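/- Conventions. Let $n\ge 1$ and let $M$ be a smooth $n$-manifold (Hausdorff, second countable, without boundary). For $p\in M$ let $q_0\colon\widehat M\to M$ be the classical real blowup of $M$ at $p$: as a set $\widehat M=(M\setminus\{p\})\sqcup \mathbf P(T_pM)$, where a neighbourhood of $\mathbf P(T_pM)$ is glued in through a chart centred at $p$ from the model $\{(x,\ell)\in\mathbf R^n\times\mathbf P(\mathbf R^n): x\in \ell\}$, and $q_0$ is the identity off $\mathbf P(T_pM)$ and collapses $\mathbf P(T_pM)$ to $p$. A diffeomorphism $g$ of $M$ with $g(p)=p$ lifts to $\widehat g\colon\widehat M\to\widehat M$, equal to $g$ on $M\setminus\{p\}$ and to the projectivized derivative $\mathbf P(Dg|_p)$ on $\mathbf P(T_pM)$. A topological blowup of $M$ at $p$ is a quotient map $q\colon V\to M$ from an $n$-manifold $V$ such that $\Sigma=q^{-1}(p)$ is nonempty, connected and compact and $q$ restricts to a homeomorphism $V\setminus\Sigma\to M\setminus\{p\}$; a topological blowup of a self-map $h$ of $M$ with $h(p)=p$ is such a $q$ together with a continuous map $\widetilde h\colon V\to V$ satisfying $q\circ\widetilde h=h\circ q$. It is called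 conjugacy-induced if $V=\widehat M$ and there are a ($C^\infty$) diffeomorphism $g$ of $M$ with a hyperbolic fixed point at $p$ and a homeomorphism $\varphi\colon M\to M$ with $\varphi(p)=p$ and $\varphi\circ g=h\circ\varphi$ on a neighbourhood of $p$, such that $q=\varphi\circ q_0$ and $\widetilde h=\widehat g$ on a neighbourhood of $\Sigma$. Proposition. Let $h\colon M\to M$ be a $C^1$ diffeomorphism with a hyperbolic fixed point $p$ (so $Dh|_p$ has no complex eigenvalue of modulus $1$, and $p$ is an isolated fixed point). Let $E^s,E^u\subseteq T_pM$ be the stable and unstable subspaces of $Dh|_p$; suppose that both are even-dimensional and that $Dh|_p$ preserves the orientation of each of them, i.e. $\det(Dh|_p|_{E^s})>0$ and $\det(Dh|_p|_{E^u})>0$. Then: (a) there is a conjugacy-induced topological blowup $(q,\widetilde h)$ of $h$ at $p$, with $\widetilde h$ a homeomorphism, such that $\Sigma\cap\operatorname{Fix}(\widetilde h)=\emptyset$; (b) for every even $k$ with $2\le k\le n$ there is one such that $\Sigma\cap\operatorname{Fix}(\widetilde h)$ is discrete and has exactly $k$ points; (c) for every integer $d$ with $1\le d\le \max(\dim E^u,\dim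 E^s)-1$ there is one such that $\Sigma\cap\operatorname{Fix}(\widetilde h)$ has dimension $d$, i.e. is a disjoint union of topological manifolds of dimensions at most $d$, with $d$ attained. -/

import Mathlib

open Set Filter Topology
open scoped Manifold ContDiff LinearAlgebra.Projectivization

noncomputable section

namespace PointBlowup

/-- The model space `ℝⁿ` with its Euclidean norm. -/
abbrev Eu (n : ℕ) : Type := EuclideanSpace ℝ (Fin n)

/-! ### Projective space and the model blowup of the origin -/

/-- The quotient topology on the projectivization of a real topological vector space. -/
instance projTopology (V : Type*) [AddCommGroup V] [Module ℝ V] [TopologicalSpace V] :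
    TopologicalSpace (ℙ ℝ V) :=
  inferInstanceAs (TopologicalSpace (Quotient (projectivizationSetoid ℝ V)))

/-- The model blowup of `ℝⁿ` at the origin: pairs of a vector and a line through the origin
containing that vector. -/
def Model (n : ℕ) : Type := {z : Eu n × ℙ ℝ (Eu n) // z.1 ∈ z.2.submodule}

instance (n : ℕ) : TopologicalSpace (Model n) :=
  inferInstanceAs (TopologicalSpace {z : Eu n × ℙ ℝ (Eu n) // z.1 ∈ z.2.submodule})

/-! ### The classical blowup of a manifold at a point -/

section Blowup

variable {n : ℕ} {M : Type*} [TopologicalSpace M] [ChartedSpace (Eu n) M]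

/-- The underlying set of the classical (real) blowup of `M` at `p`: the point `p` is replaced by
the projective space of lines in the tangent space `T_p M`. -/
inductive Blowup (n : ℕ) {M : Type*} [TopologicalSpace M] [ChartedSpace (Eu n) M] (p : M) :
    Type _ where
  | off (x : {x : M // x ≠ p}) : Blowup n p
  | exc (l : ℙ ℝ (TangentSpace (𝓡 n) p)) : Blowup n p

/-- The part of the model blowup lying over the image of the chart at `p`, translated so that `p`
corresponds to the origin. -/
def ModelPart (n : ℕ) {M : Type*} [TopologicalSpace M] [ChartedSpace (Eu n) M] (p : M) : Type :=
  {z : Model n // chartAt (Eu n) p p + z.1.1 ∈ (chartAt (Eu n) p).target}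

instance (p : M) : TopologicalSpace (ModelPart n p) :=
  inferInstanceAs (TopologicalSpace
    {z : Model n // chartAt (Eu n) p p + z.1.1 ∈ (chartAt (Eu n) p).target})

lemma chart_symm_ne {p : M} {x : Eu n}
    (hx : chartAt (Eu n) p p + x ∈ (chartAt (Eu n) p).target) (h0 : x ≠ 0) :
    (chartAt (Eu n) p).symm (chartAt (Eu n) p p + x) ≠ p := by
  intro h
  apply h0
  have h1 := (chartAt (Eu n) p).right_inv hx
  rw [h] at h1
  simpa using h1.symm

open Classical in
/-- The parametrization of a neighbourhood of the exceptional locus by the model blowup. A line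
in `ℝⁿ` is a line in `T_p M`, because `T_p M` is identified with `ℝⁿ` through the chart at `p`. -/
def modelMap (p : M) (z : ModelPart n p) : Blowup n p :=
  if h : z.1.1.1 = 0 then
    Blowup.exc (show ℙ ℝ (TangentSpace (𝓡 n) p) from z.1.1.2)
  else
    Blowup.off ⟨(chartAt (Eu n) p).symm (chartAt (Eu n) p p + z.1.1.1), chart_symm_ne z.2 h⟩

/-- The blowup is glued from `M ∖ {p}` and the model: a set is open if and only if its preimages
in both pieces are open. -/
instance (p : M) : TopologicalSpace (Blowup n p) :=
  TopologicalSpace.coinduced (Blowup.off : {x : M // x ≠ p} → Blowup n p) inferInstance ⊔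
    TopologicalSpace.coinduced (modelMap p : ModelPart n p → Blowup n p) inferInstance

/-- The classical blowdown map. -/
def blowdown (p : M) : Blowup n p → M
  | .off x => x
  | .exc _ => p

/-- The derivative, at a fixed point, of a diffeomorphism, as an automorphism of `T_p M`. -/
def derivAt {k : WithTop ℕ∞} (hk : k ≠ 0) (g : M ≃ₘ^k⟮𝓡 n, 𝓡 n⟯ M) (p : M) (_hp : g p = p) :
    TangentSpace (𝓡 n) p ≃L[ℝ] TangentSpace (𝓡 n) p :=
  g.mfderivToContinuousLinearEquiv hk p

/-- The classical lift of a diffeomorphism `g` fixing `p` to the blowup: it is `g` on `M ∖ {p}` and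
the projectivized derivative of `g` at `p` on the exceptional locus. -/
def classicalLift {k : WithTop ℕ∞} (hk : k ≠ 0) (g : M ≃ₘ^k⟮𝓡 n, 𝓡 n⟯ M) (p : M) (hp : g p = p) :
    Blowup n p → Blowup n p
  | .off x => .off ⟨g x.1, fun h => x.2 (g.injective (h.trans hp.symm))⟩
  | .exc l => .exc (Projectivization.map (derivAt hk g p hp).toLinearEquiv.toLinearMap
      (derivAt hk g p hp).injective l)

end Blowup

/-! ### Hyperbolic linear automorphisms -/

section Linear

variable {V : Type*} [AddCommGroup V] [Module ℝ V] [TopologicalSpace V] [IsTopologicalAddGroup V]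
  [ContinuousSMul ℝ V]

/-- The stable subspace of a linear automorphism: the vectors whose forward orbit tends to `0`. -/
def stableSubspace (A : V ≃L[ℝ] V) : Submodule ℝ V where
  carrier := {v | Tendsto (fun k : ℕ => A^[k] v) atTop (𝓝 0)}
  zero_mem' := by
    have h : ∀ k : ℕ, A^[k] 0 = 0 := fun k => Function.iterate_fixed (map_zero A) k
    simpa [h] using (tendsto_const_nhds : Tendsto (fun _ : ℕ => (0 : V)) atTop (𝓝 0))
  add_mem' := by
    intro a b ha hb
    have h : ∀ k : ℕ, A^[k] (a + b) = A^[k] a + A^[k] b := fun k => iterate_map_add A k a b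
    simpa [h] using Tendsto.add ha hb
  smul_mem' := by
    intro c a ha
    have h : ∀ k : ℕ, A^[k] (c • a) = c • A^[k] a := by
      intro k
      induction k with
      | zero => rfl
      | succ k ih => rw [Function.iterate_succ_apply', Function.iterate_succ_apply', ih, map_smul]
    simpa [h] using Tendsto.const_smul ha c

/-- The unstable subspace: the vectors whose backward orbit tends to `0`. -/
def unstableSubspace (A : V ≃L[ℝ] V) : Submodule ℝ V := stableSubspace A.symm

lemma map_mem_stable (A : V ≃L[ℝ] V) : ∀ v ∈ stableSubspace A, A v ∈ stableSubspace A := by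
  intro v hv
  have h : Tendsto (fun k : ℕ => A^[k + 1] v) atTop (𝓝 0) := (tendsto_add_atTop_iff_nat 1).2 hv
  exact h

lemma map_mem_unstable (A : V ≃L[ℝ] V) :
    ∀ v ∈ unstableSubspace A, A v ∈ unstableSubspace A := by
  intro v hv
  refine (tendsto_add_atTop_iff_nat 1).1 (?_ : Tendsto (fun k : ℕ => A.symm^[k + 1] (A v)) atTop _)
  have h : (fun k : ℕ => A.symm^[k + 1] (A v)) = fun k : ℕ => A.symm^[k] v := by
    funext k
    rw [Function.iterate_succ_apply, A.symm_apply_apply]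
  rw [h]
  exact hv

/-- The linear automorphism preserves the orientation of its stable subspace. -/
def PreservesStableOrientation (A : V ≃L[ℝ] V) : Prop :=
  0 < LinearMap.det ((A.toLinearEquiv.toLinearMap).restrict (map_mem_stable A))

/-- The linear automorphism preserves the orientation of its unstable subspace. -/
def PreservesUnstableOrientation (A : V ≃L[ℝ] V) : Prop :=
  0 < LinearMap.det ((A.toLinearEquiv.toLinearMap).restrict (map_mem_unstable A))

/-- Hyperbolicity: no complex eigenvalue has modulus one. -/
def IsHyperbolic [Module.Finite ℝ V] [Module.Free ℝ V] (A : V ≃L[ℝ] V) : Prop :=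
  ∀ z : ℂ, ((A.toLinearEquiv.toLinearMap).charpoly.map (algebraMap ℝ ℂ)).IsRoot z → ‖z‖ ≠ 1

end Linear

instance {n : ℕ} {M : Type*} [TopologicalSpace M] [ChartedSpace (Eu n) M] (p : M) :
    Module.Finite ℝ (TangentSpace (𝓡 n) p) :=
  inferInstanceAs (Module.Finite ℝ (Eu n))

/-! ### Topological blowups -/

/-- A topological `n`-manifold (without boundary). -/
structure IsTopManifold (n : ℕ) (V : Type*) [TopologicalSpace V] : Prop where
  t2 : T2Space V
  secondCountable : SecondCountableTopology V
  locallyEuclidean : ∀ v : V, ∃ U : Set V, IsOpen U ∧ v ∈ U ∧ Nonempty (U ≃ₜ Eu n)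

/-- `q : V → M` is a topological blowup, at the point `p`, of the `n`-manifold `M`. -/
structure IsTopologicalBlowup (n : ℕ) {V M : Type*} [TopologicalSpace V] [TopologicalSpace M]
    (q : V → M) (p : M) : Prop where
  manifold : IsTopManifold n V
  quotient : IsQuotientMap q
  connected : IsConnected (q ⁻¹' {p})
  compact : IsCompact (q ⁻¹' {p})
  homeo : ∃ e : {v : V // v ∉ q ⁻¹' {p}} ≃ₜ {x : M // x ≠ p}, ∀ v, (e v : M) = q v

/-- `q : V → M` together with `f' : V → V` is a topological blowup of the self-map `f` of the
`n`-manifold `M` at its fixed point `p`. -/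
structure IsMapBlowup (n : ℕ) {V M : Type*} [TopologicalSpace V] [TopologicalSpace M]
    (q : V → M) (f' : V → V) (f : M → M) (p : M) : Prop where
  fixed : f p = p
  blowup : IsTopologicalBlowup n q p
  continuous : Continuous f'
  commutes : q ∘ f' = f ∘ q

/-- A topological blowup `(q, h')` of `h` at `p`, defined on the classical blowup of `M` at `p`, is
induced by a conjugacy if there are a diffeomorphism `g` of `M` with a hyperbolic fixed point at
`p` and a homeomorphism `φ` of `M` fixing `p` that conjugates `g` to `h` near `p`, such that the
blowdown map `q` is `φ` composed with the classical blowdown map, and `h'` is, near the exceptional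
locus, the classical lift of `g`. -/
structure IsConjugacyInduced {n : ℕ} {M : Type*} [TopologicalSpace M] [ChartedSpace (Eu n) M]
    (h : M → M) (p : M) (q : Blowup n p → M) (h' : Blowup n p → Blowup n p) : Prop where
  blowup : IsMapBlowup n q h' h p
  induced : ∃ (g : M ≃ₘ^∞⟮𝓡 n, 𝓡 n⟯ M) (hg : g p = p) (φ : M ≃ₜ M),
    IsHyperbolic (derivAt (by simp) g p hg) ∧
    φ p = p ∧
    (∀ᶠ x in 𝓝 p, φ (g x) = h (φ x)) ∧
    q = φ ∘ blowdown p ∧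
    ∀ᶠ v in 𝓝ˢ (q ⁻¹' {p}), h' v = classicalLift (by simp) g p hg v

/-- The set of fixed points of the lift `h'` on the exceptional locus of `q` over `p`. -/
def excFix {V M : Type*} (q : V → M) (h' : V → V) (p : M) : Set V :=
  (q ⁻¹' {p}) ∩ Function.fixedPoints h'

/-- `X` is a disjoint union of topological manifolds of dimensions at most `d`, the dimension `d`
being attained. -/
def HasManifoldDim (d : ℕ) (X : Type*) [TopologicalSpace X] : Prop :=
  (∀ x : X, ∃ m ≤ d, ∃ U : Set X, IsOpen U ∧ x ∈ U ∧ Nonempty (U ≃ₜ Eu m)) ∧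
  ∃ x : X, ∃ U : Set X, IsOpen U ∧ x ∈ U ∧ Nonempty (U ≃ₜ Eu d)

end PointBlowup

end

noncomputable section

set_option linter.unusedSectionVars false

namespace PointBlowup

/-! ### Connectedness of the group of orientation preserving linear automorphisms -/

section GLPos

/-! A topological conjugacy near a hyperbolic fixed point remembers very little of the derivative,
whereas the classical lift sees its eigenlines. So the derivative `A` of `h` may be traded for any
hyperbolic `B` in the same connected family, and `B` is chosen so that its action on projective
space has the desired fixed points.

The trade. `A` is a product of a stable automorphism of E^s and the inverse of a stable automorphism
of E^u (`IsHyperbolic.exists_eq_splitMap`). Positive determinants put both factors in the identity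
component, and the stable automorphisms in that component form a connected set
(`joinedIn_stableAut`): scaling by a small constant turns any path of automorphisms into a path of
contractions. The local Hartman–Grobman theorem (`SplitHyperbolic.germConj`) makes germ conjugacy an
open relation on this family, so connectedness gives a conjugacy from `A` to every `B` in it
(`germConj_splitMap`). All conjugacies are squashed to have support in a small ball, hence extend to
homeomorphisms of `M` through a chart. As `B` lies in the identity component, its germ also extends
to a smooth diffeomorphism `g` of `M` (`exists_supportedDiffeo`); `exists_conjugate_diffeo` collects
this.

The lift. With φ conjugating `g` to `h` near `p`, the map φ⁻¹hφ is globally defined and equals `B`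
in the chart near `p`, so it lifts to a homeomorphism of the blowup acting on the exceptional locus
by the projectivization of `B` (`exists_isConjugacyInduced`).

The count. Fixed lines are eigenlines, and an eigenspace of dimension m+1 contributes a projective
space of dimension m (`hasManifoldDim_fixedPoints`, `ncard_fixedPoints`). In an even-dimensional
space any even number of real eigenvalues in (0,1) can be prescribed, the other dimensions being
filled by multiplication by i/2 on copies of ℂ (`exists_mem_stableAut_eigenDim`). No real eigenvalue
gives (a), k simple ones give (b), and one of multiplicity d+1 with all others simple gives (c). -/

lemma JoinedIn.mul_isUnit {𝓐 : Type*} [Monoid 𝓐] [TopologicalSpace 𝓐] [ContinuousMul 𝓐]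
    {a b c d : 𝓐} (h : JoinedIn {x : 𝓐 | IsUnit x} a b) (h' : JoinedIn {x : 𝓐 | IsUnit x} c d) :
    JoinedIn {x : 𝓐 | IsUnit x} (a * c) (b * d) := by
  obtain ⟨γ, hγ⟩ := h
  obtain ⟨γ', hγ'⟩ := h'
  exact ⟨γ.mul γ', fun t => (hγ t).mul (hγ' t)⟩

variable {ι : Type*} [DecidableEq ι]

/-- The diagonal matrix with entry `x` at `i` and all other diagonal entries equal to one. -/
def diagSingle (i : ι) (x : ℝ) : Matrix ι ι ℝ := Matrix.diagonal (Function.update 1 i x)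

lemma continuous_diagSingle (i : ι) : Continuous (diagSingle i : ℝ → Matrix ι ι ℝ) :=
  Continuous.matrix_diagonal (continuous_const.update i continuous_id)

variable [Fintype ι]

lemma det_diagSingle (i : ι) (x : ℝ) : (diagSingle i x).det = x := by
  rw [diagSingle, Matrix.det_diagonal, Finset.prod_update_of_mem (Finset.mem_univ i)]
  simp

lemma isUnit_diagSingle (i : ι) {x : ℝ} (hx : x ≠ 0) : IsUnit (diagSingle i x) := by
  rw [Matrix.isUnit_iff_isUnit_det, det_diagSingle]
  exact hx.isUnit

lemma joinedIn_diagSingle (i : ι) {x y : ℝ} (h : 0 < x * y) :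
    JoinedIn {M : Matrix ι ι ℝ | IsUnit M} (diagSingle i x) (diagSingle i y) := by
  refine JoinedIn.ofLine (f := fun t : ℝ => diagSingle i ((1 - t) * x + t * y)) ?_ (by simp)
    (by simp) ?_
  · exact ((continuous_diagSingle i).comp (by fun_prop)).continuousOn
  · rintro _ ⟨t, ⟨h0, h1⟩, rfl⟩
    refine isUnit_diagSingle i fun h2 => ?_
    -- Multiplying by `x` turns the claim into (1-t)x² + t·xy > 0, which covers both signs at once.
    have h3 : 0 < ((1 - t) * x + t * y) * x := by
      rcases eq_or_lt_of_le h0 with h4 | h4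
      · subst h4
        have : x ≠ 0 := by rintro rfl; simp at h
        have := mul_self_pos.2 this
        nlinarith
      · have := mul_self_nonneg x
        have : 0 ≤ (1 - t) * (x * x) := mul_nonneg (by linarith) this
        have : 0 < t * (x * y) := mul_pos h4 h
        nlinarith
    rw [h2] at h3
    simp at h3

/-- The orthogonal reflection along a vector. -/
def reflectionMatrix (v : ι → ℝ) : Matrix ι ι ℝ :=
  1 - (2 / (v ⬝ᵥ v)) • Matrix.vecMulVec v v

lemma reflectionMatrix_mul_self {v : ι → ℝ} (hv : v ≠ 0) :
    reflectionMatrix v * reflectionMatrix v = 1 := by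
  have h : v ⬝ᵥ v ≠ 0 := by simpa using hv
  rw [reflectionMatrix, sub_mul, mul_sub, mul_sub, one_mul, mul_one, one_mul, smul_mul_smul_comm,
    Matrix.vecMulVec_mul_vecMulVec, Matrix.vecMulVec_smul, smul_smul]
  have : 2 / v ⬝ᵥ v * (2 / v ⬝ᵥ v) * v ⬝ᵥ v = 2 / v ⬝ᵥ v + 2 / v ⬝ᵥ v := by field_simp; ring
  rw [this, add_smul]
  abel

lemma reflectionMatrix_single (i : ι) :
    reflectionMatrix (Pi.single i (1 : ℝ)) = diagSingle i (-1) := by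
  ext a b
  simp only [reflectionMatrix, diagSingle, Matrix.sub_apply, Matrix.smul_apply,
    Matrix.vecMulVec_apply, Matrix.one_apply, Matrix.diagonal_apply, Function.update_apply,
    Pi.single_apply, dotProduct, Pi.one_apply]
  by_cases h1 : a = b <;> by_cases h2 : a = i <;> by_cases h3 : b = i <;> simp_all
  norm_num

/-- The axis of the reflection is moved along the segment from one basis vector to the other. The
segment misses the origin, and each reflection is its own inverse, so the path never leaves the
units. -/
lemma joinedIn_reflection (i j : ι) :
    JoinedIn {M : Matrix ι ι ℝ | IsUnit M} (diagSingle i (-1)) (diagSingle j (-1)) := by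
  by_cases hij : i = j
  · subst hij
    exact JoinedIn.refl (isUnit_diagSingle i (by norm_num))
  let v : ℝ → ι → ℝ := fun t => (1 - t) • Pi.single i (1 : ℝ) + t • Pi.single j (1 : ℝ)
  have hv : ∀ t, v t ≠ 0 := by
    intro t h
    have h1 := congrFun h i
    have h2 := congrFun h j
    simp [v, hij, Ne.symm hij] at h1 h2
    simp [h2] at h1
  have hvc : Continuous v := by fun_prop
  refine JoinedIn.ofLine (f := fun t : ℝ => reflectionMatrix (v t)) ?_ ?_ ?_ ?_
  · refine Continuous.continuousOn ?_
    unfold reflectionMatrix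
    refine continuous_const.sub (Continuous.fun_smul ?_ (Continuous.matrix_vecMulVec hvc hvc))
    exact continuous_const.div (hvc.dotProduct hvc) fun t => by simpa using hv t
  · simp [v, reflectionMatrix_single]
  · simp [v, reflectionMatrix_single]
  · rintro _ ⟨t, -, rfl⟩
    exact IsUnit.of_mul_eq_one _ (reflectionMatrix_mul_self (hv t))

/-- The alternative is stable under products, so Gaussian elimination reduces it to diagonal
matrices and transvections. -/
lemma joinedIn_one_or_reflection (M : Matrix ι ι ℝ) (hM : M.det ≠ 0) :
    JoinedIn {M : Matrix ι ι ℝ | IsUnit M} M 1 ∨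
      ∃ i, JoinedIn {M : Matrix ι ι ℝ | IsUnit M} M (diagSingle i (-1)) := by
  have hmul : ∀ A B : Matrix ι ι ℝ,
      (JoinedIn {M : Matrix ι ι ℝ | IsUnit M} A 1 ∨
        ∃ i, JoinedIn {M : Matrix ι ι ℝ | IsUnit M} A (diagSingle i (-1))) →
      (JoinedIn {M : Matrix ι ι ℝ | IsUnit M} B 1 ∨
        ∃ i, JoinedIn {M : Matrix ι ι ℝ | IsUnit M} B (diagSingle i (-1))) →
      (JoinedIn {M : Matrix ι ι ℝ | IsUnit M} (A * B) 1 ∨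
        ∃ i, JoinedIn {M : Matrix ι ι ℝ | IsUnit M} (A * B) (diagSingle i (-1))) := by
    rintro A B (hA | ⟨i, hA⟩) (hB | ⟨j, hB⟩)
    · exact .inl (by simpa using JoinedIn.mul_isUnit hA hB)
    · exact .inr ⟨j, by simpa using JoinedIn.mul_isUnit hA hB⟩
    · exact .inr ⟨i, by simpa using JoinedIn.mul_isUnit hA hB⟩
    -- Two reflections: once the second is moved to the axis of the first, their product is the
    -- square of an involution.
    · refine .inl ?_
      have h := JoinedIn.mul_isUnit hA (hB.trans (joinedIn_reflection j i))
      rwa [← reflectionMatrix_single, reflectionMatrix_mul_self (by simp)] at h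
  have hone : JoinedIn {M : Matrix ι ι ℝ | IsUnit M} 1 1 := JoinedIn.refl isUnit_one
  have hd1 : ∀ i : ι, diagSingle i 1 = 1 := fun i => by simp [diagSingle]
  refine Matrix.diagonal_transvection_induction_of_det_ne_zero _ M hM ?_ ?_
    fun A B _ _ => hmul A B
  · intro D hD
    rw [Matrix.det_diagonal, Finset.prod_ne_zero_iff] at hD
    -- The diagonal entries are inserted one at a time; each factor deforms to 1 or to a reflection
    -- according to the sign of its entry.
    have key : ∀ s : Finset ι,
      (JoinedIn {M : Matrix ι ι ℝ | IsUnit M} (Matrix.diagonal (s.piecewise D 1)) 1 ∨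
        ∃ i, JoinedIn {M : Matrix ι ι ℝ | IsUnit M} (Matrix.diagonal (s.piecewise D 1))
          (diagSingle i (-1))) := by
      intro s
      induction s using Finset.induction_on with
      | empty => left; simpa using hone
      | insert j s hj ih =>
        have h1 : Matrix.diagonal ((insert j s).piecewise D 1)
            = Matrix.diagonal (s.piecewise D 1) * diagSingle j (D j) := by
          rw [diagSingle, Matrix.diagonal_mul_diagonal]
          congr 1
          funext a
          by_cases ha : a = j
          · subst ha; simp [hj]
          · simp [Finset.piecewise, ha]
        rw [h1]
        refine hmul _ _ ih ?_
        rcases lt_or_gt_of_ne (hD j (Finset.mem_univ j)) with h2 | h2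
        · exact .inr ⟨j, joinedIn_diagSingle j (by linarith)⟩
        · left
          rw [← hd1 j]
          exact joinedIn_diagSingle j (by linarith)
    simpa using key Finset.univ
  · intro t
    left
    refine JoinedIn.ofLine (f := fun x : ℝ => Matrix.transvection t.i t.j ((1 - x) * t.c)) ?_
      (by simp [Matrix.TransvectionStruct.toMatrix]) (by simp) ?_
    · refine Continuous.continuousOn ?_
      unfold Matrix.transvection
      refine continuous_const.add ?_
      refine continuous_matrix fun a b => ?_
      simp only [Matrix.single_apply]
      split_ifs <;> fun_prop
    · rintro _ ⟨x, -, rfl⟩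
      change IsUnit _
      rw [Matrix.isUnit_iff_isUnit_det, Matrix.det_transvection_of_ne _ _ t.hij]
      exact isUnit_one

/-- A path to a reflection would carry the determinant from a positive value to -1, hence through 0,
where invertibility fails. -/
lemma joinedIn_one_of_det_pos {M : Matrix ι ι ℝ} (hM : 0 < M.det) :
    JoinedIn {M : Matrix ι ι ℝ | IsUnit M} M 1 := by
  rcases joinedIn_one_or_reflection M hM.ne' with h | ⟨i, γ, hγ⟩
  · exact h
  · exfalso
    have hc : Continuous fun t => (γ t).det := γ.continuous.matrix_det
    have h1 : (0 : ℝ) ∈ range fun t => (γ t).det := by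
      refine mem_range_of_exists_le_of_exists_ge hc ⟨1, ?_⟩ ⟨0, ?_⟩
      · simp [det_diagSingle]
      · simpa using hM.le
    obtain ⟨t, ht⟩ := h1
    have := hγ t
    change IsUnit _ at this
    rw [Matrix.isUnit_iff_isUnit_det] at this
    exact this.ne_zero ht

/-- An orientation preserving automorphism of a finite-dimensional space is joined to the
identity by a path of automorphisms. -/
theorem joinedIn_one_of_linearMap_det_pos {E : Type*} [NormedAddCommGroup E] [NormedSpace ℝ E]
    [FiniteDimensional ℝ E] {T : E →L[ℝ] E} (hT : 0 < LinearMap.det (T : E →ₗ[ℝ] E)) :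
    JoinedIn {S : E →L[ℝ] E | IsUnit S} T 1 := by
  let b := Module.finBasis ℝ E
  obtain ⟨γ, hγ⟩ := joinedIn_one_of_det_pos (M := LinearMap.toMatrixAlgEquiv b T)
    (by change 0 < (LinearMap.toMatrix b b T).det; rwa [LinearMap.det_toMatrix])
  -- As a continuous algebra homomorphism, `F` carries paths of units to paths of units.
  let F : Matrix _ _ ℝ →ₐ[ℝ] (E →L[ℝ] E) :=
    (Module.End.toContinuousLinearMap (𝕜 := ℝ) E).toAlgHom.comp
      (Matrix.toLinAlgEquiv b).toAlgHom
  have hF : Continuous F := LinearMap.continuous_of_finiteDimensional F.toLinearMap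
  have h0 : F (LinearMap.toMatrixAlgEquiv b T) = T := by
    ext x
    simp [F]
    rfl
  refine ⟨(γ.map hF).cast h0.symm (map_one F).symm, fun t => ?_⟩
  exact (hγ t).map F

end GLPos

/-! ### Linear maps all of whose orbits tend to zero -/

section Stable

variable {E : Type*} [NormedAddCommGroup E] [NormedSpace ℝ E]

/-- All orbits of the linear map tend to zero. -/
def OrbitStable (T : E →L[ℝ] E) : Prop := ∀ v, Tendsto (fun k : ℕ => (T ^ k) v) atTop (𝓝 0)

/-- In finite dimension the operator norm is controlled by the values on a basis, so pointwise
convergence is uniform. -/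
lemma OrbitStable.tendsto_norm_pow [FiniteDimensional ℝ E] {T : E →L[ℝ] E} (hT : OrbitStable T) :
    Tendsto (fun k : ℕ => ‖T ^ k‖) atTop (𝓝 0) := by
  let b := Module.finBasis ℝ E
  obtain ⟨C, hC, h⟩ := b.exists_opNorm_le (F := E)
  have h1 : Tendsto (fun k : ℕ => C * ∑ i, ‖(T ^ k) (b i)‖) atTop (𝓝 (C * ∑ _i : Fin (Module.finrank ℝ E), 0)) := by
    refine Tendsto.const_mul _ (tendsto_finsetSum _ fun i _ => ?_)
    simpa using (hT (b i)).norm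
  rw [Finset.sum_const_zero, mul_zero] at h1
  refine squeeze_zero (fun _ => norm_nonneg _) (fun k => ?_) h1
  refine h (Finset.sum_nonneg fun _ _ => norm_nonneg _) fun i => ?_
  exact Finset.single_le_sum (f := fun i => ‖(T ^ k) (b i)‖) (fun _ _ => norm_nonneg _)
    (Finset.mem_univ i)

lemma OrbitStable.smul {T : E →L[ℝ] E} (hT : OrbitStable T) {c : ℝ} (h0 : 0 ≤ c) (h1 : c ≤ 1) :
    OrbitStable (c • T) := by
  intro v
  refine squeeze_zero_norm (fun k => ?_) (tendsto_zero_iff_norm_tendsto_zero.1 (hT v))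
  rw [smul_pow, smul_apply, norm_smul, Real.norm_of_nonneg (pow_nonneg h0 k)]
  exact mul_le_of_le_one_left (norm_nonneg ((T ^ k) v)) (pow_le_one₀ h0 h1)

lemma orbitStable_of_norm_lt_one {T : E →L[ℝ] E} (hT : ‖T‖ < 1) : OrbitStable T := by
  intro v
  have h := tendsto_pow_atTop_nhds_zero_of_norm_lt_one hT
  have h2 := ((ContinuousLinearMap.apply ℝ E v).continuous.tendsto 0).comp h
  rw [map_zero] at h2
  exact h2

/-- A linear map all of whose orbits tend to zero is a contraction for an equivalent norm. -/
theorem OrbitStable.exists_adapted_norm {E : Type} [NormedAddCommGroup E] [NormedSpace ℝ E]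
    [FiniteDimensional ℝ E] {T : E →L[ℝ] E} (hT : OrbitStable T) :
    ∃ (F : Type) (_ : NormedAddCommGroup F) (_ : NormedSpace ℝ F) (e : E ≃L[ℝ] F),
      ‖(e : E →L[ℝ] F) ∘L T ∘L (e.symm : F →L[ℝ] E)‖ < 1 := by
  have h1 : ∀ᶠ k : ℕ in atTop, ‖T ^ k‖ < 1 / 2 :=
    hT.tendsto_norm_pow.eventually_lt_const (by norm_num)
  -- The weight `c` constructed next satisfies c^N = 2, so that it is exactly compensated by ‖T^N‖ <
  -- 1/2.
  obtain ⟨N, hN, hN1⟩ := (h1.and (eventually_ge_atTop 1)).exists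
  obtain ⟨c, hc1, hcN⟩ : ∃ c : ℝ, 1 < c ∧ c ^ N = 2 :=
    ⟨2 ^ ((N : ℝ)⁻¹), Real.one_lt_rpow (by norm_num) (by positivity),
      Real.rpow_inv_natCast_pow (by norm_num) (by omega)⟩
  have hc0 : 0 < c := by linarith
  -- The adapted norm is the supremum of the weighted orbit segment c^k T^k v, k < N. Applying `T`
  -- shifts this segment and gains a factor 1/c.
  let Φ : E →ₗ[ℝ] (Fin N → E) := LinearMap.pi fun k => c ^ (k : ℕ) • ((T ^ (k : ℕ) : E →L[ℝ] E) :
    E →ₗ[ℝ] E)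
  have hΦ : ∀ v (k : Fin N), Φ v k = c ^ (k : ℕ) • (T ^ (k : ℕ)) v := fun v k => rfl
  have hinj : Function.Injective Φ := by
    intro v w h
    have := congrFun h ⟨0, hN1⟩
    simpa [hΦ] using this
  let e := (LinearEquiv.ofInjective Φ hinj).toContinuousLinearEquiv
  have he : ∀ v, ((e v : LinearMap.range Φ) : Fin N → E) = Φ v := fun v => rfl
  refine ⟨LinearMap.range Φ, inferInstance, inferInstance, e, ?_⟩
  refine lt_of_le_of_lt (ContinuousLinearMap.opNorm_le_bound _ (inv_nonneg.2 hc0.le) fun y => ?_)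
    (inv_lt_one_of_one_lt₀ hc1)
  obtain ⟨v, rfl⟩ := e.surjective y
  simp only [ContinuousLinearMap.comp_apply, ContinuousLinearEquiv.coe_coe,
    ContinuousLinearEquiv.symm_apply_apply]
  rw [Submodule.coe_norm, Submodule.coe_norm, he, he]
  refine (pi_norm_le_iff_of_nonneg (by positivity)).2 fun k => ?_
  have h3 : c ^ (k : ℕ) • (T ^ (k : ℕ)) (T v) = c⁻¹ • (c ^ (k + 1 : ℕ) • (T ^ (k + 1 : ℕ)) v) := by
    rw [smul_smul, pow_succ T, pow_succ', inv_mul_cancel_left₀ hc0.ne']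
    rfl
  rw [hΦ, h3, norm_smul, Real.norm_of_nonneg (inv_nonneg.2 hc0.le)]
  gcongr
  -- Only the last entry leaves the segment; there c^N‖T^N v‖ is bounded by ‖v‖, the entry of index
  -- 0.
  by_cases hk : (k : ℕ) + 1 < N
  · exact norm_le_pi_norm (Φ v) ⟨k + 1, hk⟩
  · have hk' : (k : ℕ) + 1 = N := by omega
    rw [hk', hcN, norm_smul]
    calc ‖(2 : ℝ)‖ * ‖(T ^ N) v‖ ≤ 2 * ((1 / 2) * ‖v‖) := by
          rw [Real.norm_of_nonneg (by norm_num)]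
          gcongr
          exact (T ^ N).le_of_opNorm_le hN.le v
      _ = ‖Φ v ⟨0, hN1⟩‖ := by simp [hΦ]
      _ ≤ ‖Φ v‖ := norm_le_pi_norm (Φ v) _

variable (E) in
/-- The automorphisms with all orbits tending to zero, joined to the identity by a path of
automorphisms. -/
def stableAut : Set (E →L[ℝ] E) :=
  {T | OrbitStable T ∧ T ∈ pathComponentIn {S : E →L[ℝ] E | IsUnit S} 1}

lemma isUnit_of_mem_pathComponentIn {T : E →L[ℝ] E}
    (hT : T ∈ pathComponentIn {S : E →L[ℝ] E | IsUnit S} 1) : IsUnit T :=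
  pathComponentIn_subset (F := {S : E →L[ℝ] E | IsUnit S}) hT

lemma isUnit_smul_of_pos {T : E →L[ℝ] E} (hT : IsUnit T) {c : ℝ} (h0 : 0 < c) :
    IsUnit (c • T) := by
  have := (IsUnit.smul (Units.mk0 c h0.ne') hT)
  exact this

lemma smul_mem_pathComponentIn {T : E →L[ℝ] E}
    (hT : T ∈ pathComponentIn {S : E →L[ℝ] E | IsUnit S} 1) {c : ℝ} (h0 : 0 < c) :
    c • T ∈ pathComponentIn {S : E →L[ℝ] E | IsUnit S} 1 := by
  refine JoinedIn.trans hT (JoinedIn.ofLine (f := fun t : ℝ => ((1 - t) + t * c) • T) ?_ (by simp)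
    (by simp) ?_)
  · fun_prop
  · rintro _ ⟨t, ⟨ht0, ht1⟩, rfl⟩
    refine isUnit_smul_of_pos (isUnit_of_mem_pathComponentIn hT) ?_
    rcases eq_or_lt_of_le ht0 with h | h
    · simp [← h]
    · nlinarith [mul_pos h h0]

lemma joinedIn_stableAut_smul {T : E →L[ℝ] E} (hT : T ∈ stableAut E) {c : ℝ} (h0 : 0 < c)
    (h1 : c ≤ 1) : JoinedIn (stableAut E) T (c • T) := by
  refine JoinedIn.ofLine (f := fun t : ℝ => ((1 - t) + t * c) • T) ?_ (by simp)
    (by simp) ?_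
  · fun_prop
  · rintro _ ⟨t, ⟨ht0, ht1⟩, rfl⟩
    have h2 : 0 < (1 - t) + t * c := by
      rcases eq_or_lt_of_le ht0 with h | h
      · simp [← h]
      · nlinarith [mul_pos h h0]
    exact ⟨hT.1.smul h2.le (by nlinarith), smul_mem_pathComponentIn hT.2 h2⟩

/-- A path of automorphisms from `T` to `T'` is bounded, so a small multiple of it consists of
contractions. Shrinking `T` and `T'` radially preserves stability and connects them to the ends of
the rescaled path. -/
theorem joinedIn_stableAut {T T' : E →L[ℝ] E} (hT : T ∈ stableAut E) (hT' : T' ∈ stableAut E) :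
    JoinedIn (stableAut E) T T' := by
  obtain ⟨γ, hγ⟩ := (isPathConnected_pathComponentIn
    (show (1 : E →L[ℝ] E) ∈ {S : E →L[ℝ] E | IsUnit S} from isUnit_one)).joinedIn T hT.2 T' hT'.2
  obtain ⟨C, hC⟩ := (isCompact_range γ.continuous).isBounded.exists_norm_le
  have hC' : ∀ t, ‖γ t‖ ≤ C := fun t => hC _ (mem_range_self t)
  have hC0 : 0 ≤ C := (norm_nonneg _).trans (hC' 0)
  set c : ℝ := (C + 1)⁻¹ with hc
  have h0 : 0 < c := by positivity
  have h1 : c ≤ 1 := inv_le_one_of_one_le₀ (by linarith)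
  refine (joinedIn_stableAut_smul hT h0 h1).trans (JoinedIn.trans ?_
    (joinedIn_stableAut_smul hT' h0 h1).symm)
  refine ⟨γ.map (continuous_const_smul c), fun t => ⟨orbitStable_of_norm_lt_one ?_,
    smul_mem_pathComponentIn (hγ t) h0⟩⟩
  change ‖c • γ t‖ < 1
  rw [norm_smul, Real.norm_of_nonneg h0.le, hc, inv_mul_lt_iff₀ (by linarith)]
  linarith [hC' t]

theorem isPreconnected_stableAut : IsPreconnected (stableAut E) := by
  rcases (stableAut E).eq_empty_or_nonempty with h | ⟨T, hT⟩
  · rw [h]; exact isPreconnected_empty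
  · exact IsPathConnected.isConnected ⟨T, hT, fun _ hT' => joinedIn_stableAut hT hT'⟩
      |>.isPreconnected

end Stable

/-! ### The splitting of a hyperbolic automorphism -/

section Splitting

/-- A scalar contraction with vanishing forcing; this is the inductive step along a Jordan chain. -/
lemma tendsto_zero_of_recursion {E : Type*} [NormedAddCommGroup E] [NormedSpace ℂ E]
    {x e : ℕ → E} {r : ℂ} (hr : ‖r‖ < 1) (h : ∀ k, x (k + 1) = r • x k + e k)
    (he : Tendsto e atTop (𝓝 0)) : Tendsto x atTop (𝓝 0) := by
  rw [Metric.tendsto_atTop] at he ⊢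
  intro ε hε
  obtain ⟨N, hN⟩ := he (ε / 2 * (1 - ‖r‖)) (by have := sub_pos.2 hr; positivity)
  have h1 : ∀ j, ‖x (N + j)‖ ≤ ε / 2 + ‖r‖ ^ j * ‖x N‖ := by
    intro j
    induction j with
    | zero => simp; positivity
    | succ j ih =>
      have h2 := hN (N + j) (by omega)
      rw [dist_zero_right] at h2
      have h3 : ‖x (N + (j + 1))‖ ≤ ‖r‖ * ‖x (N + j)‖ + ‖e (N + j)‖ := by
        rw [← add_assoc, h]
        exact (norm_add_le _ _).trans (by rw [norm_smul])
      have h4 := mul_le_mul_of_nonneg_left ih (norm_nonneg r)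
      rw [pow_succ]
      nlinarith
  have h5 : Tendsto (fun j => ‖r‖ ^ j * ‖x N‖) atTop (𝓝 (0 * ‖x N‖)) :=
    (tendsto_pow_atTop_nhds_zero_of_lt_one (norm_nonneg r) hr).mul_const _
  rw [zero_mul] at h5
  obtain ⟨J, hJ⟩ := eventually_atTop.1 (h5.eventually_lt_const (half_pos hε))
  refine ⟨N + J, fun k hk => ?_⟩
  obtain ⟨j, rfl⟩ := Nat.exists_eq_add_of_le (show N ≤ k by omega)
  rw [dist_zero_right]
  have := h1 j
  have := hJ j (by omega)
  linarith

variable {E : Type*} [NormedAddCommGroup E] [NormedSpace ℂ E]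

/-- The orbit satisfies f^(k+1) w = μ f^k w + f^k (f-μ)w, and (f-μ)w has smaller nilpotency order.
-/
lemma orbit_tendsto_zero_of_genEigenvector {f : Module.End ℂ E} {μ : ℂ} (hμ : ‖μ‖ < 1) (N : ℕ) :
    ∀ w : E, ((f - μ • (1 : Module.End ℂ E)) ^ N) w = 0 →
      Tendsto (fun k : ℕ => (f ^ k) w) atTop (𝓝 0) := by
  induction N with
  | zero =>
    intro w hw
    have : w = 0 := by simpa using hw
    subst this
    simp
  | succ N ih =>
    intro w hw
    have h1 := ih ((f - μ • (1 : Module.End ℂ E)) w) (by rwa [pow_succ] at hw)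
    refine tendsto_zero_of_recursion hμ (fun k => ?_) h1
    rw [← map_smul, ← map_add, pow_succ]
    simp

/-- The same induction for the inverse, through gw = μ⁻¹w - μ⁻¹ g(f-μ)w. -/
lemma orbit_tendsto_zero_of_genEigenvector_inv {f g : Module.End ℂ E} (hgf : g * f = 1)
    {μ : ℂ} (hμ : 1 < ‖μ‖) (N : ℕ) :
    ∀ w : E, ((f - μ • (1 : Module.End ℂ E)) ^ N) w = 0 →
      Tendsto (fun k : ℕ => (g ^ k) w) atTop (𝓝 0) := by
  have h0 : μ ≠ 0 := by rintro rfl; simp at hμ; linarith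
  have hgf' : ∀ w, g (f w) = w := fun w => by
    rw [← Module.End.mul_apply, hgf]; rfl
  induction N with
  | zero =>
    intro w hw
    have : w = 0 := by simpa using hw
    subst this
    simp
  | succ N ih =>
    intro w hw
    have h1 := ih ((f - μ • (1 : Module.End ℂ E)) w) (by rwa [pow_succ] at hw)
    have h2 := ((tendsto_add_atTop_iff_nat 1).2 h1).const_smul (-μ⁻¹)
    rw [smul_zero] at h2
    refine tendsto_zero_of_recursion (r := μ⁻¹) ?_ (fun k => ?_) h2
    · rw [norm_inv]; exact inv_lt_one_of_one_lt₀ hμ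
    · rw [← map_smul, ← map_smul, pow_succ g k, Module.End.mul_apply, Module.End.mul_apply,
        ← map_add]
      congr 1
      simp [hgf', smul_sub, smul_smul, h0]

/-- Over ℂ the generalized eigenspaces span, and each is attracted to 0 by `f` or by `g`, since no
eigenvalue has modulus one. -/
lemma exists_add_of_spectrum [FiniteDimensional ℂ E] {f g : Module.End ℂ E} (hgf : g * f = 1)
    (hf : ∀ μ, f.HasEigenvalue μ → ‖μ‖ ≠ 1) (w : E) :
    ∃ s u, w = s + u ∧ Tendsto (fun k : ℕ => (f ^ k) s) atTop (𝓝 0) ∧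
      Tendsto (fun k : ℕ => (g ^ k) u) atTop (𝓝 0) := by
  have hw : w ∈ ⨆ μ : ℂ, f.maxGenEigenspace μ := by
    rw [Module.End.iSup_maxGenEigenspace_eq_top]; trivial
  induction hw using Submodule.iSup_induction' with
  | mem μ w hw =>
    by_cases h0 : w = 0
    · exact ⟨0, 0, by simp [h0], by simp, by simp⟩
    have hne : ‖μ‖ ≠ 1 := by
      refine hf μ ?_
      have : f.HasUnifEigenvalue μ ⊤ := by
        intro h
        change f.maxGenEigenspace μ = ⊥ at h
        rw [h] at hw
        exact h0 ((Submodule.mem_bot ℂ).1 hw)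
      exact this.lt (by simp)
    obtain ⟨N, hN⟩ := (Module.End.mem_maxGenEigenspace f μ w).1 hw
    rcases lt_or_gt_of_ne hne with h | h
    · exact ⟨w, 0, by simp, orbit_tendsto_zero_of_genEigenvector h N w hN,
        by simp⟩
    · exact ⟨0, w, by simp, by simp,
        orbit_tendsto_zero_of_genEigenvector_inv hgf h N w hN⟩
  | zero => exact ⟨0, 0, by simp, by simp, by simp⟩
  | add x y _ _ hx hy =>
    obtain ⟨s, u, rfl, h1, h2⟩ := hx
    obtain ⟨s', u', rfl, h3, h4⟩ := hy
    exact ⟨s + s', u + u', by abel, by simpa using h1.add h3, by simpa using h2.add h4⟩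

end Splitting

/-! ### Complexification in a basis, and real parts. -/

section Complexification

variable {V : Type*} [NormedAddCommGroup V] [NormedSpace ℝ V] {ι : Type*} [Fintype ι]
  [DecidableEq ι] (b : Module.Basis ι ℝ V)

/-- The complexification of a real linear map, in a basis. -/
def complexify (T : V →ₗ[ℝ] V) : Module.End ℂ (ι → ℂ) :=
  Matrix.toLin' ((LinearMap.toMatrix b b T).map (algebraMap ℝ ℂ))

/-- The vector whose coordinates are the real parts of given complex numbers. -/
def reVec (w : ι → ℂ) : V := b.equivFun.symm fun i => (w i).re

lemma reVec_add (w w' : ι → ℂ) : reVec b (w + w') = reVec b w + reVec b w' := by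
  rw [reVec, reVec, reVec, ← map_add]
  rfl

lemma continuous_reVec [FiniteDimensional ℝ V] : Continuous (reVec b) := by
  have : Continuous b.equivFun.symm := LinearMap.continuous_of_finiteDimensional
    b.equivFun.symm.toLinearMap
  exact this.comp (by fun_prop)

lemma reVec_ofReal (v : V) : reVec b (fun i => (b.repr v i : ℂ)) = v := by
  simp only [reVec, Complex.ofReal_re]
  exact b.equivFun.symm_apply_apply v

/-- The real part of -iw is the imaginary part of w. -/
lemma eq_zero_of_reVec {w : ι → ℂ} (h : reVec b w = 0) (h' : reVec b (-Complex.I • w) = 0) :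
    w = 0 := by
  rw [reVec, LinearEquiv.map_eq_zero_iff] at h h'
  funext i
  have h1 := congrFun h i
  have h2 := congrFun h' i
  simp at h1 h2
  exact Complex.ext h1 h2

/-- The matrix is real, so it commutes with taking real parts; this transfers complex orbits to real
ones. -/
lemma reVec_complexify (T : V →ₗ[ℝ] V) (w : ι → ℂ) :
    reVec b (complexify b T w) = T (reVec b w) := by
  apply b.equivFun.injective
  funext i
  have h := congrFun (LinearMap.toMatrix_mulVec_repr b b T (reVec b w)) i
  rw [reVec, LinearEquiv.apply_symm_apply, Module.Basis.equivFun_apply, ← h]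
  have h2 : ∀ x, b.repr (reVec b w) x = (w x).re := fun x =>
    congrFun (b.equivFun.apply_symm_apply fun i => (w i).re) x
  simp [complexify, Matrix.mulVec, dotProduct, h2]

lemma reVec_complexify_pow (T : V →ₗ[ℝ] V) (w : ι → ℂ) (k : ℕ) :
    reVec b ((complexify b T ^ k) w) = T^[k] (reVec b w) := by
  induction k with
  | zero => rfl
  | succ k ih =>
    rw [pow_succ', Module.End.mul_apply, reVec_complexify, ih, Function.iterate_succ_apply']

lemma complexify_mul {S T : V →ₗ[ℝ] V} (h : S ∘ₗ T = LinearMap.id) :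
    complexify b S * complexify b T = 1 := by
  rw [complexify, complexify, Module.End.mul_eq_comp, ← Matrix.toLin'_mul, ← Matrix.map_mul,
    ← LinearMap.toMatrix_comp, h, LinearMap.toMatrix_id]
  simp [Module.End.one_eq_id]

lemma isHyperbolic_iff_complexify (A : V ≃L[ℝ] V) [Module.Finite ℝ V] [Module.Free ℝ V] :
    IsHyperbolic A ↔ ∀ μ, (complexify b (A : V →ₗ[ℝ] V)).HasEigenvalue μ → ‖μ‖ ≠ 1 := by
  unfold IsHyperbolic
  refine forall_congr' fun μ => ?_
  rw [Module.End.hasEigenvalue_iff_isRoot_charpoly, complexify, Matrix.charpoly_toLin',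
    Matrix.charpoly_map, LinearMap.charpoly_toMatrix]

end Complexification

/-! ### The stable and unstable subspaces are complementary. -/

section Hyperbolic

variable {V : Type*} [NormedAddCommGroup V] [NormedSpace ℝ V] [FiniteDimensional ℝ V]

/-- The complexified vector is split by generalized eigenspaces, and the real parts of its two
components are taken. -/
lemma IsHyperbolic.exists_add {A : V ≃L[ℝ] V} (hA : IsHyperbolic A) (v : V) :
    ∃ s ∈ stableSubspace A, ∃ u ∈ unstableSubspace A, v = s + u := by
  let b := Module.finBasis ℝ V
  obtain ⟨s, u, h, hs, hu⟩ := exists_add_of_spectrum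
    (complexify_mul b (S := (A.symm : V →ₗ[ℝ] V)) (T := (A : V →ₗ[ℝ] V)) (by ext; simp))
    ((isHyperbolic_iff_complexify b A).1 hA) (fun i => (b.repr v i : ℂ))
  have h0 : reVec b 0 = 0 := by
    simpa [Pi.zero_def] using reVec_ofReal b 0
  refine ⟨reVec b s, ?_, reVec b u, ?_, ?_⟩
  · have h1 := ((continuous_reVec b).tendsto 0).comp hs
    rw [h0] at h1
    refine h1.congr fun k => ?_
    exact reVec_complexify_pow b _ s k
  · have h1 := ((continuous_reVec b).tendsto 0).comp hu
    rw [h0] at h1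
    refine h1.congr fun k => ?_
    exact reVec_complexify_pow b _ u k
  · rw [← reVec_add, ← h, reVec_ofReal]

/-- The restriction of a linear automorphism to its stable subspace. -/
def stablePart (A : V ≃L[ℝ] V) : stableSubspace A →L[ℝ] stableSubspace A :=
  LinearMap.toContinuousLinearMap ((A.toLinearEquiv.toLinearMap).restrict (map_mem_stable A))

lemma stablePart_pow_apply (A : V ≃L[ℝ] V) (k : ℕ) (v : stableSubspace A) :
    ((stablePart A ^ k) v : V) = A^[k] v := by
  induction k with
  | zero => rfl
  | succ k ih =>
    rw [pow_succ', Function.iterate_succ_apply', ← ih]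
    rfl

lemma orbitStable_stablePart (A : V ≃L[ℝ] V) : OrbitStable (stablePart A) := by
  intro v
  rw [tendsto_subtype_rng]
  exact Tendsto.congr (fun k => (stablePart_pow_apply A k v).symm) v.2

/-- A common vector is v = A^k(A^(-k) v), where A^(-k) v tends to 0 inside the stable subspace and
A^k tends to 0 there in operator norm. -/
lemma disjoint_stable_unstable (A : V ≃L[ℝ] V) :
    Disjoint (stableSubspace A) (unstableSubspace A) := by
  rw [Submodule.disjoint_def]
  intro v hs hu
  have hs' : ∀ k, A.symm^[k] v ∈ stableSubspace A := by
    intro k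
    induction k with
    | zero => exact hs
    | succ k ih =>
      rw [Function.iterate_succ_apply']
      exact map_mem_unstable A.symm _ (show _ ∈ stableSubspace A.symm.symm from ih)
  have h1 : ∀ k, ‖v‖ ≤ ‖stablePart A ^ k‖ * ‖A.symm^[k] v‖ := by
    intro k
    have h2 := (stablePart A ^ k).le_opNorm ⟨_, hs' k⟩
    rw [Submodule.coe_norm, Submodule.coe_norm, stablePart_pow_apply] at h2
    rwa [(show Function.LeftInverse A^[k] A.symm^[k] from
      Function.LeftInverse.iterate A.apply_symm_apply k) v] at h2
  have h3 := (orbitStable_stablePart A).tendsto_norm_pow.mul (tendsto_zero_iff_norm_tendsto_zero.1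
    (show Tendsto (fun k : ℕ => A.symm^[k] v) atTop (𝓝 0) from hu))
  rw [mul_zero] at h3
  have := ge_of_tendsto' h3 h1
  simpa using this

lemma IsHyperbolic.isCompl {A : V ≃L[ℝ] V} (hA : IsHyperbolic A) :
    IsCompl (stableSubspace A) (unstableSubspace A) := by
  refine ⟨disjoint_stable_unstable A, ?_⟩
  rw [codisjoint_iff, eq_top_iff]
  intro v _
  obtain ⟨s, hs, u, hu, h⟩ := hA.exists_add v
  rw [h]
  exact Submodule.add_mem_sup hs hu

end Hyperbolic

/-- The linear map splits as the product of a contraction and an expansion, for suitable norms. -/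
def SplitHyperbolic {X : Type} [NormedAddCommGroup X] [NormedSpace ℝ X] (T : X →L[ℝ] X) : Prop :=
  ∃ (F G : Type) (_ : NormedAddCommGroup F) (_ : NormedSpace ℝ F) (_ : NormedAddCommGroup G)
    (_ : NormedSpace ℝ G) (e : X ≃L[ℝ] F × G) (S : F ≃L[ℝ] F) (U : G ≃L[ℝ] G),
    ‖(S : F →L[ℝ] F)‖ < 1 ∧ ‖(U.symm : G →L[ℝ] G)‖ < 1 ∧ ∀ x, e (T x) = (S (e x).1, U (e x).2)

/-! ### Split hyperbolic maps and their spectrum. -/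

section Split

variable {X : Type} [NormedAddCommGroup X] [NormedSpace ℝ X] [FiniteDimensional ℝ X]

lemma exists_adapted_equiv {E : Type} [NormedAddCommGroup E] [NormedSpace ℝ E]
    [FiniteDimensional ℝ E] {T : E →L[ℝ] E} (hT : OrbitStable T) (hu : IsUnit T) :
    ∃ (F : Type) (_ : NormedAddCommGroup F) (_ : NormedSpace ℝ F) (e : E ≃L[ℝ] F) (S : F ≃L[ℝ] F),
      ‖(S : F →L[ℝ] F)‖ < 1 ∧ (∀ x, e (T x) = S (e x)) := by
  obtain ⟨F, _, _, e, he⟩ := hT.exists_adapted_norm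
  obtain ⟨u, rfl⟩ := hu
  refine ⟨F, _, _, e, (e.symm.trans (ContinuousLinearEquiv.ofUnit u)).trans e, he, fun x => ?_⟩
  simp
  rfl

/-- The product of a linear map and the inverse of another, transported to `X`. -/
def splitMap {E E' : Type} [NormedAddCommGroup E] [NormedSpace ℝ E] [NormedAddCommGroup E']
    [NormedSpace ℝ E'] (e : X ≃L[ℝ] E × E') (S : E →L[ℝ] E) (W : E' →L[ℝ] E') : X →L[ℝ] X :=
  (e.symm : E × E' →L[ℝ] X) ∘L (S.prodMap (Ring.inverse W)) ∘L (e : X →L[ℝ] E × E')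

/-- Each factor receives its own adapted norm. The second factor enters through its inverse, so a
contraction `S₂` adapted to `W` yields the expansion `S₂.symm`. -/
lemma splitHyperbolic_splitMap {E E' : Type} [NormedAddCommGroup E] [NormedSpace ℝ E]
    [NormedAddCommGroup E'] [NormedSpace ℝ E'] [FiniteDimensional ℝ E] [FiniteDimensional ℝ E']
    (e : X ≃L[ℝ] E × E') {S : E →L[ℝ] E} {W : E' →L[ℝ] E'} (hS : OrbitStable S) (hSu : IsUnit S)
    (hW : OrbitStable W) (hWu : IsUnit W) : SplitHyperbolic (splitMap e S W) := by
  obtain ⟨F, _, _, e₁, S₁, hS₁, h₁⟩ := exists_adapted_equiv hS hSu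
  obtain ⟨G, _, _, e₂, S₂, hS₂, h₂⟩ := exists_adapted_equiv hW hWu
  refine ⟨F, G, _, _, _, _, e.trans (e₁.prodCongr e₂), S₁, S₂.symm, hS₁, hS₂, fun x => ?_⟩
  have h3 : ∀ y, W (Ring.inverse W y) = y := fun y => by
    rw [← mul_apply_eq_comp, Ring.mul_inverse_cancel _ hWu]; rfl
  refine Prod.ext ?_ ?_
  · simp [splitMap, h₁]
  · simp only [splitMap, ContinuousLinearEquiv.trans_apply, ContinuousLinearMap.comp_apply,
      ContinuousLinearEquiv.coe_coe, ContinuousLinearEquiv.apply_symm_apply,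
      ContinuousLinearEquiv.prodCongr_apply, ContinuousLinearMap.coe_prodMap', Prod.map_snd]
    rw [ContinuousLinearEquiv.eq_symm_apply, ← h₂]
    simp [h3]

/-- The contracted coordinate of `v` is S^k of a coordinate of its backward orbit, and the expanded
one is U^(-k) of a coordinate of its forward orbit. Bounded orbits force both to vanish. -/
lemma SplitHyperbolic.eq_zero_of_bounded_orbit {A : X ≃L[ℝ] X}
    (hA : SplitHyperbolic (A : X →L[ℝ] X)) {v : X} {C : ℝ} (h1 : ∀ k : ℕ, ‖A^[k] v‖ ≤ C)
    (h2 : ∀ k : ℕ, ‖A.symm^[k] v‖ ≤ C) : v = 0 := by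
  obtain ⟨F, G, _, _, _, _, e, S, U, hS, hU, he⟩ := hA
  have hC : 0 ≤ C := (norm_nonneg _).trans (h1 0)
  have hk1 : ∀ (k : ℕ) x, (e (A^[k] x)).1 = ((S : F →L[ℝ] F) ^ k) (e x).1 := by
    intro k x
    induction k with
    | zero => rfl
    | succ k ih =>
      rw [Function.iterate_succ_apply', pow_succ', mul_apply_eq_comp, ← ih]
      exact congrArg Prod.fst (he _)
  have hk2 : ∀ (k : ℕ) x, (e x).2 = ((U.symm : G →L[ℝ] G) ^ k) (e (A^[k] x)).2 := by
    intro k x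
    induction k with
    | zero => rfl
    | succ k ih =>
      rw [Function.iterate_succ_apply', pow_succ, mul_apply_eq_comp]
      have : (e (A (A^[k] x))).2 = U (e (A^[k] x)).2 := congrArg Prod.snd (he _)
      rw [this, ih]
      simp
  have key : ∀ {H : Type} [NormedAddCommGroup H] [NormedSpace ℝ H] (T : H →L[ℝ] H), ‖T‖ < 1 →
      ∀ (y : H) (z : ℕ → H) (K : ℝ), (∀ k, y = (T ^ k) (z k)) → (∀ k, ‖z k‖ ≤ K) → y = 0 := by
    intro H _ _ T hT y z K hy hz
    have h3 : Tendsto (fun k : ℕ => ‖T ^ k‖ * K) atTop (𝓝 (0 * K)) :=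
      (tendsto_zero_iff_norm_tendsto_zero.1
        (tendsto_pow_atTop_nhds_zero_of_norm_lt_one hT)).mul_const K
    rw [zero_mul] at h3
    have := ge_of_tendsto' h3 fun k => (show ‖y‖ ≤ ‖T ^ k‖ * K by
      conv_lhs => rw [hy k]
      exact (T ^ k).le_of_opNorm_le_of_le le_rfl (hz k))
    simpa using this
  have hb : ∀ x, ‖x‖ ≤ C → ‖e x‖ ≤ ‖(e : X →L[ℝ] F × G)‖ * C := fun x hx =>
    (e : X →L[ℝ] F × G).le_of_opNorm_le_of_le le_rfl hx
  have hv1 : (e v).1 = 0 := by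
    refine key (S : F →L[ℝ] F) hS _ (fun k => (e (A.symm^[k] v)).1) _ (fun k => ?_)
      fun k => (norm_fst_le _).trans (hb _ (h2 k))
    rw [← hk1, (show Function.LeftInverse A^[k] A.symm^[k] from
      Function.LeftInverse.iterate A.apply_symm_apply k) v]
  have hv2 : (e v).2 = 0 :=
    key (U.symm : G →L[ℝ] G) hU _ (fun k => (e (A^[k] v)).2) _ (fun k => hk2 k v)
      fun k => (norm_snd_le _).trans (hb _ (h1 k))
  have : e v = 0 := Prod.ext hv1 hv2
  simpa using this

/-- An eigenvalue of modulus one would have an eigenvector whose real and imaginary parts have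
bounded two-sided orbits, hence vanish. -/
theorem SplitHyperbolic.isHyperbolic {A : X ≃L[ℝ] X} (hA : SplitHyperbolic (A : X →L[ℝ] X)) :
    IsHyperbolic A := by
  let b := Module.finBasis ℝ X
  rw [isHyperbolic_iff_complexify b]
  intro μ hμ h1
  obtain ⟨w, hw⟩ := hμ.exists_hasEigenvector
  have hμ0 : μ ≠ 0 := by rintro rfl; simp at h1
  have hgf : complexify b (A.symm : X →ₗ[ℝ] X) * complexify b (A : X →ₗ[ℝ] X) = 1 :=
    complexify_mul b (by ext; simp)
  have hgw : complexify b (A.symm : X →ₗ[ℝ] X) w = μ⁻¹ • w := by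
    have h2 : complexify b (A.symm : X →ₗ[ℝ] X) (complexify b (A : X →ₗ[ℝ] X) w) = w := by
      rw [← Module.End.mul_apply, hgf]; rfl
    rw [hw.apply_eq_smul, map_smul] at h2
    rw [eq_inv_smul_iff₀ hμ0, h2]
  -- Unimodular multiples of `w` stay in this ball, so one constant bounds both orbits.
  obtain ⟨C, hC⟩ := ((isCompact_closedBall (0 : Fin (Module.finrank ℝ X) → ℂ) ‖w‖).image
    (continuous_reVec b)).isBounded.exists_norm_le
  have hpow : ∀ (f : Module.End ℂ (Fin (Module.finrank ℝ X) → ℂ)) (ν c : ℂ), f w = ν • w →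
      ∀ k : ℕ, (f ^ k) (c • w) = (ν ^ k * c) • w := by
    intro f ν c h k
    induction k with
    | zero => simp
    | succ k ih => rw [pow_succ', Module.End.mul_apply, ih, map_smul, h, smul_smul]; ring_nf
  have key : ∀ c : ℂ, ‖c‖ = 1 → reVec b (c • w) = 0 := by
    intro c hc
    refine hA.eq_zero_of_bounded_orbit (C := C) (fun k => ?_) fun k => ?_
    · rw [show A^[k] (reVec b (c • w)) = _ from (reVec_complexify_pow b _ _ k).symm,
        hpow _ _ _ hw.apply_eq_smul]
      refine hC _ (mem_image_of_mem _ ?_)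
      simp [norm_smul, hc, h1]
    · rw [show A.symm^[k] (reVec b (c • w)) = _ from (reVec_complexify_pow b _ _ k).symm,
        hpow _ _ _ hgw]
      refine hC _ (mem_image_of_mem _ ?_)
      simp [norm_smul, hc, h1]
  refine hw.2 (eq_zero_of_reVec b ?_ (key _ (by simp)))
  simpa using key 1 (by simp)

end Split

/-! ### The Hartman–Grobman theorem for small perturbations of hyperbolic maps -/

section HartmanGrobman

open scoped NNReal BoundedContinuousFunction

variable {F G : Type*} [NormedAddCommGroup F] [NormedSpace ℝ F] [NormedAddCommGroup G]
  [NormedSpace ℝ G] [CompleteSpace F] [CompleteSpace G]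

/-- A semiconjugacy id + u is a fixed point of a contraction on bounded continuous maps. Allowing
perturbations `f` and `g` on both sides lets one statement provide both semiconjugacies and the
uniqueness making them mutually inverse. -/
lemma existsUnique_semiconj (S : F ≃L[ℝ] F) (U : G ≃L[ℝ] G) {l ε : ℝ≥0}
    (hS : ‖(S : F →L[ℝ] F)‖ ≤ l) (hU : ‖(U.symm : G →L[ℝ] G)‖ ≤ l) (hl : l + ε < 1)
    {f g : F × G → F × G} (hf : LipschitzWith ε f) (hfb : ∃ C, ∀ x, ‖f x‖ ≤ C)
    (hg : Continuous g) (hgb : ∃ C, ∀ x, ‖g x‖ ≤ C) (γ : (F × G) ≃ₜ (F × G))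
    (hγ : ∀ x, γ x = S.prodCongr U x + g x) :
    ∃! u : (F × G) →ᵇ (F × G),
      ∀ x, S.prodCongr U (x + u x) + f (x + u x) = γ x + u (γ x) := by
  obtain ⟨Cf, hCf⟩ := hfb
  obtain ⟨Cg, hCg⟩ := hgb
  have hfc := hf.continuous
  have hSc : Continuous S := S.continuous
  have hUc : Continuous U.symm := U.symm.continuous
  have hSn : ∀ x, ‖S x‖ ≤ l * ‖x‖ := fun x => (S : F →L[ℝ] F).le_of_opNorm_le hS x
  have hUn : ∀ x, ‖U.symm x‖ ≤ l * ‖x‖ := fun x => (U.symm : G →L[ℝ] G).le_of_opNorm_le hU x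
  -- The contracting coordinate is solved for u at γ x, the expanding one for u at x after applying
  -- U⁻¹; thus only S and U⁻¹ occur, both of norm at most `l`.
  let a : ((F × G) →ᵇ (F × G)) → F × G → F := fun u x =>
    S (u x).1 + (f (x + u x)).1 - (g x).1
  let b : ((F × G) →ᵇ (F × G)) → F × G → G := fun u y =>
    U.symm ((u (γ y)).2 + (g y).2 - (f (y + u y)).2)
  have hac : ∀ u, Continuous (a u) := fun u => by
    have := u.continuous
    fun_prop
  have hbc : ∀ u, Continuous (b u) := fun u => by
    have := u.continuous
    have := γ.continuous
    fun_prop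
  have hab : ∀ u x, ‖a u x‖ ≤ l * ‖u‖ + Cf + Cg := fun u x => by
    have h1 := hSn (u x).1
    have h2 : ‖(u x).1‖ ≤ ‖u‖ := (norm_fst_le _).trans (u.norm_coe_le_norm x)
    have h3 := (norm_fst_le _).trans (hCf (x + u x))
    have h4 := (norm_fst_le _).trans (hCg x)
    have h5 : (l : ℝ) * ‖(u x).1‖ ≤ l * ‖u‖ := by gcongr
    have h6 := norm_sub_le (S (u x).1 + (f (x + u x)).1) (g x).1
    have h7 := norm_add_le (S (u x).1) (f (x + u x)).1
    simp only [a]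
    linarith
  have hbb : ∀ u x, ‖b u x‖ ≤ l * (‖u‖ + Cg + Cf) := fun u x => by
    refine (hUn _).trans ?_
    gcongr
    have h2 : ‖(u (γ x)).2‖ ≤ ‖u‖ := (norm_snd_le _).trans (u.norm_coe_le_norm _)
    have h3 := (norm_snd_le _).trans (hCf (x + u x))
    have h4 := (norm_snd_le _).trans (hCg x)
    have h6 := norm_sub_le ((u (γ x)).2 + (g x).2) (f (x + u x)).2
    have h7 := norm_add_le (u (γ x)).2 (g x).2
    linarith
  let Φ : ((F × G) →ᵇ (F × G)) → ((F × G) →ᵇ (F × G)) := fun u =>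
    BoundedContinuousFunction.ofNormedAddCommGroup (fun y => (a u (γ.symm y), b u y))
      (((hac u).comp γ.symm.continuous).prodMk (hbc u))
      (max (l * ‖u‖ + Cf + Cg) (l * (‖u‖ + Cg + Cf)))
      (fun y => max_le_max (hab u _) (hbb u y))
  have hΦ : ∀ u y, Φ u y = (a u (γ.symm y), b u y) := fun _ _ => rfl
  have hc : ContractingWith (l + ε) Φ := by
    refine ⟨hl, LipschitzWith.of_dist_le_mul fun u v => ?_⟩
    have hd : 0 ≤ dist u v := dist_nonneg
    have hff : ∀ x, ‖f (x + u x) - f (x + v x)‖ ≤ ε * dist u v := fun x => by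
      refine (hf.norm_sub_le _ _).trans ?_
      gcongr
      rw [add_sub_add_left_eq_sub, ← dist_eq_norm]
      exact BoundedContinuousFunction.dist_coe_le_dist x
    have huv : ∀ x, ‖u x - v x‖ ≤ dist u v := fun x => by
      rw [← dist_eq_norm]
      exact BoundedContinuousFunction.dist_coe_le_dist x
    refine (BoundedContinuousFunction.dist_le (by positivity)).2 fun y => ?_
    rw [hΦ, hΦ, Prod.dist_eq]
    refine max_le ?_ ?_
    · set x := γ.symm y
      have h1 : a u x - a v x = S ((u x - v x).1) + (f (x + u x) - f (x + v x)).1 := by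
        simp only [a, Prod.fst_sub, map_sub]; abel
      dsimp only
      rw [dist_eq_norm, h1]
      have h2 := hSn (u x - v x).1
      have h3 := (norm_fst_le _).trans (huv x)
      have h4 := (norm_fst_le _).trans (hff x)
      have h5 : (l : ℝ) * ‖(u x - v x).1‖ ≤ l * dist u v := by gcongr
      have h6 := norm_add_le (S ((u x - v x).1)) (f (x + u x) - f (x + v x)).1
      push_cast
      linarith
    · have h1 : b u y - b v y = U.symm ((u (γ y) - v (γ y)).2 - (f (y + u y) - f (y + v y)).2) := by
        simp only [b, Prod.snd_sub, ← map_sub]; congr 1; abel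
      dsimp only
      rw [dist_eq_norm, h1]
      refine (hUn _).trans ?_
      have h3 := (norm_snd_le _).trans (huv (γ y))
      have h4 := (norm_snd_le _).trans (hff y)
      have h5 := norm_sub_le (u (γ y) - v (γ y)).2 (f (y + u y) - f (y + v y)).2
      have hl1 : (l : ℝ) ≤ 1 := by
        have : l ≤ 1 := (le_self_add.trans hl.le)
        exact_mod_cast this
      have h6 : (l : ℝ) * ‖(u (γ y) - v (γ y)).2 - (f (y + u y) - f (y + v y)).2‖ ≤
          l * (dist u v + ε * dist u v) := by gcongr; linarith
      have h7 : (l : ℝ) * (ε * dist u v) ≤ 1 * (ε * dist u v) := by gcongr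
      push_cast
      linarith
  have hiff : ∀ u, (∀ x, S.prodCongr U (x + u x) + f (x + u x) = γ x + u (γ x)) ↔
      Function.IsFixedPt Φ u := by
    intro u
    have h1 : ∀ x, (S.prodCongr U (x + u x) + f (x + u x) = γ x + u (γ x) ↔
        a u x = (u (γ x)).1 ∧ b u x = (u x).2) := by
      intro x
      generalize hy : u (γ x) = y
      rw [hγ, Prod.ext_iff]
      refine and_congr ?_ ?_
      · simp only [a, ContinuousLinearEquiv.prodCongr_apply, Prod.fst_add, map_add]
        constructor <;> intro h <;> rw [← sub_eq_zero, ← sub_eq_zero.2 h] <;> abel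
      · simp only [b, ContinuousLinearEquiv.prodCongr_apply, Prod.snd_add, map_add,
          ContinuousLinearEquiv.symm_apply_eq, hy]
        constructor <;> intro h <;> rw [← sub_eq_zero, ← sub_eq_zero.2 h.symm] <;> abel
    constructor
    · intro h
      ext1 y
      rw [hΦ]
      refine Prod.ext ?_ ((h1 y).1 (h y)).2
      have := ((h1 (γ.symm y)).1 (h _)).1
      rwa [γ.apply_symm_apply] at this
    · intro h x
      have h2 : ∀ y, (a u (γ.symm y), b u y) = u y := fun y => by
        rw [← hΦ]; exact congrArg (fun w : (F × G) →ᵇ (F × G) => w y) h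
      refine (h1 x).2 ⟨?_, congrArg Prod.snd (h2 x)⟩
      have := congrArg Prod.fst (h2 (γ x))
      simpa using this
  refine ⟨_, (hiff _).2 hc.fixedPoint_isFixedPt, fun v hv => ?_⟩
  exact hc.fixedPoint_unique ((hiff v).1 hv)

/-- A small bounded Lipschitz perturbation of a hyperbolic linear map is conjugate to it by a
homeomorphism at bounded distance from the identity. -/
theorem exists_conj_of_perturbation (S : F ≃L[ℝ] F) (U : G ≃L[ℝ] G) {l ε : ℝ≥0}
    (hS : ‖(S : F →L[ℝ] F)‖ ≤ l) (hU : ‖(U.symm : G →L[ℝ] G)‖ ≤ l) (hl : l + ε < 1)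
    {f : F × G → F × G} (hf : LipschitzWith ε f) (hfb : ∃ C, ∀ x, ‖f x‖ ≤ C)
    (γ : (F × G) ≃ₜ (F × G)) (hγ : ∀ x, γ x = S.prodCongr U x + f x) :
    ∃ H : (F × G) ≃ₜ (F × G), (∃ C, ∀ x, ‖H x - x‖ ≤ C) ∧
      ∀ x, H (S.prodCongr U x) = γ (H x) := by
  have h0 : LipschitzWith ε (fun _ : F × G => (0 : F × G)) := LipschitzWith.const' 0
  have h0b : ∃ C : ℝ, ∀ x : F × G, ‖(fun _ : F × G => (0 : F × G)) x‖ ≤ C := ⟨0, by simp⟩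
  let L : (F × G) ≃ₜ (F × G) := (S.prodCongr U).toHomeomorph
  have hL : ∀ x, L x = S.prodCongr U x + (fun _ : F × G => (0 : F × G)) x := fun x => by
    simp [L]
  obtain ⟨u, hu, -⟩ := existsUnique_semiconj S U hS hU hl hf hfb h0.continuous h0b L hL
  obtain ⟨v, hv, -⟩ := existsUnique_semiconj S U hS hU hl h0 h0b hf.continuous hfb γ hγ
  -- Uniqueness of self-semiconjugacies of `L` and of `γ`: the two composites below commute with
  -- these maps, so their displacements must be zero.
  have e1 := existsUnique_semiconj S U hS hU hl h0 h0b h0.continuous h0b L hL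
  have e2 := existsUnique_semiconj S U hS hU hl hf hfb hf.continuous hfb γ hγ
  have hu' : ∀ x, γ (x + u x) = L x + u (L x) := fun x => by rw [hγ, hu]
  have hv' : ∀ x, L (x + v x) = γ x + v (γ x) := fun x => by rw [hL, hv]
  let w₁ : (F × G) →ᵇ (F × G) := u + v.compContinuous ⟨fun x => x + u x, by fun_prop⟩
  let w₂ : (F × G) →ᵇ (F × G) := v + u.compContinuous ⟨fun x => x + v x, by fun_prop⟩
  have hw₁ : ∀ x, x + w₁ x = (x + u x) + v (x + u x) := fun x => by simp [w₁, add_assoc]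
  have hw₂ : ∀ x, x + w₂ x = (x + v x) + u (x + v x) := fun x => by simp [w₂, add_assoc]
  have hw₁0 : w₁ = 0 := by
    refine e1.unique (fun x => ?_) (fun x => by simp [L])
    rw [← hL, hw₁, hw₁, hv', hu']
  have hw₂0 : w₂ = 0 := by
    refine e2.unique (fun x => ?_) (fun x => by simp [hγ])
    rw [← hγ, hw₂, hw₂, hu', hv']
  refine ⟨⟨⟨fun x => x + u x, fun x => x + v x, fun x => ?_, fun x => ?_⟩, by fun_prop,
    by fun_prop⟩, ⟨‖u‖, fun x => ?_⟩, fun x => (hu' x).symm⟩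
  · change (x + u x) + v (x + u x) = x
    rw [← hw₁, hw₁0]; simp
  · change (x + v x) + u (x + v x) = x
    rw [← hw₂, hw₂0]; simp
  · change ‖x + u x - x‖ ≤ _
    rw [add_sub_cancel_left]
    exact u.norm_coe_le_norm x

end HartmanGrobman

/-! ### Global conjugacy on a space with a hyperbolic splitting. -/

section Transport

open scoped NNReal

variable {X : Type} [NormedAddCommGroup X] [NormedSpace ℝ X] [FiniteDimensional ℝ X]

theorem SplitHyperbolic.exists_conj {T : X →L[ℝ] X} (hT : SplitHyperbolic T) :
    ∃ ε : ℝ≥0, 0 < ε ∧ ∀ f : X → X, LipschitzWith ε f → (∃ C, ∀ x, ‖f x‖ ≤ C) → f 0 = 0 →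
      ∃ H : X ≃ₜ X, (∃ C, ∀ x, ‖H x - x‖ ≤ C) ∧ H 0 = 0 ∧ ∀ x, H (T x) = T (H x) + f (H x) := by
  obtain ⟨F, G, _, _, _, _, e, S, U, hS, hU, he⟩ := hT
  have : FiniteDimensional ℝ (F × G) := e.toLinearEquiv.finiteDimensional
  have : FiniteDimensional ℝ F :=
    FiniteDimensional.of_surjective (LinearMap.fst ℝ F G) LinearMap.fst_surjective
  have : FiniteDimensional ℝ G :=
    FiniteDimensional.of_surjective (LinearMap.snd ℝ F G) LinearMap.snd_surjective
  have : CompleteSpace F := FiniteDimensional.complete ℝ F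
  have : CompleteSpace G := FiniteDimensional.complete ℝ G
  let L := S.prodCongr U
  have heL : ∀ x, e (T x) = L (e x) := he
  set l : ℝ≥0 := max ‖(S : F →L[ℝ] F)‖₊ ‖(U.symm : G →L[ℝ] G)‖₊ with hl_def
  have hl : l < 1 := max_lt hS hU
  -- The bound l + δ < 1 drives the contraction; the last condition makes the perturbed map itself a
  -- homeomorphism.
  obtain ⟨δ, hδ0, hδ1, hδ2⟩ : ∃ δ : ℝ≥0, 0 < δ ∧ l + δ < 1 ∧
      (Subsingleton (F × G) ∨ δ < ‖(L.symm : F × G →L[ℝ] F × G)‖₊⁻¹) := by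
    have h1 : ∃ δ : ℝ≥0, 0 < δ ∧ l + δ < 1 := by
      obtain ⟨δ, h1, h2⟩ := exists_between (tsub_pos_of_lt hl)
      exact ⟨δ, h1, by rwa [add_comm, ← lt_tsub_iff_right]⟩
    obtain ⟨δ, h0, h1⟩ := h1
    rcases L.subsingleton_or_nnnorm_symm_pos with h | h
    · exact ⟨δ, h0, h1, .inl h⟩
    · obtain ⟨δ', h2, h3⟩ := exists_between (lt_min h0 (inv_pos.2 h))
      refine ⟨δ', h2, lt_trans ?_ h1, .inr (lt_of_lt_of_le h3 (min_le_right _ _))⟩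
      gcongr
      exact lt_of_lt_of_le h3 (min_le_left _ _)
  set K : ℝ≥0 := ‖(e : X →L[ℝ] F × G)‖₊ * ‖(e.symm : F × G →L[ℝ] X)‖₊ with hK
  have hε : δ / (K + 1) * K ≤ δ := by
    rw [div_mul_eq_mul_div]
    refine div_le_of_le_mul₀ (by positivity) (by positivity) ?_
    gcongr
    exact le_self_add
  -- Changing coordinates multiplies Lipschitz constants by at most K; the 1 avoids dividing by
  -- zero.
  refine ⟨δ / (K + 1), by positivity, fun f hf ⟨C, hC⟩ hf0 => ?_⟩
  let f' : F × G → F × G := fun y => e (f (e.symm y))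
  have hf' : LipschitzWith δ f' := by
    have h1 := (e : X →L[ℝ] F × G).lipschitz.comp (hf.comp (e.symm : F × G →L[ℝ] X).lipschitz)
    refine h1.weaken (le_trans (le_of_eq ?_) hε)
    rw [hK]; ring
  have hγ : ApproximatesLinearOn (fun y => L y + f' y) (L : F × G →L[ℝ] F × G) univ δ := by
    rw [ApproximatesLinearOn.approximatesLinearOn_iff_lipschitzOnWith]
    have : (fun y => L y + f' y) - ⇑(L : F × G →L[ℝ] F × G) = f' := by
      funext y; simp
    rw [this]
    exact hf'.lipschitzOnWith
  obtain ⟨H, ⟨D, hD⟩, hH⟩ := exists_conj_of_perturbation S U (l := l) (ε := δ)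
    (le_max_left _ _) (le_max_right _ _) hδ1 hf'
    ⟨‖(e : X →L[ℝ] F × G)‖ * C, fun y => (e : X →L[ℝ] F × G).le_of_opNorm_le_of_le le_rfl (hC _)⟩
    (hγ.toHomeomorph _ hδ2) (fun x => rfl)
  have hH' : ∀ y, H (L y) = L (H y) + f' (H y) := hH
  refine ⟨(e.toHomeomorph.trans H).trans e.symm.toHomeomorph,
    ⟨‖(e.symm : F × G →L[ℝ] X)‖ * D, fun x => ?_⟩, ?_, fun x => ?_⟩
  · have h1 : e.symm (H (e x)) - x = e.symm (H (e x) - e x) := by simp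
    change ‖e.symm (H (e x)) - x‖ ≤ _
    rw [h1]
    exact (e.symm : F × G →L[ℝ] X).le_of_opNorm_le_of_le le_rfl (hD _)
  · change e.symm (H (e 0)) = 0
    rw [map_zero, e.symm.map_eq_zero_iff]
    -- The perturbed map fixes 0, so the preimage of 0 under the conjugacy is fixed by the
    -- hyperbolic `L`, hence is 0.
    have h1 : L (H.symm 0) = H.symm 0 := by
      apply H.injective
      rw [hH', H.apply_symm_apply]
      simp [f', hf0]
    have h2 : S (H.symm 0).1 = (H.symm 0).1 := congrArg Prod.fst h1
    have h3 : U.symm (H.symm 0).2 = (H.symm 0).2 := by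
      rw [ContinuousLinearEquiv.symm_apply_eq]
      exact (congrArg Prod.snd h1).symm
    have key : ∀ {V : Type} [NormedAddCommGroup V] [NormedSpace ℝ V] (R : V →L[ℝ] V) (x : V),
        ‖R‖ < 1 → R x = x → x = 0 := by
      intro V _ _ R x hR hx
      by_contra h
      have h4 := R.le_opNorm x
      rw [hx] at h4
      have := norm_pos_iff.2 h
      nlinarith
    have h4 : H.symm 0 = 0 := Prod.ext (key (S : F →L[ℝ] F) _ hS h2)
      (key (U.symm : G →L[ℝ] G) _ hU h3)
    rw [← h4, H.apply_symm_apply, h4]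
  · change e.symm (H (e (T x))) = T (e.symm (H (e x))) + f (e.symm (H (e x)))
    rw [heL, hH', map_add]
    congr 1
    · rw [ContinuousLinearEquiv.symm_apply_eq, heL, e.apply_symm_apply]
    · simp [f']

end Transport

/-! ### Squashing a homeomorphism at bounded distance from the identity into a ball -/

section Squash

variable {X : Type*} [NormedAddCommGroup X] [NormedSpace ℝ X]

/-- The radial homeomorphism of `X` onto the ball of radius `R` that is the identity on the ball of
radius `R / 2`. -/
def squash (R : ℝ) (x : X) : X := min 1 (2 * R / (R + 2 * ‖x‖)) • x

/-- The inverse of `squash` on the ball of radius `R`. -/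
def unsquash (R : ℝ) (y : X) : X := max 1 (R / (2 * (R - ‖y‖))) • y

variable {R : ℝ}

lemma squash_of_le (hR : 0 < R) {x : X} (hx : ‖x‖ ≤ R / 2) : squash R x = x := by
  rw [squash, min_eq_left, one_smul]
  rw [one_le_div (by positivity)]
  linarith

lemma squash_of_ge (hR : 0 < R) {x : X} (hx : R / 2 ≤ ‖x‖) :
    squash R x = (2 * R / (R + 2 * ‖x‖)) • x := by
  rw [squash, min_eq_right]
  rw [div_le_one (by positivity)]
  linarith

lemma unsquash_of_le (hR : 0 < R) {x : X} (hx : ‖x‖ ≤ R / 2) : unsquash R x = x := by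
  rw [unsquash, max_eq_left, one_smul]
  rw [div_le_one (by linarith)]
  linarith

lemma unsquash_of_ge {x : X} (hx : R / 2 ≤ ‖x‖) (hx' : ‖x‖ < R) :
    unsquash R x = (R / (2 * (R - ‖x‖))) • x := by
  rw [unsquash, max_eq_right]
  rw [one_le_div (by linarith)]
  linarith

lemma norm_squash_lt (hR : 0 < R) (x : X) : ‖squash R x‖ < R := by
  rcases le_total ‖x‖ (R / 2) with h | h
  · rw [squash_of_le hR h]; linarith
  · rw [squash_of_ge hR h, norm_smul, Real.norm_of_nonneg (by positivity), div_mul_eq_mul_div,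
      div_lt_iff₀ (by positivity)]
    nlinarith

lemma unsquash_squash (hR : 0 < R) (x : X) : unsquash R (squash R x) = x := by
  rcases le_total ‖x‖ (R / 2) with h | h
  · rw [squash_of_le hR h, unsquash_of_le hR h]
  · have h1 : ‖squash R x‖ = 2 * R * ‖x‖ / (R + 2 * ‖x‖) := by
      rw [squash_of_ge hR h, norm_smul, Real.norm_of_nonneg (by positivity), div_mul_eq_mul_div]
    have h0 := norm_nonneg x
    rw [unsquash_of_ge _ (norm_squash_lt hR x), h1, squash_of_ge hR h, smul_smul]
    · have h2 : R - 2 * R * ‖x‖ / (R + 2 * ‖x‖) = R ^ 2 / (R + 2 * ‖x‖) := by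
        field_simp; ring
      rw [h2]
      have : R / (2 * (R ^ 2 / (R + 2 * ‖x‖))) * (2 * R / (R + 2 * ‖x‖)) = 1 := by
        field_simp
      rw [this, one_smul]
    · rw [h1, le_div_iff₀ (by positivity)]
      nlinarith

lemma squash_unsquash (hR : 0 < R) {y : X} (hy : ‖y‖ < R) : squash R (unsquash R y) = y := by
  rcases le_total ‖y‖ (R / 2) with h | h
  · rw [unsquash_of_le hR h, squash_of_le hR h]
  · have h3 : 0 < R - ‖y‖ := by linarith
    have h1 : ‖unsquash R y‖ = R * ‖y‖ / (2 * (R - ‖y‖)) := by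
      rw [unsquash_of_ge h hy, norm_smul, Real.norm_of_nonneg (by positivity), div_mul_eq_mul_div]
    rw [squash_of_ge hR, h1, unsquash_of_ge h hy, smul_smul]
    · have h2 : R + 2 * (R * ‖y‖ / (2 * (R - ‖y‖))) = R ^ 2 / (R - ‖y‖) := by
        field_simp; ring
      rw [h2]
      have : 2 * R / (R ^ 2 / (R - ‖y‖)) * (R / (2 * (R - ‖y‖))) = 1 := by
        field_simp
      rw [this, one_smul]
    · rw [h1, le_div_iff₀ (by positivity)]
      nlinarith

lemma continuous_squash (hR : 0 < R) : Continuous (squash R : X → X) := by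
  unfold squash
  refine Continuous.smul (continuous_const.min (continuous_const.div (by fun_prop) ?_))
    continuous_id
  intro x
  positivity

lemma continuousAt_unsquash {y : X} (hy : ‖y‖ < R) : ContinuousAt (unsquash R : X → X) y := by
  unfold unsquash
  refine ContinuousAt.smul (continuousAt_const.max (continuousAt_const.div ?_ ?_)) continuousAt_id
  · fun_prop
  · have : 0 < R - ‖y‖ := by linarith
    positivity

/-- The variation of the radial factor, weighted by the norm of the moved point; the four cases
record which of the two radii lie below R/2. -/
lemma abs_min_sub_min_mul_le (hR : 0 < R) {t t' : ℝ} (h : 0 ≤ t) (h' : 0 ≤ t') :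
    |min 1 (2 * R / (R + 2 * t')) - min 1 (2 * R / (R + 2 * t))| * t' ≤
      2 * R / (R + 2 * t) * |t' - t| := by
  have key : ∀ s : ℝ, 0 ≤ s → (s ≤ R / 2 ∧ min 1 (2 * R / (R + 2 * s)) = 1) ∨
      (R / 2 ≤ s ∧ min 1 (2 * R / (R + 2 * s)) = 2 * R / (R + 2 * s)) := by
    intro s hs
    rcases le_total s (R / 2) with h1 | h1
    · exact .inl ⟨h1, min_eq_left (by rw [one_le_div (by positivity)]; linarith)⟩
    · exact .inr ⟨h1, min_eq_right (by rw [div_le_one (by positivity)]; linarith)⟩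
  rcases key t h with ⟨h1, e1⟩ | ⟨h1, e1⟩ <;> rcases key t' h' with ⟨h2, e2⟩ | ⟨h2, e2⟩ <;>
    rw [e1, e2]
  · rw [sub_self, abs_zero, zero_mul]; positivity
  · have h3 : 2 * R / (R + 2 * t') ≤ 1 := by rw [div_le_one (by positivity)]; linarith
    have h4 : 1 ≤ 2 * R / (R + 2 * t) := by rw [one_le_div (by positivity)]; linarith
    rw [abs_of_nonpos (by linarith), abs_of_nonneg (by linarith)]
    have h5 : -(2 * R / (R + 2 * t') - 1) * t' = (2 * t' - R) * t' / (R + 2 * t') := by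
      field_simp; ring
    have h6 : (2 * t' - R) * t' / (R + 2 * t') ≤ t' - R / 2 := by
      rw [div_le_iff₀ (by positivity)]; nlinarith
    rw [h5]
    nlinarith
  · have h3 : 2 * R / (R + 2 * t) ≤ 1 := by rw [div_le_one (by positivity)]; linarith
    rw [abs_of_nonneg (by linarith), abs_of_nonpos (by linarith)]
    have h5 : 1 - 2 * R / (R + 2 * t) = (2 * t - R) / (R + 2 * t) := by field_simp; ring
    rw [h5, div_mul_eq_mul_div, div_mul_eq_mul_div]
    refine div_le_div_of_nonneg_right ?_ (by positivity)
    nlinarith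
  · have h5 : 2 * R / (R + 2 * t') - 2 * R / (R + 2 * t)
        = 2 * R / (R + 2 * t) * ((-(t' - t)) * (2 / (R + 2 * t'))) := by field_simp; ring
    rw [h5, abs_mul, abs_mul, abs_neg, abs_of_nonneg (a := 2 * R / (R + 2 * t)) (by positivity),
      abs_of_nonneg (a := 2 / (R + 2 * t')) (by positivity), mul_assoc, mul_assoc]
    gcongr
    refine mul_le_of_le_one_right (abs_nonneg _) ?_
    rw [div_mul_eq_mul_div, div_le_one (by positivity)]
    linarith

/-- The factor decays as ‖x‖ grows, so a bounded displacement becomes negligible near the boundary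
sphere. -/
lemma norm_squash_sub_squash_le (hR : 0 < R) (x x' : X) :
    ‖squash R x' - squash R x‖ ≤ 2 * (2 * R / (R + 2 * ‖x‖)) * ‖x' - x‖ := by
  have h1 : squash R x' - squash R x = min 1 (2 * R / (R + 2 * ‖x‖)) • (x' - x) +
      (min 1 (2 * R / (R + 2 * ‖x'‖)) - min 1 (2 * R / (R + 2 * ‖x‖))) • x' := by
    rw [squash, squash, smul_sub, sub_smul]; abel
  have h2 : 0 ≤ 2 * R / (R + 2 * ‖x‖) := by positivity
  have h3 := abs_min_sub_min_mul_le hR (norm_nonneg x) (norm_nonneg x')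
  have h4 := abs_norm_sub_norm_le x' x
  rw [h1]
  refine (norm_add_le _ _).trans ?_
  rw [norm_smul, norm_smul, Real.norm_of_nonneg (le_min zero_le_one h2), Real.norm_eq_abs]
  have h5 : min 1 (2 * R / (R + 2 * ‖x‖)) * ‖x' - x‖ ≤ 2 * R / (R + 2 * ‖x‖) * ‖x' - x‖ := by
    gcongr
    exact min_le_right _ _
  have h6 : 2 * R / (R + 2 * ‖x‖) * |‖x'‖ - ‖x‖| ≤ 2 * R / (R + 2 * ‖x‖) * ‖x' - x‖ := by
    gcongr
  linarith

open Classical in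
/-- A self-map squashed into the ball of radius `R`, and extended by the identity. -/
def tame (R : ℝ) (H : X → X) (y : X) : X :=
  if ‖y‖ < R then squash R (H (unsquash R y)) else y

lemma tame_of_lt {H : X → X} {y : X} (hy : ‖y‖ < R) :
    tame R H y = squash R (H (unsquash R y)) := if_pos hy

lemma tame_of_ge {H : X → X} {y : X} (hy : R ≤ ‖y‖) : tame R H y = y := if_neg hy.not_gt

lemma tame_tame (hR : 0 < R) {H H' : X → X} (h : ∀ x, H (H' x) = x) (y : X) :
    tame R H (tame R H' y) = y := by
  rcases lt_or_ge ‖y‖ R with hy | hy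
  · rw [tame_of_lt hy, tame_of_lt (norm_squash_lt hR _), unsquash_squash hR, h,
      squash_unsquash hR hy]
  · rw [tame_of_ge hy, tame_of_ge hy]

/-- The displacement dies linearly at the sphere of radius `R`, which is what glues the squashed map
continuously to the identity outside. -/
lemma norm_tame_sub_le (hR : 0 < R) {H : X → X} {C : ℝ} (hC : ∀ x, ‖H x - x‖ ≤ C) (y : X) :
    ‖tame R H y - y‖ ≤ 4 * C / R * max 0 (R - ‖y‖) := by
  have hC0 : 0 ≤ C := (norm_nonneg _).trans (hC 0)
  rcases lt_or_ge ‖y‖ R with hy | hy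
  · rw [tame_of_lt hy, max_eq_right (by linarith)]
    set x := unsquash R y with hx
    have h1 : y = squash R x := (squash_unsquash hR hy).symm
    have h3 : 0 < R - ‖y‖ := by linarith
    have h2 : R * ‖y‖ / (2 * (R - ‖y‖)) ≤ ‖x‖ := by
      rw [hx, unsquash, norm_smul, Real.norm_of_nonneg (by positivity), mul_div_right_comm]
      gcongr
      exact le_max_right _ _
    have h4 : R ^ 2 / (R - ‖y‖) ≤ R + 2 * ‖x‖ := by
      have : R ^ 2 / (R - ‖y‖) = R + 2 * (R * ‖y‖ / (2 * (R - ‖y‖))) := by field_simp; ring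
      linarith
    have h5 : 2 * R / (R + 2 * ‖x‖) ≤ 2 * R / (R ^ 2 / (R - ‖y‖)) := by gcongr
    have h6 : 2 * R / (R ^ 2 / (R - ‖y‖)) = 2 * (R - ‖y‖) / R := by field_simp
    conv_lhs => rw [h1]
    refine (norm_squash_sub_squash_le hR x (H x)).trans ?_
    calc 2 * (2 * R / (R + 2 * ‖x‖)) * ‖H x - x‖ ≤ 2 * (2 * (R - ‖y‖) / R) * C := by
          rw [← h6]
          gcongr
          exact hC x
      _ = _ := by ring
  · rw [tame_of_ge hy, sub_self, norm_zero]
    positivity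

lemma continuous_tame (hR : 0 < R) {H : X → X} (hH : Continuous H) (hC : ∃ C, ∀ x, ‖H x - x‖ ≤ C) :
    Continuous (tame R H) := by
  obtain ⟨C, hC⟩ := hC
  rw [continuous_iff_continuousAt]
  intro y
  rcases lt_or_ge ‖y‖ R with hy | hy
  · have h1 : ContinuousAt (fun y => squash R (H (unsquash R y))) y :=
      (continuous_squash hR).continuousAt.comp (hH.continuousAt.comp (continuousAt_unsquash hy))
    refine h1.congr ?_
    filter_upwards [continuous_norm.continuousAt.eventually_lt_const hy] with z hz
    rw [tame_of_lt hz]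
  · have h1 : Tendsto (fun z => 4 * C / R * max 0 (R - ‖z‖)) (𝓝 y) (𝓝 0) := by
      have h2 : Continuous fun z : X => 4 * C / R * max 0 (R - ‖z‖) := by fun_prop
      have h3 := h2.tendsto y
      rwa [max_eq_left (by linarith), mul_zero] at h3
    have h4 := squeeze_zero_norm (norm_tame_sub_le hR hC) h1
    have h5 := h4.add (tendsto_id (α := X) (x := 𝓝 y))
    rw [zero_add] at h5
    rw [ContinuousAt, tame_of_ge hy]
    refine h5.congr fun z => ?_
    simp

/-- The homeomorphism obtained by squashing a homeomorphism at bounded distance from the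
identity. -/
def tameHomeo (hR : 0 < R) (H : X ≃ₜ X) (hC : ∃ C, ∀ x, ‖H x - x‖ ≤ C) : X ≃ₜ X where
  toFun := tame R H
  invFun := tame R H.symm
  left_inv := tame_tame hR H.symm_apply_apply
  right_inv := tame_tame hR H.apply_symm_apply
  continuous_toFun := continuous_tame hR H.continuous hC
  continuous_invFun := continuous_tame hR H.symm.continuous <| by
    obtain ⟨C, hC⟩ := hC
    refine ⟨C, fun x => ?_⟩
    have := hC (H.symm x)
    rwa [H.apply_symm_apply, norm_sub_rev] at this

end Squash

/-! ### Conjugacy of germs by homeomorphisms supported in a ball -/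

section Germ

variable {X : Type} [NormedAddCommGroup X] [NormedSpace ℝ X]

/-- The germs at the origin of two self-maps are conjugate by a homeomorphism that fixes the origin
and is supported in the ball of radius `R`. -/
def GermConj (R : ℝ) (f g : X → X) : Prop :=
  ∃ φ : X ≃ₜ X, φ 0 = 0 ∧ (∀ x, R ≤ ‖x‖ → φ x = x) ∧ ∀ᶠ x in 𝓝 0, φ (g x) = f (φ x)

variable {R : ℝ}

lemma GermConj.symm {f g : X → X} (h : GermConj R f g) : GermConj R g f := by
  obtain ⟨φ, h0, hs, h⟩ := h
  have h0' : φ.symm 0 = 0 := by rw [φ.symm_apply_eq, h0]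
  refine ⟨φ.symm, h0', fun x hx => ?_, ?_⟩
  · rw [φ.symm_apply_eq, hs x hx]
  · have h1 : Tendsto φ.symm (𝓝 0) (𝓝 0) := by
      simpa [h0'] using φ.symm.continuous.tendsto 0
    filter_upwards [h1.eventually h] with x hx
    rw [φ.symm_apply_eq, hx, φ.apply_symm_apply]

lemma GermConj.trans {f g k : X → X} (h : GermConj R f g) (h' : GermConj R g k) :
    GermConj R f k := by
  obtain ⟨φ, h0, hs, h⟩ := h
  obtain ⟨ψ, h0', hs', h'⟩ := h'
  refine ⟨ψ.trans φ, by simp [h0, h0'], fun x hx => by simp [hs' x hx, hs x hx], ?_⟩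
  have h1 : Tendsto ψ (𝓝 0) (𝓝 0) := by
    simpa [h0'] using ψ.continuous.tendsto 0
  filter_upwards [h1.eventually h, h'] with x hx hx'
  simp [hx, hx']

/-- The radial retraction onto the closed ball of radius `r`. -/
def radialRetract (r : ℝ) (x : X) : X := (r / max r ‖x‖) • x

lemma radialRetract_of_le {r : ℝ} (hr : 0 < r) {x : X} (hx : ‖x‖ ≤ r) : radialRetract r x = x := by
  rw [radialRetract, max_eq_left hx, div_self hr.ne', one_smul]

lemma norm_radialRetract_le {r : ℝ} (hr : 0 < r) (x : X) : ‖radialRetract r x‖ ≤ r := by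
  have h : 0 < max r ‖x‖ := lt_max_of_lt_left hr
  rw [radialRetract, norm_smul, Real.norm_of_nonneg (by positivity), div_mul_eq_mul_div,
    div_le_iff₀ h]
  gcongr
  exact le_max_right _ _

/-- Retraction turns a perturbation that is small on a ball into a global one; the constant 2 is
valid for an arbitrary norm. -/
lemma lipschitzWith_radialRetract {r : ℝ} (hr : 0 < r) :
    LipschitzWith 2 (radialRetract r : X → X) := by
  refine LipschitzWith.of_dist_le_mul fun x y => ?_
  rw [dist_eq_norm, dist_eq_norm]
  set m := max r ‖x‖ with hm
  set m' := max r ‖y‖ with hm'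
  have hm0 : 0 < m := lt_max_of_lt_left hr
  have hm0' : 0 < m' := lt_max_of_lt_left hr
  have h1 : radialRetract r x - radialRetract r y =
      (r / m) • (x - y) + (r / m * ((m' - m) / m')) • y := by
    have : r / m * ((m' - m) / m') = r / m - r / m' := by field_simp
    rw [radialRetract, radialRetract, this, smul_sub, sub_smul]; abel
  have h2 : |m' - m| ≤ ‖x - y‖ := by
    have h3 := abs_max_sub_max_le_abs ‖y‖ ‖x‖ r
    rw [max_comm ‖y‖, max_comm ‖x‖] at h3
    refine h3.trans ((abs_norm_sub_norm_le y x).trans ?_)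
    rw [norm_sub_rev]
  have h3 : r / m ≤ 1 := by rw [div_le_one hm0]; exact le_max_left _ _
  have h3' : 0 ≤ r / m := by positivity
  rw [h1]
  refine (norm_add_le _ _).trans ?_
  rw [norm_smul, norm_smul, norm_mul, Real.norm_of_nonneg h3', norm_div, Real.norm_eq_abs,
    Real.norm_of_nonneg hm0'.le]
  have h4 : |m' - m| / m' * ‖y‖ ≤ ‖x - y‖ := by
    rw [div_mul_eq_mul_div, div_le_iff₀ hm0']
    gcongr
    exact le_max_right _ _
  have h5 : r / m * ‖x - y‖ ≤ 1 * ‖x - y‖ := by gcongr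
  have h6 : r / m * (|m' - m| / m' * ‖y‖) ≤ 1 * ‖x - y‖ := by
    refine mul_le_mul h3 h4 (by positivity) zero_le_one
  rw [mul_assoc]
  change _ ≤ 2 * ‖x - y‖
  linarith

open scoped NNReal

variable [FiniteDimensional ℝ X]

/-- The local Hartman–Grobman theorem. -/
theorem SplitHyperbolic.germConj {T : X →L[ℝ] X} (hT : SplitHyperbolic T) :
    ∃ ε : ℝ≥0, 0 < ε ∧ ∀ (f : X → X) (r R : ℝ), 0 < r → 0 < R → f 0 = 0 →
      ApproximatesLinearOn f T (Metric.closedBall 0 r) ε → GermConj R f T := by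
  obtain ⟨ε, hε, h⟩ := hT.exists_conj
  -- Half of the global constant, because the retraction is only 2-Lipschitz.
  refine ⟨ε / 2, by positivity, fun f r R hr hR hf0 hf => ?_⟩
  have hfl := hf.lipschitzOnWith
  have hmem : ∀ x : X, radialRetract r x ∈ Metric.closedBall (0 : X) r := fun x => by
    simpa using norm_radialRetract_le hr x
  let f' : X → X := fun x => (f - ⇑T) (radialRetract r x)
  have hf' : LipschitzWith ε f' := by
    have h1 := hfl.comp (lipschitzWith_radialRetract hr).lipschitzOnWith
      (s := univ) (fun x _ => hmem x)
    rw [lipschitzOnWith_univ] at h1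
    refine h1.weaken (le_of_eq ?_)
    field_simp
  have hf'0 : f' 0 = 0 := by simp [f', radialRetract, hf0]
  have hf'b : ∀ x, ‖f' x‖ ≤ ε / 2 * r := by
    intro x
    have h1 := hf _ (hmem x) 0 (by simp [hr.le])
    rw [hf0, map_sub, map_zero, sub_zero, sub_zero, sub_zero] at h1
    refine h1.trans ?_
    push_cast
    gcongr
    exact norm_radialRetract_le hr x
  obtain ⟨H, hC, hH0, hH⟩ := h f' hf' ⟨_, hf'b⟩ hf'0
  refine ⟨tameHomeo hR H hC, ?_, fun x hx => tame_of_ge hx, ?_⟩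
  · change tame R H 0 = 0
    rw [tame_of_lt (by simpa using hR), unsquash_of_le hR (by simp; linarith), hH0,
      squash_of_le hR (by simp; linarith)]
  -- Near the origin neither the squashing nor the retraction is felt, so the global conjugacy
  -- restricts to the germs. The radii `r` and `R` are independent.
  · have e1 : ∀ᶠ x : X in 𝓝 0, ‖x‖ ≤ R / 2 := by
      filter_upwards [Metric.closedBall_mem_nhds (0 : X) (half_pos hR)] with x hx
      simpa using hx
    have e2 : ∀ᶠ x : X in 𝓝 0, ‖x‖ ≤ r := by
      filter_upwards [Metric.closedBall_mem_nhds (0 : X) hr] with x hx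
      simpa using hx
    have t1 : Tendsto H (𝓝 0) (𝓝 0) := by simpa [hH0] using H.continuous.tendsto 0
    have t2 : Tendsto T (𝓝 0) (𝓝 0) := by simpa using T.continuous.tendsto 0
    have key : ∀ x, ‖x‖ ≤ R / 2 → ‖H x‖ ≤ R / 2 → tame R H x = H x := by
      intro x h1 h2
      rw [tame_of_lt (by linarith), unsquash_of_le hR h1, squash_of_le hR h2]
    filter_upwards [e1, t1.eventually e1, t1.eventually e2, t2.eventually e1,
      (t1.comp t2).eventually e1] with x h1 h2 h3 h4 h5
    change tame R H (T x) = f (tame R H x)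
    rw [key x h1 h2, key _ h4 h5, hH]
    simp [f', radialRetract_of_le hr h3]

/-- Germ conjugacy is an equivalence relation, and Hartman–Grobman applied to nearby linear maps
makes its classes open in `s`. -/
theorem germConj_of_isPreconnected {s : Set (X →L[ℝ] X)} (hs : IsPreconnected s)
    (hsplit : ∀ T ∈ s, SplitHyperbolic T) (hR : 0 < R) {T T' : X →L[ℝ] X} (hT : T ∈ s)
    (hT' : T' ∈ s) : GermConj R T T' := by
  refine hs.induction₂ (fun T T' : X →L[ℝ] X => GermConj R T T') (fun T hT => ?_)
    (fun _ _ _ _ _ _ h h' => h.trans h') (fun _ _ _ _ h => h.symm) hT hT'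
  obtain ⟨ε, hε, h⟩ := (hsplit T hT).germConj
  have h1 : ∀ᶠ T' in 𝓝[s] T, dist T' T < ε :=
    nhdsWithin_le_nhds (Metric.ball_mem_nhds T (by exact_mod_cast hε))
  filter_upwards [h1] with T' hT'
  refine (h T' 1 R one_pos hR (map_zero _) fun x _ y _ => ?_).symm
  rw [← map_sub]
  change ‖(T' - T) (x - y)‖ ≤ _
  refine (T' - T).le_of_opNorm_le ?_ _
  rw [← dist_eq_norm]
  exact hT'.le

end Germ

/-! ### Compactly supported diffeomorphisms with prescribed derivative -/

section Supported

open scoped NNReal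

variable {X : Type} [NormedAddCommGroup X] [NormedSpace ℝ X]

/-- A smooth diffeomorphism of `X` supported in the ball of radius `R`. -/
structure IsSupportedDiffeo (R : ℝ) (ψ : X ≃ X) : Prop where
  contDiff : ContDiff ℝ ∞ ψ
  contDiff_symm : ContDiff ℝ ∞ ψ.symm
  eq_of_le : ∀ x, R ≤ ‖x‖ → ψ x = x

variable {R : ℝ}

lemma IsSupportedDiffeo.symm {ψ : X ≃ X} (h : IsSupportedDiffeo R ψ) :
    IsSupportedDiffeo R ψ.symm :=
  ⟨h.contDiff_symm, h.contDiff, fun x hx => by rw [ψ.symm_apply_eq, h.eq_of_le x hx]⟩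

lemma IsSupportedDiffeo.trans {ψ ψ' : X ≃ X} (h : IsSupportedDiffeo R ψ)
    (h' : IsSupportedDiffeo R ψ') : IsSupportedDiffeo R (ψ.trans ψ') :=
  ⟨h'.contDiff.comp h.contDiff, h.contDiff_symm.comp h'.contDiff_symm, fun x hx => by
    rw [Equiv.trans_apply, h.eq_of_le x hx, h'.eq_of_le x hx]⟩

variable [FiniteDimensional ℝ X]

/-- The diffeomorphism is x + (C-1)(χ(x)x) with χ a bump function: for C close to 1 the second term
has Lipschitz constant below 1. -/
lemma exists_supportedDiffeo_of_near_one (hR : 0 < R) :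
    ∃ δ > 0, ∀ C : X →L[ℝ] X, ‖C - 1‖ < δ →
      ∃ ψ : X ≃ X, IsSupportedDiffeo R ψ ∧ ∀ᶠ x in 𝓝 0, ψ x = C x := by
  let χ : ContDiffBump (0 : X) := ⟨R / 2, R, half_pos hR, half_lt_self hR⟩
  let f : X → X := fun x => χ x • x
  have hfd : ContDiff ℝ ∞ f := χ.contDiff.smul contDiff_id
  have hfs : HasCompactSupport f := χ.hasCompactSupport.smul_right
  obtain ⟨K, hK⟩ := ContDiff.lipschitzWith_of_hasCompactSupport hfs hfd (by simp)
  refine ⟨((K : ℝ) + 1)⁻¹, by positivity, fun C hC => ?_⟩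
  set D : X →L[ℝ] X := C - 1 with hD
  have hDK : K * ‖D‖₊ < 1 := by
    have h1 := mul_lt_mul_of_pos_left hC (show 0 < (K : ℝ) + 1 by positivity)
    rw [mul_inv_cancel₀ (by positivity)] at h1
    have h2 : (K : ℝ) * ‖D‖ < 1 := by nlinarith [norm_nonneg D]
    exact_mod_cast h2
  let g : X → X := fun x => x + D (f x)
  have hg : ContDiff ℝ ∞ g := contDiff_id.add (D.contDiff.comp hfd)
  have hDf : LipschitzWith (‖D‖₊ * K) (D ∘ f) := D.lipschitz.comp hK
  have happ : ApproximatesLinearOn g ((ContinuousLinearEquiv.refl ℝ X : X ≃L[ℝ] X) : X →L[ℝ] X)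
      univ (‖D‖₊ * K) := by
    rw [ApproximatesLinearOn.approximatesLinearOn_iff_lipschitzOnWith, lipschitzOnWith_univ]
    have : g - ⇑((ContinuousLinearEquiv.refl ℝ X : X ≃L[ℝ] X) : X →L[ℝ] X) = D ∘ f := by
      funext x; simp [g]
    rwa [this]
  have hc : Subsingleton X ∨ ‖D‖₊ * K <
      ‖((ContinuousLinearEquiv.refl ℝ X).symm : X →L[ℝ] X)‖₊⁻¹ := by
    rcases subsingleton_or_nontrivial X with h | h
    · exact .inl h
    · right
      have : ‖((ContinuousLinearEquiv.refl ℝ X).symm : X →L[ℝ] X)‖₊ = 1 :=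
        ContinuousLinearMap.nnnorm_id
      rw [this, inv_one, mul_comm]
      exact hDK
  let H : X ≃ₜ X := happ.toHomeomorph g hc
  have hH : ∀ x, H x = g x := fun _ => rfl
  -- The derivative is 1 plus a term of norm below 1, invertible by the Neumann series; this gives
  -- smoothness of the inverse.
  have hderiv : ∀ a, ∃ L : X ≃L[ℝ] X, HasFDerivAt H (L : X →L[ℝ] X) a := by
    intro a
    have h1 : HasFDerivAt (D ∘ f) (fderiv ℝ (D ∘ f) a) a :=
      ((D.contDiff.comp hfd).differentiable (by simp) a).hasFDerivAt
    have h2 : ‖-(fderiv ℝ (D ∘ f) a)‖ < 1 := by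
      rw [norm_neg]
      refine (norm_fderiv_le_of_lipschitz ℝ hDf).trans_lt ?_
      rw [mul_comm]
      exact_mod_cast hDK
    refine ⟨ContinuousLinearEquiv.ofUnit (Units.oneSub _ h2), ?_⟩
    have h3 : ((ContinuousLinearEquiv.ofUnit (Units.oneSub _ h2) : X ≃L[ℝ] X) : X →L[ℝ] X) =
        ContinuousLinearMap.id ℝ X + fderiv ℝ (D ∘ f) a := by
      change 1 - -(fderiv ℝ (D ∘ f) a) = _
      rw [sub_neg_eq_add]; rfl
    rw [h3]
    exact (hasFDerivAt_id a).add h1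
  choose L hL using hderiv
  refine ⟨H.toEquiv, ⟨hg, H.contDiff_symm hL hg, fun x hx => ?_⟩, ?_⟩
  · change x + D (χ x • x) = x
    rw [χ.zero_of_le_dist (by simpa using hx)]
    simp
  · filter_upwards [χ.eventuallyEq_one] with x hx
    change x + D (χ x • x) = C x
    rw [hx, hD]
    simp

/-- Differing by the germ of a supported diffeomorphism is an equivalence relation with open
classes, by the case near 1, so it is constant on the identity component. -/
theorem exists_supportedDiffeo (hR : 0 < R) {T : X →L[ℝ] X}
    (hT : T ∈ pathComponentIn {S : X →L[ℝ] X | IsUnit S} 1) :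
    ∃ ψ : X ≃ X, IsSupportedDiffeo R ψ ∧ ∀ᶠ x in 𝓝 0, ψ x = T x := by
  let P : (X →L[ℝ] X) → (X →L[ℝ] X) → Prop := fun S S' =>
    ∃ ψ : X ≃ X, IsSupportedDiffeo R ψ ∧ ∀ᶠ x in 𝓝 0, ψ (S x) = S' x
  have h1mem : (1 : X →L[ℝ] X) ∈ pathComponentIn {S : X →L[ℝ] X | IsUnit S} 1 :=
    mem_pathComponentIn_self (F := {S : X →L[ℝ] X | IsUnit S}) isUnit_one
  have hpre : IsPreconnected (pathComponentIn {S : X →L[ℝ] X | IsUnit S} 1) :=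
    (isPathConnected_pathComponentIn (F := {S : X →L[ℝ] X | IsUnit S})
      isUnit_one).isConnected.isPreconnected
  have key : P 1 T := by
    refine hpre.induction₂ P (fun S hS => ?_) ?_ ?_ h1mem hT
    · obtain ⟨δ, hδ, h⟩ := exists_supportedDiffeo_of_near_one (X := X) hR
      obtain ⟨u, rfl⟩ := isUnit_of_mem_pathComponentIn hS
      have hc : Tendsto (fun S' : X →L[ℝ] X => ‖S' * (↑u⁻¹ : X →L[ℝ] X) - 1‖) (𝓝 ↑u) (𝓝 0) := by
        have : Continuous (fun S' : X →L[ℝ] X => ‖S' * (↑u⁻¹ : X →L[ℝ] X) - 1‖) := by fun_prop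
        simpa using this.tendsto ↑u
      filter_upwards [nhdsWithin_le_nhds (hc.eventually_lt_const hδ)] with S' hS'
      obtain ⟨ψ, hψ, hψ'⟩ := h _ hS'
      refine ⟨ψ, hψ, ?_⟩
      have hu : Tendsto (u : X →L[ℝ] X) (𝓝 0) (𝓝 0) := by
        simpa using (u : X →L[ℝ] X).continuous.tendsto 0
      filter_upwards [hu.eventually hψ'] with x hx
      rw [hx, ← mul_apply_eq_comp, mul_assoc, Units.inv_mul, mul_one]
    · rintro S S' S'' - - - ⟨ψ, hψ, h⟩ ⟨ψ', hψ', h'⟩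
      refine ⟨ψ.trans ψ', hψ.trans hψ', ?_⟩
      filter_upwards [h, h'] with x hx hx'
      rw [Equiv.trans_apply, hx, hx']
    · rintro S S' - - ⟨ψ, hψ, h⟩
      refine ⟨ψ.symm, hψ.symm, ?_⟩
      filter_upwards [h] with x hx
      rw [ψ.symm_apply_eq, hx]
  obtain ⟨ψ, hψ, h⟩ := key
  exact ⟨ψ, hψ, h⟩

end Supported

/-! ### Extending compactly supported maps from a chart -/

section Extend

variable {M X : Type*} [TopologicalSpace M] [NormedAddCommGroup X] [NormedSpace ℝ X]

open Classical in
/-- A self-map of `X` transported to `M` through a chart, and extended by the identity. -/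
def extendMap (τ : OpenPartialHomeomorph M X) (Φ : X → X) (x : M) : M :=
  if x ∈ τ.source then τ.symm (Φ (τ x)) else x

variable {τ : OpenPartialHomeomorph M X} {R : ℝ}

lemma extendMap_of_mem {Φ : X → X} {x : M} (hx : x ∈ τ.source) :
    extendMap τ Φ x = τ.symm (Φ (τ x)) := if_pos hx

lemma extendMap_of_notMem {Φ : X → X} {x : M} (hx : x ∉ τ.source) : extendMap τ Φ x = x := if_neg hx

/-- A point of the ball sent outside it would share its image with a point already fixed there,
against injectivity. -/
lemma mapsTo_target (hτ : Metric.closedBall 0 R ⊆ τ.target) (Φ : X ≃ X)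
    (hΦ : ∀ y, R ≤ ‖y‖ → Φ y = y) : MapsTo Φ τ.target τ.target := by
  intro y hy
  rcases le_or_gt R ‖y‖ with h | h
  · rwa [hΦ y h]
  · refine hτ ?_
    rw [mem_closedBall_zero_iff]
    by_contra! h'
    have h1 := Φ.injective (hΦ _ h'.le)
    rw [h1] at h'
    linarith

lemma extendMap_extendMap (hτ : Metric.closedBall 0 R ⊆ τ.target) {Φ Ψ : X ≃ X}
    (hΨ : ∀ y, R ≤ ‖y‖ → Ψ y = y) (h : ∀ y, Φ (Ψ y) = y) (x : M) :
    extendMap τ Φ (extendMap τ Ψ x) = x := by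
  by_cases hx : x ∈ τ.source
  · have h1 := mapsTo_target hτ Ψ hΨ (τ.map_source hx)
    rw [extendMap_of_mem hx, extendMap_of_mem (τ.map_target h1), τ.right_inv h1, h, τ.left_inv hx]
  · rw [extendMap_of_notMem hx, extendMap_of_notMem hx]

/-- Near a point outside of the domain of the chart, the extended map is the identity. -/
lemma extendMap_eventuallyEq [T2Space M] [ProperSpace X]
    (hτ : Metric.closedBall 0 R ⊆ τ.target) {Φ : X → X} (hΦ : ∀ y, R ≤ ‖y‖ → Φ y = y) {x : M}
    (hx : x ∉ τ.source) : extendMap τ Φ =ᶠ[𝓝 x] id := by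
  -- The support is compact, hence closed in the Hausdorff space `M`, and it misses `x`.
  have hK : IsClosed (τ.symm '' Metric.closedBall 0 R) :=
    ((isCompact_closedBall 0 R).image_of_continuousOn (τ.continuousOn_symm.mono hτ)).isClosed
  have hxK : x ∉ τ.symm '' Metric.closedBall 0 R := by
    rintro ⟨y, hy, rfl⟩
    exact hx (τ.map_target (hτ hy))
  filter_upwards [hK.isOpen_compl.mem_nhds hxK] with z hz
  by_cases hzs : z ∈ τ.source
  · rw [extendMap_of_mem hzs, hΦ, τ.left_inv hzs]
    · rfl
    · by_contra! h
      exact hz ⟨τ z, mem_closedBall_zero_iff.2 h.le, τ.left_inv hzs⟩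
  · rw [extendMap_of_notMem hzs]; rfl

lemma extendMap_eventuallyEq_of_mem {Φ : X → X} {x : M}
    (hx : x ∈ τ.source) : extendMap τ Φ =ᶠ[𝓝 x] τ.symm ∘ Φ ∘ τ := by
  filter_upwards [τ.open_source.mem_nhds hx] with z hz
  exact extendMap_of_mem hz

lemma continuous_extendMap [T2Space M] [ProperSpace X]
    (hτ : Metric.closedBall 0 R ⊆ τ.target) {Φ : X ≃ X} (hΦ : ∀ y, R ≤ ‖y‖ → Φ y = y)
    (hc : Continuous Φ) : Continuous (extendMap τ Φ) := by
  rw [continuous_iff_continuousAt]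
  intro x
  by_cases hx : x ∈ τ.source
  · refine ContinuousAt.congr ?_ (extendMap_eventuallyEq_of_mem hx).symm
    refine ContinuousAt.comp (τ.continuousAt_symm ?_) (hc.continuousAt.comp (τ.continuousAt hx))
    exact mapsTo_target hτ Φ hΦ (τ.map_source hx)
  · exact continuousAt_id.congr (extendMap_eventuallyEq hτ hΦ hx).symm

/-- A homeomorphism of `X` supported in a ball, transported to `M` through a chart. -/
def extendHomeo [T2Space M] [ProperSpace X] (hτ : Metric.closedBall 0 R ⊆ τ.target) (Φ : X ≃ₜ X)
    (hΦ : ∀ y, R ≤ ‖y‖ → Φ y = y) : M ≃ₜ M where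
  toFun := extendMap τ Φ
  invFun := extendMap τ Φ.symm
  left_inv := extendMap_extendMap (Φ := Φ.symm.toEquiv) (Ψ := Φ.toEquiv) hτ hΦ Φ.symm_apply_apply
  right_inv := extendMap_extendMap (Φ := Φ.toEquiv) (Ψ := Φ.symm.toEquiv) hτ
    (fun y hy => by rw [Homeomorph.coe_toEquiv, Φ.symm_apply_eq, hΦ y hy]) Φ.apply_symm_apply
  continuous_toFun := continuous_extendMap (Φ := Φ.toEquiv) hτ hΦ Φ.continuous
  continuous_invFun := continuous_extendMap (Φ := Φ.symm.toEquiv) hτ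
    (fun y hy => by rw [Homeomorph.coe_toEquiv, Φ.symm_apply_eq, hΦ y hy]) Φ.symm.continuous

end Extend

/-! ### The centred chart and extension of supported diffeomorphisms. -/

section Chart

variable {n : ℕ} {M : Type*} [TopologicalSpace M] [ChartedSpace (Eu n) M]

/-- The chart at `p`, translated so that `p` corresponds to the origin. -/
def centeredChart (n : ℕ) {M : Type*} [TopologicalSpace M] [ChartedSpace (Eu n) M] (p : M) :
    OpenPartialHomeomorph M (Eu n) where
  toFun x := chartAt (Eu n) p x - chartAt (Eu n) p p
  invFun y := (chartAt (Eu n) p).symm (chartAt (Eu n) p p + y)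
  source := (chartAt (Eu n) p).source
  target := {y | chartAt (Eu n) p p + y ∈ (chartAt (Eu n) p).target}
  map_source' x hx := by
    change chartAt (Eu n) p p + (chartAt (Eu n) p x - chartAt (Eu n) p p) ∈
      (chartAt (Eu n) p).target
    rw [add_sub_cancel]
    exact (chartAt (Eu n) p).map_source hx
  map_target' y hy := (chartAt (Eu n) p).map_target hy
  left_inv' x hx := by
    rw [add_sub_cancel, (chartAt (Eu n) p).left_inv hx]
  right_inv' y hy := by
    rw [(chartAt (Eu n) p).right_inv hy, add_sub_cancel_left]
  open_source := (chartAt (Eu n) p).open_source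
  open_target := (chartAt (Eu n) p).open_target.preimage (by fun_prop)
  continuousOn_toFun := (chartAt (Eu n) p).continuousOn.sub continuousOn_const
  continuousOn_invFun := (chartAt (Eu n) p).continuousOn_symm.comp (by fun_prop) fun _ hy => hy

lemma centeredChart_self (p : M) : centeredChart n p p = 0 := sub_self _

lemma mem_centeredChart_source (p : M) : p ∈ (centeredChart n p).source := mem_chart_source _ p

lemma zero_mem_centeredChart_target (p : M) : (0 : Eu n) ∈ (centeredChart n p).target := by
  rw [← centeredChart_self p]
  exact (centeredChart n p).map_source (mem_centeredChart_source p)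

lemma centeredChart_symm_zero (p : M) : (centeredChart n p).symm 0 = p := by
  rw [← centeredChart_self p]
  exact (centeredChart n p).left_inv (mem_centeredChart_source p)

lemma tendsto_centeredChart_symm (p : M) :
    Tendsto (centeredChart n p).symm (𝓝 0) (𝓝 p) := by
  have := (centeredChart n p).continuousAt_symm (zero_mem_centeredChart_target p)
  rwa [ContinuousAt, centeredChart_symm_zero] at this

lemma tendsto_centeredChart (p : M) :
    Tendsto (centeredChart n p) (𝓝 p) (𝓝 0) := by
  have := (centeredChart n p).continuousAt (mem_centeredChart_source p)
  rwa [ContinuousAt, centeredChart_self] at this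

variable [IsManifold (𝓡 n) ∞ M]

lemma contMDiffOn_centeredChart (p : M) :
    ContMDiffOn (𝓡 n) 𝓘(ℝ, Eu n) ∞ (centeredChart n p) (centeredChart n p).source :=
  (contMDiffOn_chart (I := 𝓡 n) (x := p)).sub contMDiffOn_const

lemma contMDiffOn_centeredChart_symm (p : M) :
    ContMDiffOn 𝓘(ℝ, Eu n) (𝓡 n) ∞ (centeredChart n p).symm (centeredChart n p).target :=
  (contMDiffOn_chart_symm (I := 𝓡 n) (x := p)).comp
    (contMDiffOn_const.add contMDiffOn_id) fun _ hy => hy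

variable [T2Space M] {R : ℝ}

lemma contMDiff_extendMap {p : M} (hτ : Metric.closedBall 0 R ⊆ (centeredChart n p).target)
    {Φ : Eu n ≃ Eu n} (hΦ : ∀ y, R ≤ ‖y‖ → Φ y = y) (hc : ContDiff ℝ ∞ Φ) :
    ContMDiff (𝓡 n) (𝓡 n) ∞ (extendMap (centeredChart n p) Φ) := by
  intro x
  by_cases hx : x ∈ (centeredChart n p).source
  · refine ContMDiffAt.congr_of_eventuallyEq ?_ (extendMap_eventuallyEq_of_mem hx)
    have h1 := (contMDiffOn_centeredChart p).contMDiffAt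
      ((centeredChart n p).open_source.mem_nhds hx)
    have h2 := mapsTo_target hτ Φ hΦ ((centeredChart n p).map_source hx)
    have h3 := (contMDiffOn_centeredChart_symm p).contMDiffAt
      ((centeredChart n p).open_target.mem_nhds h2)
    exact h3.comp x ((hc.contMDiff.contMDiffAt).comp x h1)
  · exact contMDiffAt_id.congr_of_eventuallyEq (extendMap_eventuallyEq hτ hΦ hx)

/-- A diffeomorphism of `ℝⁿ` supported in a ball, transported to `M` through the chart at `p`. -/
def extendDiffeo {p : M} (hτ : Metric.closedBall 0 R ⊆ (centeredChart n p).target)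
    (ψ : Eu n ≃ Eu n) (hψ : IsSupportedDiffeo R ψ) : M ≃ₘ^∞⟮𝓡 n, 𝓡 n⟯ M where
  toFun := extendMap (centeredChart n p) ψ
  invFun := extendMap (centeredChart n p) ψ.symm
  left_inv := extendMap_extendMap hτ hψ.eq_of_le ψ.symm_apply_apply
  right_inv := extendMap_extendMap hτ hψ.symm.eq_of_le ψ.apply_symm_apply
  contMDiff_toFun := contMDiff_extendMap hτ hψ.eq_of_le hψ.contDiff
  contMDiff_invFun := contMDiff_extendMap hτ hψ.symm.eq_of_le hψ.contDiff_symm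

end Chart

/-! ### Realizing a linear germ conjugate to a given diffeomorphism -/

section Realize

open scoped NNReal

variable {n : ℕ} {M : Type*} [TopologicalSpace M] [ChartedSpace (Eu n) M]

/-- At a fixed point the source and target charts coincide, and translating both does not affect the
derivative. -/
lemma mfderiv_eq_fderiv_centeredChart {k : M → M} {p : M} (hp : k p = p)
    (hk : MDifferentiableAt (𝓡 n) (𝓡 n) k p) :
    (mfderiv (𝓡 n) (𝓡 n) k p : Eu n →L[ℝ] Eu n) =
      fderiv ℝ (centeredChart n p ∘ k ∘ (centeredChart n p).symm) 0 := by
  have h1 : (mfderiv (𝓡 n) (𝓡 n) k p : Eu n →L[ℝ] Eu n) =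
      fderiv ℝ (fun y => chartAt (Eu n) p (k ((chartAt (Eu n) p).symm y)))
        (chartAt (Eu n) p p) := by
    have h2 : (mfderiv (𝓡 n) (𝓡 n) k p : Eu n →L[ℝ] Eu n) =
      fderiv ℝ (fun y => chartAt (Eu n) (k p) (k ((chartAt (Eu n) p).symm y)))
        (chartAt (Eu n) p p) := by
      simp only [mfderiv, hk, ↓reduceIte, writtenInExtChartAt, ModelWithCorners.range_eq_univ,
        fderivWithin_univ]
      rfl
    rw [h2, hp]
  rw [h1]
  have h3 : centeredChart n p ∘ k ∘ (centeredChart n p).symm = fun y =>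
      (fun y => chartAt (Eu n) p (k ((chartAt (Eu n) p).symm y))) (chartAt (Eu n) p p + y) -
        chartAt (Eu n) p p := rfl
  rw [h3, fderiv_sub_const]
  refine Eq.trans ?_ (fderiv_comp_add_left (𝕜 := ℝ)
    (f := fun y => chartAt (Eu n) p (k ((chartAt (Eu n) p).symm y))) (x := 0)
    (chartAt (Eu n) p p)).symm
  rw [add_zero]

variable [IsManifold (𝓡 n) ∞ M]

lemma derivAt_eq_fderiv {k : WithTop ℕ∞} (hk : k ≠ 0) (g : M ≃ₘ^k⟮𝓡 n, 𝓡 n⟯ M) {p : M}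
    (hp : g p = p) {B : Eu n ≃L[ℝ] Eu n} (hB : B = derivAt hk g p hp) :
    (B : Eu n →L[ℝ] Eu n) =
      fderiv ℝ (centeredChart n p ∘ g ∘ (centeredChart n p).symm) 0 :=
  (congrArg ContinuousLinearEquiv.toContinuousLinearMap hB).trans
    (mfderiv_eq_fderiv_centeredChart hp (g.contMDiff.mdifferentiable hk p))

lemma contDiffAt_centeredChart (h : M ≃ₘ^1⟮𝓡 n, 𝓡 n⟯ M) {p : M} (hp : h p = p) :
    ContDiffAt ℝ 1 (centeredChart n p ∘ h ∘ (centeredChart n p).symm) 0 := by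
  rw [← contMDiffAt_iff_contDiffAt]
  have h1 : ContMDiffAt 𝓘(ℝ, Eu n) (𝓡 n) 1 (centeredChart n p).symm 0 :=
    ((contMDiffOn_centeredChart_symm p).contMDiffAt
      ((centeredChart n p).open_target.mem_nhds (zero_mem_centeredChart_target p))).of_le
      (by norm_cast)
  have h2 : ContMDiffAt (𝓡 n) 𝓘(ℝ, Eu n) 1 (centeredChart n p) p :=
    ((contMDiffOn_centeredChart p).contMDiffAt
      ((centeredChart n p).open_source.mem_nhds (mem_centeredChart_source p))).of_le
      (by norm_cast)
  refine ContMDiffAt.comp (I' := 𝓡 n) 0 ?_ (ContMDiffAt.comp (I' := 𝓡 n) 0 ?_ h1)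
  · simp only [Function.comp_apply, centeredChart_symm_zero, hp]
    exact h2
  · exact h.contMDiff.contMDiffAt

variable [T2Space M]

/-- A `C¹` diffeomorphism with a hyperbolic fixed point is topologically conjugate, near the fixed
point, to a smooth diffeomorphism that is linear in the chart, for every linear map whose germ is
conjugate to the derivative. -/
theorem exists_conjugate_diffeo (h : M ≃ₘ^1⟮𝓡 n, 𝓡 n⟯ M) {p : M} (hp : h p = p)
    {A B : Eu n ≃L[ℝ] Eu n} (hA : A = derivAt one_ne_zero h p hp)
    (hAs : SplitHyperbolic (A : Eu n →L[ℝ] Eu n))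
    (hAB : ∀ R : ℝ, 0 < R → GermConj R A B)
    (hB : (B : Eu n →L[ℝ] Eu n) ∈ pathComponentIn {S : Eu n →L[ℝ] Eu n | IsUnit S} 1) :
    ∃ (g : M ≃ₘ^∞⟮𝓡 n, 𝓡 n⟯ M) (hg : g p = p) (φ : M ≃ₜ M),
      B = derivAt (by simp) g p hg ∧ φ p = p ∧ (∀ᶠ x in 𝓝 p, φ (g x) = h (φ x)) ∧
      ∀ᶠ x in 𝓝 p, g x = (centeredChart n p).symm (B (centeredChart n p x)) := by
  set τ := centeredChart n p with hτ_def
  obtain ⟨R, hR, hτ⟩ := Metric.nhds_basis_closedBall.mem_iff.1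
    (τ.open_target.mem_nhds (zero_mem_centeredChart_target p))
  set f : Eu n → Eu n := τ ∘ h ∘ τ.symm with hf_def
  have hf0 : f 0 = 0 := by
    simp [hf_def, hτ_def, centeredChart_symm_zero, hp, centeredChart_self]
  have hfA : HasStrictFDerivAt f (A : Eu n →L[ℝ] Eu n) 0 := by
    have h1 : (A : Eu n →L[ℝ] Eu n) = fderiv ℝ f 0 := derivAt_eq_fderiv one_ne_zero h hp hA
    rw [h1]
    exact (contDiffAt_centeredChart h hp).hasStrictFDerivAt one_ne_zero
  obtain ⟨ε, hε, hloc⟩ := hAs.germConj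
  obtain ⟨s, hs, happ⟩ := hfA.approximates_deriv_on_nhds (.inr hε)
  obtain ⟨r, hr, hrs⟩ := Metric.nhds_basis_closedBall.mem_iff.1 hs
  -- Hartman–Grobman replaces the chart expression of `h` by its derivative `A`, and the deformation
  -- replaces `A` by `B`.
  obtain ⟨φ, hφ0, hφR, hφ⟩ := (hloc f r R hr hR hf0 (happ.mono_set hrs)).trans (hAB R hR)
  obtain ⟨ψ, hψ, hψB⟩ := exists_supportedDiffeo hR hB
  have hps : p ∈ τ.source := mem_centeredChart_source p
  let g := extendDiffeo hτ ψ hψ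
  have hg_apply : ∀ x, g x = extendMap τ ψ x := fun _ => rfl
  have hτp : Tendsto τ (𝓝 p) (𝓝 0) := tendsto_centeredChart p
  have hgB : ∀ᶠ x in 𝓝 p, g x = τ.symm (B (τ x)) := by
    filter_upwards [hτp.eventually hψB, τ.open_source.mem_nhds hps] with x hx hxs
    rw [hg_apply, extendMap_of_mem hxs, hx]
    rfl
  have hg : g p = p := by
    rw [hgB.self_of_nhds, hτ_def, centeredChart_self, map_zero, centeredChart_symm_zero]
  have hBt : Tendsto B (𝓝 0) (𝓝 0) := by simpa using B.continuous.tendsto 0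
  have hφt : Tendsto φ (𝓝 0) (𝓝 0) := by simpa [hφ0] using φ.continuous.tendsto 0
  have htarget : ∀ᶠ y in 𝓝 (0 : Eu n), y ∈ τ.target :=
    τ.open_target.mem_nhds (zero_mem_centeredChart_target p)
  have hsource : ∀ᶠ x in 𝓝 p, x ∈ τ.source := τ.open_source.mem_nhds hps
  let Φ := extendHomeo hτ φ hφR
  have hΦ : ∀ x ∈ τ.source, Φ x = τ.symm (φ (τ x)) := fun x hx => extendMap_of_mem hx
  have hΦp : Φ p = p := by
    rw [hΦ p hps, hτ_def, centeredChart_self, hφ0, centeredChart_symm_zero]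
  refine ⟨g, hg, Φ, ?_, hΦp, ?_, hgB⟩
  · apply ContinuousLinearEquiv.coe_injective
    have h1 : τ ∘ g ∘ τ.symm =ᶠ[𝓝 0] B := by
      filter_upwards [(tendsto_centeredChart_symm p).eventually hgB, htarget,
        hBt.eventually htarget] with y hy hyt hyB
      rw [Function.comp_apply, Function.comp_apply, hy, τ.right_inv hyt, τ.right_inv hyB]
    refine Eq.trans ?_ (derivAt_eq_fderiv (by simp) g hg rfl).symm
    rw [h1.fderiv_eq]
    exact (B : Eu n →L[ℝ] Eu n).fderiv.symm
  · have hhΦ : Tendsto (fun x => h (Φ x)) (𝓝 p) (𝓝 p) := by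
      have : Continuous fun x => h (Φ x) := h.continuous.comp Φ.continuous
      simpa [hΦp, hp] using this.tendsto p
    have hgc : Tendsto g (𝓝 p) (𝓝 p) := by simpa [hg] using g.continuous.tendsto p
    filter_upwards [hgB, hτp.eventually hφ, hsource, hhΦ.eventually hsource,
      hgc.eventually hsource, (hBt.comp hτp).eventually htarget] with x h1 h2 h3 h4 h5 h6
    rw [hΦ _ h5, h1, τ.right_inv (show B (τ x) ∈ τ.target from h6), h2, hΦ x h3]
    rw [hΦ x h3] at h4
    exact τ.left_inv h4

end Realize

/-! ### Deforming a hyperbolic automorphism -/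

section Deform

variable {X : Type} [NormedAddCommGroup X] [NormedSpace ℝ X]

variable {E E' : Type} [NormedAddCommGroup E] [NormedSpace ℝ E] [FiniteDimensional ℝ E]
  [NormedAddCommGroup E'] [NormedSpace ℝ E'] [FiniteDimensional ℝ E']

lemma continuousOn_splitMap (e : X ≃L[ℝ] E × E') :
    ContinuousOn (fun z : (E →L[ℝ] E) × (E' →L[ℝ] E') => splitMap e z.1 z.2)
      (univ ×ˢ {W | IsUnit W}) := by
  have : CompleteSpace E' := FiniteDimensional.complete ℝ E'
  have h1 : ContinuousOn (fun z : (E →L[ℝ] E) × (E' →L[ℝ] E') => Ring.inverse z.2)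
      (univ ×ˢ {W | IsUnit W}) := by
    intro z hz
    obtain ⟨u, hu⟩ := hz.2
    have h2 := NormedRing.inverse_continuousAt u
    rw [hu] at h2
    exact (h2.comp continuousAt_snd).continuousWithinAt
  have h3 : Continuous fun z : (E →L[ℝ] E) × (E' →L[ℝ] E') => z.1.prodMap z.2 :=
    (ContinuousLinearMap.prodMapL ℝ E E E' E').continuous
  unfold splitMap
  refine continuousOn_const.clm_comp (ContinuousOn.clm_comp ?_ continuousOn_const)
  exact h3.comp_continuousOn (continuousOn_fst.prodMk h1)

lemma isUnit_splitMap (e : X ≃L[ℝ] E × E') {S : E →L[ℝ] E} {W : E' →L[ℝ] E'} (hS : IsUnit S)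
    (hW : IsUnit W) : IsUnit (splitMap e S W) := by
  obtain ⟨u, rfl⟩ := hS
  obtain ⟨w, rfl⟩ := hW
  refine ⟨((e.trans ((ContinuousLinearEquiv.ofUnit u).prodCongr
    (ContinuousLinearEquiv.ofUnit w⁻¹))).trans e.symm).toUnit, ?_⟩
  ext x
  simp [splitMap]
  rfl

lemma splitMap_one (e : X ≃L[ℝ] E × E') : splitMap e 1 1 = 1 := by
  ext x
  simp [splitMap]

lemma splitMap_mem_pathComponentIn (e : X ≃L[ℝ] E × E') {S : E →L[ℝ] E} {W : E' →L[ℝ] E'}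
    (hS : S ∈ stableAut E) (hW : W ∈ stableAut E') :
    splitMap e S W ∈ pathComponentIn {T : X →L[ℝ] X | IsUnit T} 1 := by
  have h1 := (JoinedIn.prod hS.2 hW.2).map_continuousOn
    ((continuousOn_splitMap e).mono (prod_mono_left (subset_univ _)))
  simp only [splitMap_one] at h1
  refine h1.mono ?_
  rintro _ ⟨z, hz, rfl⟩
  exact isUnit_splitMap e hz.1 hz.2

/-- The pairs of stable automorphisms form a connected set, whose continuous image consists of split
hyperbolic maps. -/
lemma germConj_splitMap [FiniteDimensional ℝ X] (e : X ≃L[ℝ] E × E') {S S' : E →L[ℝ] E}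
    {W W' : E' →L[ℝ] E'}
    (hS : S ∈ stableAut E) (hW : W ∈ stableAut E') (hS' : S' ∈ stableAut E)
    (hW' : W' ∈ stableAut E') {R : ℝ} (hR : 0 < R) :
    GermConj R (splitMap e S W) (splitMap e S' W') := by
  have h1 : IsPreconnected (stableAut E ×ˢ stableAut E') :=
    isPreconnected_stableAut.prod isPreconnected_stableAut
  have h2 := h1.image _ ((continuousOn_splitMap e).mono fun z hz =>
    ⟨mem_univ _, isUnit_of_mem_pathComponentIn hz.2.2⟩)
  refine germConj_of_isPreconnected h2 ?_ hR ⟨(S, W), ⟨hS, hW⟩, rfl⟩ ⟨(S', W'), ⟨hS', hW'⟩, rfl⟩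
  rintro _ ⟨z, hz, rfl⟩
  exact splitHyperbolic_splitMap e hz.1.1 (isUnit_of_mem_pathComponentIn hz.1.2) hz.2.1
    (isUnit_of_mem_pathComponentIn hz.2.2)

/-- A hyperbolic automorphism that preserves the orientations of its stable and unstable subspaces
is, in the splitting of the space, a stable automorphism times the inverse of a stable one. -/
theorem IsHyperbolic.exists_eq_splitMap [FiniteDimensional ℝ X] {A : X ≃L[ℝ] X}
    (hA : IsHyperbolic A)
    (hs : PreservesStableOrientation A) (hu : PreservesUnstableOrientation A) :
    ∃ (e : X ≃L[ℝ] stableSubspace A × stableSubspace A.symm),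
      ∃ S ∈ stableAut (stableSubspace A), ∃ W ∈ stableAut (stableSubspace A.symm),
        (A : X →L[ℝ] X) = splitMap e S W := by
  let e : X ≃L[ℝ] stableSubspace A × stableSubspace A.symm :=
    (Submodule.prodEquivOfIsCompl _ _ hA.isCompl).symm.toContinuousLinearEquiv
  have he : ∀ x, e.symm x = x.1 + x.2 := fun x => rfl
  let U : stableSubspace A.symm →L[ℝ] stableSubspace A.symm := LinearMap.toContinuousLinearMap
    ((A.toLinearEquiv.toLinearMap).restrict (map_mem_unstable A))
  have hUW : U * stablePart A.symm = 1 := by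
    ext x
    exact A.apply_symm_apply (x : X)
  have hWU : stablePart A.symm * U = 1 := by
    ext x
    exact A.symm_apply_apply (x : X)
  have hinv : Ring.inverse (stablePart A.symm) = U :=
    Ring.inverse_unit (⟨stablePart A.symm, U, hWU, hUW⟩ : (stableSubspace A.symm →L[ℝ] _)ˣ)
  -- The orientation hypothesis concerns `U`; its inverse has the reciprocal determinant.
  have hdetW : 0 < LinearMap.det (stablePart A.symm : stableSubspace A.symm →ₗ[ℝ] _) := by
    have hu' : 0 < LinearMap.det (U : stableSubspace A.symm →ₗ[ℝ] stableSubspace A.symm) := hu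
    have h1 := congrArg (fun T : stableSubspace A.symm →L[ℝ] stableSubspace A.symm =>
      LinearMap.det (T : stableSubspace A.symm →ₗ[ℝ] stableSubspace A.symm)) hUW
    have h2 : LinearMap.det (U : stableSubspace A.symm →ₗ[ℝ] stableSubspace A.symm) *
        LinearMap.det (stablePart A.symm : stableSubspace A.symm →ₗ[ℝ] stableSubspace A.symm) = 1 := by
      rw [← map_mul]
      refine Eq.trans h1 ?_
      exact LinearMap.det_id
    by_contra! h3
    nlinarith
  refine ⟨e, stablePart A, ⟨orbitStable_stablePart A, ?_⟩, stablePart A.symm,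
    ⟨orbitStable_stablePart A.symm, ?_⟩, ?_⟩
  · exact (joinedIn_one_of_linearMap_det_pos (T := stablePart A) hs).symm
  · exact (joinedIn_one_of_linearMap_det_pos hdetW).symm
  · ext x
    obtain ⟨y, rfl⟩ := e.symm.surjective x
    simp only [splitMap, ContinuousLinearMap.comp_apply, ContinuousLinearEquiv.coe_coe,
      ContinuousLinearEquiv.apply_symm_apply, hinv]
    rw [he, he, map_add]
    rfl

end Deform

/-! ### The topology of projective space -/

section Proj

open scoped RealInnerProductSpace

section General

variable {V : Type*} [AddCommGroup V] [Module ℝ V] [TopologicalSpace V]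

lemma isQuotientMap_mk' : IsQuotientMap (Projectivization.mk' ℝ : {v : V // v ≠ 0} → ℙ ℝ V) :=
  isQuotientMap_quotient_mk'

/-- The saturation of an open set is the union of its rescalings, each of which is open. -/
lemma isOpenQuotientMap_mk' [ContinuousConstSMul ℝ V] :
    IsOpenQuotientMap (Projectivization.mk' ℝ : {v : V // v ≠ 0} → ℙ ℝ V) := by
  refine IsOpenQuotientMap.of_isOpenMap_isQuotientMap (fun U hU => ?_) isQuotientMap_mk'
  rw [← isQuotientMap_mk'.isOpen_preimage]
  have h1 : Projectivization.mk' ℝ ⁻¹' (Projectivization.mk' ℝ '' U) =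
      ⋃ c : ℝˣ, (fun v : {v : V // v ≠ 0} => (⟨c • v.1, (smul_ne_zero_iff_ne c).2 v.2⟩ :
        {v : V // v ≠ 0})) ⁻¹' U := by
    ext v
    simp only [mem_preimage, mem_image, mem_iUnion]
    constructor
    · rintro ⟨w, hw, h⟩
      obtain ⟨c, hc⟩ := (Projectivization.mk_eq_mk_iff ℝ w.1 v.1 w.2 v.2).1 h
      refine ⟨c, ?_⟩
      convert hw
    · rintro ⟨c, hc⟩
      exact ⟨_, hc, (Projectivization.mk_eq_mk_iff ℝ _ _ _ _).2 ⟨c, rfl⟩⟩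
  rw [h1]
  refine isOpen_iUnion fun c => hU.preimage ?_
  exact Continuous.subtype_mk (continuous_subtype_val.const_smul (c : ℝ)) _

lemma continuous_projMk {T : Type*} [TopologicalSpace T] {f : T → V} (hf : Continuous f)
    (h : ∀ x, f x ≠ 0) : Continuous fun x => Projectivization.mk ℝ (f x) (h x) :=
  (isQuotientMap_mk' (V := V)).continuous.comp (hf.subtype_mk h)

lemma continuous_projMap [ContinuousConstSMul ℝ V] {W : Type*} [AddCommGroup W] [Module ℝ W]
    [TopologicalSpace W] (T : V →ₗ[ℝ] W) (hT : Continuous T) (hi : Function.Injective T) :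
    Continuous (Projectivization.map T hi) := by
  rw [← isOpenQuotientMap_mk'.continuous_comp_iff]
  exact continuous_projMk (f := fun v : {v : V // v ≠ 0} => T v)
    (hT.comp continuous_subtype_val) fun v h => v.2 (hi (h.trans (map_zero T).symm))

end General

variable {V : Type*} [NormedAddCommGroup V] [InnerProductSpace ℝ V]

instance : T2Space (ℙ ℝ V) := by
  -- A line is sent to the orthogonal projection onto it: a continuous injection into the Hausdorff
  -- space of maps from V to V.
  let F : ℙ ℝ V → V → V := Projectivization.lift
    (fun (v : {v : V // v ≠ 0}) w => ((⟪v.1, v.1⟫)⁻¹ * ⟪v.1, w⟫) • v.1) (by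
      rintro ⟨a, ha⟩ ⟨b, hb⟩ t (h : a = t • b)
      subst h
      have ht : t ≠ 0 := by rintro rfl; simp at ha
      have h1 := inner_self_ne_zero (𝕜 := ℝ).2 hb
      funext w
      simp only [inner_smul_left, inner_smul_right, smul_smul, RCLike.conj_to_real]
      congr 1
      field_simp)
  have hF : ∀ v hv w, F (Projectivization.mk ℝ v hv) w = ((⟪v, v⟫)⁻¹ * ⟪v, w⟫) • v :=
    fun v hv w => rfl
  have hc : Continuous F := by
    rw [← isOpenQuotientMap_mk'.continuous_comp_iff]
    refine continuous_pi fun w => ?_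
    change Continuous fun v : {v : V // v ≠ 0} => ((⟪v.1, v.1⟫)⁻¹ * ⟪v.1, w⟫) • v.1
    refine Continuous.smul (Continuous.mul (Continuous.inv₀ ?_ ?_) ?_) continuous_subtype_val
    · fun_prop
    · exact fun v => inner_self_ne_zero.2 v.2
    · fun_prop
  refine T2Space.of_injective_continuous (f := F) ?_ hc
  intro l l' h
  induction l with | h v hv =>
  induction l' with | h w hw =>
  have h1 := congrFun h v
  rw [hF, hF, inv_mul_cancel₀ (inner_self_ne_zero.2 hv), one_smul] at h1
  exact (Projectivization.mk_eq_mk_iff' ℝ _ _ _ _).2 ⟨_, h1.symm⟩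

instance [FiniteDimensional ℝ V] : SecondCountableTopology (ℙ ℝ V) := by
  have : ProperSpace V := FiniteDimensional.proper ℝ V
  exact isQuotientMap_mk'.secondCountableTopology isOpenQuotientMap_mk'.isOpenMap

instance [FiniteDimensional ℝ V] : CompactSpace (ℙ ℝ V) := by
  have : ProperSpace V := FiniteDimensional.proper ℝ V
  have h0 : ∀ x : Metric.sphere (0 : V) 1, x.1 ≠ 0 := fun x => ne_zero_of_mem_unit_sphere x
  refine ⟨?_⟩
  have h1 := isCompact_range (continuous_projMk (V := V) continuous_subtype_val h0)
  convert h1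
  symm
  rw [eq_univ_iff_forall]
  intro l
  induction l with | h v hv =>
  have hv' : ‖v‖ ≠ 0 := norm_ne_zero_iff.2 hv
  refine ⟨⟨‖v‖⁻¹ • v, by simp [norm_smul, hv']⟩, ?_⟩
  exact (Projectivization.mk_eq_mk_iff' ℝ _ _ _ _).2 ⟨‖v‖⁻¹, rfl⟩

lemma connectedSpace_proj (h : 1 < Module.rank ℝ V) : ConnectedSpace (ℙ ℝ V) := by
  have h1 : IsConnected ({0}ᶜ : Set V) := isConnected_compl_singleton_of_one_lt_rank h 0
  have h2 : ConnectedSpace {v : V // v ≠ 0} := isConnected_iff_connectedSpace.1 h1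
  exact isOpenQuotientMap_mk'.surjective.connectedSpace isOpenQuotientMap_mk'.continuous

/-- The point of the line `l` whose inner product with `v` is one. -/
def slope (v : V) : ℙ ℝ V → V := Projectivization.lift
  (fun m : {m : V // m ≠ 0} => (⟪m.1, v⟫)⁻¹ • m.1) (by
    rintro ⟨a, ha⟩ ⟨b, hb⟩ t (h : a = t • b)
    subst h
    have ht : t ≠ 0 := by rintro rfl; simp at ha
    simp only [inner_smul_left, smul_smul, RCLike.conj_to_real]
    congr 1
    field_simp)

lemma slope_mk (v m : V) (hm : m ≠ 0) :
    slope v (Projectivization.mk ℝ m hm) = (⟪m, v⟫)⁻¹ • m := rfl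

/-- As the inverse of 0 is 0, the slope vanishes exactly on lines orthogonal to `v`, so its
nonvanishing delimits an affine chart. -/
lemma slope_ne_zero_iff (v m : V) (hm : m ≠ 0) :
    slope v (Projectivization.mk ℝ m hm) ≠ 0 ↔ ⟪m, v⟫ ≠ 0 := by
  simp [slope_mk, hm]

lemma inner_slope {v : V} {l : ℙ ℝ V} (h : slope v l ≠ 0) : ⟪slope v l, v⟫ = 1 := by
  induction l with | h m hm =>
  rw [slope_ne_zero_iff] at h
  rw [slope_mk, inner_smul_left]
  simp [h]

lemma mk_slope {v : V} {l : ℙ ℝ V} (h : slope v l ≠ 0) : Projectivization.mk ℝ (slope v l) h = l := by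
  induction l with | h m hm =>
  exact (Projectivization.mk_eq_mk_iff' ℝ _ _ _ _).2 ⟨_, rfl⟩

lemma slope_mk_of_inner_eq_one {v m : V} (hm : m ≠ 0) (h : ⟪m, v⟫ = 1) :
    slope v (Projectivization.mk ℝ m hm) = m := by
  rw [slope_mk, h, inv_one, one_smul]

lemma isOpen_slope_ne_zero (v : V) : IsOpen {l : ℙ ℝ V | slope v l ≠ 0} := by
  rw [← isQuotientMap_mk'.isOpen_preimage]
  have : Projectivization.mk' ℝ ⁻¹' {l : ℙ ℝ V | slope v l ≠ 0} =
      {m : {m : V // m ≠ 0} | ⟪m.1, v⟫ ≠ 0} := by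
    ext m
    exact slope_ne_zero_iff v m.1 m.2
  rw [this]
  exact isOpen_ne_fun (by fun_prop) continuous_const

lemma continuousAt_slope {v : V} {l : ℙ ℝ V} (h : slope v l ≠ 0) : ContinuousAt (slope v) l := by
  induction l with | h m hm =>
  rw [slope_ne_zero_iff] at h
  have h1 : ContinuousAt (slope v ∘ Projectivization.mk' ℝ) (⟨m, hm⟩ : {m : V // m ≠ 0}) := by
    change ContinuousAt (fun m : {m : V // m ≠ 0} => (⟪m.1, v⟫)⁻¹ • m.1) ⟨m, hm⟩
    refine ContinuousAt.smul (ContinuousAt.inv₀ ?_ h) continuousAt_subtype_val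
    fun_prop
  exact isOpenQuotientMap_mk'.continuousAt_comp_iff.1 h1

lemma exists_slope_ne_zero (l : ℙ ℝ V) : ∃ v : V, ‖v‖ = 1 ∧ slope v l ≠ 0 := by
  induction l with | h m hm =>
  have hm' : ‖m‖ ≠ 0 := norm_ne_zero_iff.2 hm
  refine ⟨‖m‖⁻¹ • m, by simp [norm_smul, hm'], ?_⟩
  rw [slope_ne_zero_iff, inner_smul_right]
  simp [hm]

end Proj

/-! ### The model blowup is a manifold -/

section Model

open scoped RealInnerProductSpace

variable {n : ℕ}

instance : T2Space (Model n) :=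
  inferInstanceAs (T2Space {z : Eu n × ℙ ℝ (Eu n) // z.1 ∈ z.2.submodule})

instance : SecondCountableTopology (Model n) :=
  TopologicalSpace.Subtype.secondCountableTopology
    {z : Eu n × ℙ ℝ (Eu n) | z.1 ∈ z.2.submodule}

lemma inner_add_sub_smul {v : Eu n} (hv : ‖v‖ = 1) (x : Eu n) : ⟪v + x - ⟪x, v⟫ • v, v⟫ = 1 := by
  rw [inner_sub_left, inner_add_left, inner_smul_left, real_inner_self_eq_norm_sq, hv]
  simp

lemma add_sub_smul_ne_zero {v : Eu n} (hv : ‖v‖ = 1) (x : Eu n) : v + x - ⟪x, v⟫ • v ≠ 0 := by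
  intro h
  have := inner_add_sub_smul hv x
  rw [h, inner_zero_left] at this
  exact zero_ne_one this

/-- The standard charts of the model blowup. -/
def modelChart (v : Eu n) (hv : ‖v‖ = 1) : OpenPartialHomeomorph (Eu n) (Model n) where
  -- Writing x = tv + w with w orthogonal to v, the chart sends x to the vector t(v + w) on the line
  -- spanned by v + w.
  toFun x := ⟨(⟪x, v⟫ • (v + x - ⟪x, v⟫ • v),
    Projectivization.mk ℝ (v + x - ⟪x, v⟫ • v) (add_sub_smul_ne_zero hv x)), by
      rw [Projectivization.submodule_mk]
      exact Submodule.smul_mem _ _ (Submodule.mem_span_singleton_self _)⟩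
  invFun z := ⟪z.1.1, v⟫ • v + slope v z.1.2 - v
  source := univ
  target := {z | slope v z.1.2 ≠ 0}
  map_source' x _ := by
    change slope v (Projectivization.mk ℝ _ (add_sub_smul_ne_zero hv x)) ≠ 0
    rw [slope_ne_zero_iff, inner_add_sub_smul hv]
    exact one_ne_zero
  map_target' _ _ := mem_univ _
  left_inv' x _ := by
    change ⟪⟪x, v⟫ • (v + x - ⟪x, v⟫ • v), v⟫ • v + slope v (Projectivization.mk ℝ _ _) - v = x
    rw [slope_mk_of_inner_eq_one _ (inner_add_sub_smul hv x), inner_smul_left,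
      inner_add_sub_smul hv]
    simp
  right_inv' z hz := by
    obtain ⟨⟨y, l⟩, hy⟩ := z
    replace hz : slope v l ≠ 0 := hz
    have h1 := inner_slope hz
    have h2 : ⟪⟪y, v⟫ • v + slope v l - v, v⟫ = ⟪y, v⟫ := by
      rw [inner_sub_left, inner_add_left, inner_smul_left, real_inner_self_eq_norm_sq, hv, h1]
      simp
    have h3 : v + (⟪y, v⟫ • v + slope v l - v) - ⟪y, v⟫ • v = slope v l := by abel
    have hy' : y = ⟪y, v⟫ • slope v l := by
      have h4 := hy
      rw [← mk_slope hz, Projectivization.submodule_mk, Submodule.mem_span_singleton] at h4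
      obtain ⟨c, hc⟩ := h4
      change c • slope v l = y at hc
      rw [← hc, inner_smul_left, h1]
      simp
    refine Subtype.ext (Prod.ext ?_ ?_)
    · change ⟪⟪y, v⟫ • v + slope v l - v, v⟫ • (v + (⟪y, v⟫ • v + slope v l - v) -
        ⟪⟪y, v⟫ • v + slope v l - v, v⟫ • v) = y
      rw [h2, h3, ← hy']
    · change Projectivization.mk ℝ (v + (⟪y, v⟫ • v + slope v l - v) -
        ⟪⟪y, v⟫ • v + slope v l - v, v⟫ • v) _ = l
      conv_rhs => rw [← mk_slope hz]
      congr 1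
      rw [h2, h3]
  open_source := isOpen_univ
  open_target := (isOpen_slope_ne_zero v).preimage (continuous_snd.comp continuous_subtype_val)
  continuousOn_toFun := by
    refine Continuous.continuousOn (Continuous.subtype_mk (Continuous.prodMk (by fun_prop) ?_) _)
    exact continuous_projMk (by fun_prop) _
  continuousOn_invFun := by
    intro z hz
    refine ContinuousAt.continuousWithinAt (ContinuousAt.sub (ContinuousAt.add ?_ ?_)
      continuousAt_const)
    · have : Continuous fun z : Model n => ⟪z.1.1, v⟫ • v := by
        have h1 : Continuous fun z : Model n => z.1.1 := continuous_fst.comp continuous_subtype_val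
        fun_prop
      exact this.continuousAt
    · exact ContinuousAt.comp (g := slope v) (f := fun z : Model n => z.1.2)
        (continuousAt_slope hz) (continuous_snd.comp continuous_subtype_val).continuousAt

end Model

/-! ### Small Euclidean neighbourhoods. -/

section LocallyEuclidean

variable {m : ℕ} {V : Type*} [TopologicalSpace V]

/-- A point in the domain of a chart has arbitrarily small neighbourhoods homeomorphic to `ℝᵐ`. -/
lemma exists_isOpenEmbedding_of_chart (e : OpenPartialHomeomorph V (Eu m)) {v : V}
    (hv : v ∈ e.source) {O : Set V} (hO : IsOpen O) (hvO : v ∈ O) :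
    ∃ f : Eu m → V, IsOpenEmbedding f ∧ v ∈ range f ∧ range f ⊆ O := by
  have h1 : e.target ∩ e.symm ⁻¹' O ∈ 𝓝 (e v) :=
    (e.isOpen_inter_preimage_symm hO).mem_nhds ⟨e.map_source hv, by simpa [e.left_inv hv]⟩
  obtain ⟨r, hr, hball⟩ := Metric.nhds_basis_ball.mem_iff.1 h1
  let b : OpenPartialHomeomorph (Eu m) (Eu m) := OpenPartialHomeomorph.univBall (e v) r
  have hb : ∀ x, b x ∈ Metric.ball (e v) r := fun x => by
    rw [← OpenPartialHomeomorph.univBall_target (e v) hr]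
    exact b.map_source (by simp [b])
  have hs : (b.trans e.symm).source = univ := by
    rw [eq_univ_iff_forall]
    intro x
    rw [OpenPartialHomeomorph.trans_source]
    exact ⟨by simp [b], (hball (hb x)).1⟩
  refine ⟨b.trans e.symm, (b.trans e.symm).isOpenEmbedding hs, ⟨0, ?_⟩, ?_⟩
  · change e.symm (b 0) = v
    rw [OpenPartialHomeomorph.univBall_apply_zero, e.left_inv hv]
  · rintro _ ⟨x, rfl⟩
    exact (hball (hb x)).2

lemma exists_nhds_homeo_of_isOpenEmbedding {f : Eu m → V} (hf : IsOpenEmbedding f) {v : V}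
    (hv : v ∈ range f) : ∃ U : Set V, IsOpen U ∧ v ∈ U ∧ Nonempty (U ≃ₜ Eu m) :=
  ⟨range f, hf.isOpen_range, hv, ⟨hf.isEmbedding.toHomeomorph.symm⟩⟩

end LocallyEuclidean

/-! ### The topology of the blowup -/

section BlowupTopology

variable {n : ℕ} {M : Type*} [TopologicalSpace M] [ChartedSpace (Eu n) M] {p : M}

lemma isOpen_blowup_iff {U : Set (Blowup n p)} : IsOpen U ↔
    IsOpen ((Blowup.off : {x : M // x ≠ p} → Blowup n p) ⁻¹' U) ∧ IsOpen (modelMap p ⁻¹' U) :=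
  Iff.rfl

lemma continuous_off : Continuous (Blowup.off : {x : M // x ≠ p} → Blowup n p) :=
  ⟨fun _ hU => (isOpen_blowup_iff.1 hU).1⟩

lemma continuous_modelMap : Continuous (modelMap p : ModelPart n p → Blowup n p) :=
  ⟨fun _ hU => (isOpen_blowup_iff.1 hU).2⟩

lemma modelMap_of_eq_zero {z : ModelPart n p} (h : z.1.1.1 = 0) :
    modelMap p z = Blowup.exc (show ℙ ℝ (TangentSpace (𝓡 n) p) from z.1.1.2) := dif_pos h

lemma modelMap_of_ne_zero {z : ModelPart n p} (h : z.1.1.1 ≠ 0) :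
    modelMap p z = Blowup.off ⟨(centeredChart n p).symm z.1.1.1, chart_symm_ne z.2 h⟩ := dif_neg h

lemma continuous_modelPart_fst : Continuous fun z : ModelPart n p => z.1.1.1 :=
  continuous_fst.comp (continuous_subtype_val.comp continuous_subtype_val)

lemma continuous_modelPart_snd : Continuous fun z : ModelPart n p => z.1.1.2 :=
  continuous_snd.comp (continuous_subtype_val.comp continuous_subtype_val)

lemma modelPart_mem_target (z : ModelPart n p) : z.1.1.1 ∈ (centeredChart n p).target := z.2

lemma blowdown_modelMap (z : ModelPart n p) :
    blowdown p (modelMap p z) = (centeredChart n p).symm z.1.1.1 := by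
  by_cases h : z.1.1.1 = 0
  · rw [modelMap_of_eq_zero h, h, centeredChart_symm_zero]; rfl
  · rw [modelMap_of_ne_zero h]; rfl

lemma continuous_blowup_iff {T : Type*} [TopologicalSpace T] {f : Blowup n p → T} :
    Continuous f ↔ Continuous (fun x => f (Blowup.off x)) ∧
      Continuous (fun z => f (modelMap p z)) := by
  refine ⟨fun h => ⟨h.comp continuous_off, h.comp continuous_modelMap⟩, fun h => ⟨fun U hU => ?_⟩⟩
  exact isOpen_blowup_iff.2 ⟨hU.preimage h.1, hU.preimage h.2⟩

lemma continuous_blowdown : Continuous (blowdown p : Blowup n p → M) := by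
  rw [continuous_blowup_iff]
  refine ⟨continuous_subtype_val, ?_⟩
  simp only [blowdown_modelMap]
  exact (centeredChart n p).continuousOn_symm.comp_continuous continuous_modelPart_fst
    modelPart_mem_target

lemma off_injective : Function.Injective (Blowup.off : {x : M // x ≠ p} → Blowup n p) :=
  fun _ _ h => Blowup.off.inj h

lemma isOpenEmbedding_off [T1Space M] :
    IsOpenEmbedding (Blowup.off : {x : M // x ≠ p} → Blowup n p) := by
  refine IsOpenEmbedding.of_continuous_injective_isOpenMap continuous_off off_injective
    fun U hU => isOpen_blowup_iff.2 ⟨?_, ?_⟩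
  · rwa [preimage_image_eq _ off_injective]
  · obtain ⟨W, hW, rfl⟩ := isOpen_induced_iff.1 hU
    -- The trace on the model is the preimage of this open set under the blowdown map.
    have hW' : IsOpen (W ∩ {p}ᶜ) := hW.inter isOpen_compl_singleton
    have h1 : Continuous fun z : ModelPart n p => blowdown p (modelMap p z) :=
      continuous_blowdown.comp continuous_modelMap
    convert hW'.preimage h1 using 1
    ext z
    by_cases h : z.1.1.1 = 0
    · simp [modelMap_of_eq_zero h, blowdown]
    · rw [mem_preimage, modelMap_of_ne_zero h]
      have := chart_symm_ne z.2 h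
      constructor
      · rintro ⟨x, hx, hx'⟩
        cases hx'
        simp only [mem_preimage, blowdown_modelMap]
        exact ⟨hx, this⟩
      · rintro ⟨hx, -⟩
        have hx' : blowdown p (modelMap p z) ∈ W := hx
        rw [blowdown_modelMap] at hx'
        exact ⟨_, hx', rfl⟩

lemma modelMap_injective : Function.Injective (modelMap p : ModelPart n p → Blowup n p) := by
  intro z w h
  have h0 : z.1.1.1 = w.1.1.1 := by
    have h1 := congrArg (blowdown p) h
    rw [blowdown_modelMap, blowdown_modelMap] at h1
    exact (centeredChart n p).symm.injOn (modelPart_mem_target z) (modelPart_mem_target w) h1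
  refine Subtype.ext (Subtype.ext (Prod.ext h0 ?_))
  by_cases hz : z.1.1.1 = 0
  · rw [modelMap_of_eq_zero hz, modelMap_of_eq_zero (h0 ▸ hz)] at h
    exact Blowup.exc.inj h
  -- Away from the origin the line is determined by the vector it contains.
  · have hl : ∀ y : ModelPart n p, ∀ hy : y.1.1.1 ≠ 0,
        y.1.1.2 = Projectivization.mk ℝ y.1.1.1 hy := by
      rintro ⟨⟨⟨y, l⟩, hyl⟩, -⟩ hy
      dsimp only at hyl hy ⊢
      induction l with | h v hv =>
      rw [Projectivization.submodule_mk, Submodule.mem_span_singleton] at hyl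
      obtain ⟨c, rfl⟩ := hyl
      have hc : c ≠ 0 := by rintro rfl; simp at hy
      exact ((Projectivization.mk_eq_mk_iff' ℝ _ _ _ _).2 ⟨c, rfl⟩).symm
    rw [hl z hz, hl w (h0 ▸ hz)]
    congr 1

/-- The point of the model blowup over a point near `p`. -/
def modelPoint (p : M) (x : {x : M // x ≠ p}) (hx : x.1 ∈ (centeredChart n p).source) :
    ModelPart n p :=
  ⟨⟨(centeredChart n p x, Projectivization.mk ℝ (centeredChart n p x) (fun h => x.2 <|
      (centeredChart n p).injOn hx (mem_centeredChart_source p)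
        (h.trans (centeredChart_self p).symm))), by
      rw [Projectivization.submodule_mk]; exact Submodule.mem_span_singleton_self _⟩,
    (centeredChart n p).map_source hx⟩

lemma modelMap_modelPoint (x : {x : M // x ≠ p}) (hx : x.1 ∈ (centeredChart n p).source) :
    modelMap p (modelPoint p x hx) = Blowup.off x := by
  have h0 : (modelPoint p x hx).1.1.1 ≠ 0 := fun h => x.2 <|
      (centeredChart n p).injOn hx (mem_centeredChart_source p)
        (h.trans (centeredChart_self p).symm)
  rw [modelMap_of_ne_zero h0]
  congr 1
  exact Subtype.ext ((centeredChart n p).left_inv hx)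

/-- Off `p` the parametrization has the continuous inverse `modelPoint` on the chart domain, so
images of open sets are open in both pieces of the gluing. -/
lemma isOpenEmbedding_modelMap : IsOpenEmbedding (modelMap p : ModelPart n p → Blowup n p) := by
  refine IsOpenEmbedding.of_continuous_injective_isOpenMap continuous_modelMap modelMap_injective
    fun W hW => isOpen_blowup_iff.2 ⟨?_, ?_⟩
  · let O : Set {x : M // x ≠ p} := {x | x.1 ∈ (centeredChart n p).source}
    have hO : IsOpen O := (centeredChart n p).open_source.preimage continuous_subtype_val
    let f : O → ModelPart n p := fun x => modelPoint p x.1 x.2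
    have hf : Continuous f := by
      have h1 : Continuous fun x : O => centeredChart n p x.1.1 :=
        (centeredChart n p).continuousOn.comp_continuous
          (continuous_subtype_val.comp continuous_subtype_val) fun x => x.2
      refine Continuous.subtype_mk (Continuous.subtype_mk (h1.prodMk ?_) _) _
      exact continuous_projMk h1 _
    have h2 : Blowup.off ⁻¹' (modelMap p '' W) = Subtype.val '' (f ⁻¹' W) := by
      ext x
      constructor
      · rintro ⟨z, hz, hzx⟩
        have hx : x.1 ∈ (centeredChart n p).source := by
          have := congrArg (blowdown p) hzx
          rw [blowdown_modelMap] at this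
          rw [show x.1 = _ from this.symm]
          exact (centeredChart n p).map_target (modelPart_mem_target z)
        refine ⟨⟨x, hx⟩, ?_, rfl⟩
        have : f ⟨x, hx⟩ = z := modelMap_injective ((modelMap_modelPoint x hx).trans hzx.symm)
        rwa [mem_preimage, this]
      · rintro ⟨x, hx, rfl⟩
        exact ⟨_, hx, modelMap_modelPoint x.1 x.2⟩
    rw [h2]
    exact hO.isOpenMap_subtype_val _ (hW.preimage hf)
  · rwa [preimage_image_eq _ modelMap_injective]

/-- The point of the model blowup on the exceptional locus given by a line. -/
def modelExc (p : M) (l : ℙ ℝ (Eu n)) : ModelPart n p :=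
  ⟨⟨(0, l), Submodule.zero_mem _⟩, zero_mem_centeredChart_target p⟩

lemma modelMap_modelExc (l : ℙ ℝ (Eu n)) :
    modelMap p (modelExc p l) = Blowup.exc (show ℙ ℝ (TangentSpace (𝓡 n) p) from l) :=
  modelMap_of_eq_zero rfl

/-- The inclusion of the exceptional locus. -/
def excMap (p : M) (l : ℙ ℝ (Eu n)) : Blowup n p :=
  Blowup.exc (show ℙ ℝ (TangentSpace (𝓡 n) p) from l)

lemma isEmbedding_modelExc : IsEmbedding (modelExc p : ℙ ℝ (Eu n) → ModelPart n p) := by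
  refine IsEmbedding.of_comp (g := fun z : ModelPart n p => z.1.1.2) ?_ continuous_modelPart_snd
    IsEmbedding.id
  exact Continuous.subtype_mk (Continuous.subtype_mk (continuous_const.prodMk continuous_id) _) _

lemma isEmbedding_excMap : IsEmbedding (excMap p : ℙ ℝ (Eu n) → Blowup n p) := by
  have : excMap p = modelMap p ∘ (modelExc p : ℙ ℝ (Eu n) → ModelPart n p) := by
    funext l
    exact (modelMap_modelExc l).symm
  rw [this]
  exact isOpenEmbedding_modelMap.isEmbedding.comp isEmbedding_modelExc

lemma preimage_blowdown_singleton : blowdown p ⁻¹' {p} = range (excMap p : ℙ ℝ (Eu n) → _) := by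
  ext v
  cases v with
  | off x => simpa [blowdown, excMap] using x.2
  | exc l => simpa [blowdown, excMap] using ⟨l, rfl⟩

instance : T2Space (ModelPart n p) :=
  inferInstanceAs (T2Space
    {z : Model n // chartAt (Eu n) p p + z.1.1 ∈ (chartAt (Eu n) p).target})

instance : SecondCountableTopology (ModelPart n p) :=
  TopologicalSpace.Subtype.secondCountableTopology
    {z : Model n | chartAt (Eu n) p p + z.1.1 ∈ (chartAt (Eu n) p).target}

lemma off_or_modelMap (v : Blowup n p) : (∃ x, v = Blowup.off x) ∨ ∃ z, v = modelMap p z := by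
  cases v with
  | off x => exact .inl ⟨x, rfl⟩
  | exc l => exact .inr ⟨modelExc p l, (modelMap_modelExc l).symm⟩

instance [T2Space M] : T2Space (Blowup n p) := by
  refine ⟨fun v w hvw => ?_⟩
  by_cases h : blowdown p v = blowdown p w
  -- Distinct points with the same image downstairs both lie on the exceptional locus, hence in the
  -- Hausdorff model.
  · have key : ∃ z z' : ModelPart n p, v = modelMap p z ∧ w = modelMap p z' := by
      cases v with
      | off x =>
        cases w with
        | off y => exact absurd (congrArg Blowup.off (Subtype.ext h)) hvw
        | exc l => exact absurd h x.2
      | exc l =>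
        cases w with
        | off y => exact absurd h.symm y.2
        | exc l' => exact ⟨modelExc p l, modelExc p l', (modelMap_modelExc l).symm,
            (modelMap_modelExc l').symm⟩
    obtain ⟨z, z', rfl, rfl⟩ := key
    obtain ⟨U, U', hU, hU', hz, hz', hd⟩ := t2_separation (ne_of_apply_ne _ hvw)
    exact ⟨_, _, isOpenEmbedding_modelMap.isOpenMap U hU, isOpenEmbedding_modelMap.isOpenMap U' hU',
      mem_image_of_mem _ hz, mem_image_of_mem _ hz',
      (disjoint_image_iff modelMap_injective).2 hd⟩
  · obtain ⟨U, U', hU, hU', hz, hz', hd⟩ := t2_separation h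
    exact ⟨_, _, hU.preimage continuous_blowdown, hU'.preimage continuous_blowdown, hz, hz',
      hd.preimage _⟩

instance [T1Space M] [SecondCountableTopology M] : SecondCountableTopology (Blowup n p) := by
  let U : Bool → Set (Blowup n p) := fun b =>
    if b then range (Blowup.off : {x : M // x ≠ p} → Blowup n p) else range (modelMap p)
  have h1 : SecondCountableTopology (range (Blowup.off : {x : M // x ≠ p} → Blowup n p)) := by
    have : SecondCountableTopology {x : M // x ≠ p} :=
      TopologicalSpace.Subtype.secondCountableTopology {x : M | x ≠ p}
    exact (isOpenEmbedding_off (p := p)).isEmbedding.toHomeomorph.symm.secondCountableTopology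
  have h2 : SecondCountableTopology (range (modelMap p : ModelPart n p → _)) :=
    isOpenEmbedding_modelMap.isEmbedding.toHomeomorph.symm.secondCountableTopology
  have : ∀ b, SecondCountableTopology (U b) := by
    rintro (_ | _)
    · exact h2
    · exact h1
  refine TopologicalSpace.secondCountableTopology_of_countable_cover (U := U) ?_ ?_
  · rintro (_ | _)
    · exact isOpenEmbedding_modelMap.isOpen_range
    · exact isOpenEmbedding_off.isOpen_range
  · rw [eq_univ_iff_forall]
    intro v
    rw [mem_iUnion]
    rcases off_or_modelMap v with ⟨x, rfl⟩ | ⟨z, rfl⟩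
    · exact ⟨true, mem_range_self x⟩
    · exact ⟨false, mem_range_self z⟩

lemma isTopManifold_blowup [T2Space M] [SecondCountableTopology M] (p : M) :
    IsTopManifold n (Blowup n p) := by
  refine ⟨inferInstance, inferInstance, fun v => ?_⟩
  rcases off_or_modelMap v with ⟨x, rfl⟩ | ⟨z, rfl⟩
  · obtain ⟨f, hf, ⟨y, hy⟩, hfp⟩ := exists_isOpenEmbedding_of_chart (chartAt (Eu n) x.1)
      (mem_chart_source _ x.1) (isOpen_compl_singleton (x := p)) x.2
    let f' : Eu n → {x : M // x ≠ p} := fun y => ⟨f y, hfp (mem_range_self y)⟩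
    have hf' : IsOpenEmbedding f' :=
      IsOpenEmbedding.of_comp f' (isOpen_compl_singleton (x := p)).isOpenEmbedding_subtypeVal hf
    exact exists_nhds_homeo_of_isOpenEmbedding (isOpenEmbedding_off.comp hf')
      ⟨y, congrArg Blowup.off (Subtype.ext hy)⟩
  · obtain ⟨v, hv, hz⟩ := exists_slope_ne_zero z.1.1.2
    have hO : IsOpen {z : Model n | chartAt (Eu n) p p + z.1.1 ∈ (chartAt (Eu n) p).target} :=
      (centeredChart n p).open_target.preimage (continuous_fst.comp continuous_subtype_val)
    obtain ⟨f, hf, ⟨y, hy⟩, hfp⟩ := exists_isOpenEmbedding_of_chart (modelChart v hv).symm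
      (v := z.1) hz hO z.2
    let f' : Eu n → ModelPart n p := fun y => ⟨f y, hfp (mem_range_self y)⟩
    have hf' : IsOpenEmbedding f' :=
      IsOpenEmbedding.of_comp f' hO.isOpenEmbedding_subtypeVal hf
    exact exists_nhds_homeo_of_isOpenEmbedding (isOpenEmbedding_modelMap.comp hf')
      ⟨y, congrArg (modelMap p) (Subtype.ext hy)⟩

/-- Only neighbourhoods of `p` need care: an open set upstairs containing the whole exceptional
locus must contain a full tube around it, by compactness of the sphere. -/
lemma isQuotientMap_blowdown [T1Space M] (hn : 0 < n) (p : M) : IsQuotientMap (blowdown p : Blowup n p → M) := by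
  have : Nontrivial (Eu n) := by
    have : Nonempty (Fin n) := ⟨⟨0, hn⟩⟩
    infer_instance
  obtain ⟨v₀, hv₀⟩ := exists_ne (0 : Eu n)
  refine (isQuotientMap_iff _).2 ⟨.of_isOpen_preimage_iff_isOpen fun U =>
    ⟨fun h => ?_, fun h => h.preimage continuous_blowdown⟩, fun x => ?_⟩
  swap
  · by_cases hx : x = p
    · exact ⟨excMap p (Projectivization.mk ℝ v₀ hv₀), hx.symm⟩
    · exact ⟨.off ⟨x, hx⟩, rfl⟩
  replace h : IsOpen (blowdown p ⁻¹' U) := h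
  rw [isOpen_iff_mem_nhds]
  intro x hx
  have hoff := (isOpen_blowup_iff.1 h).1
  by_cases hxp : x = p
  · subst hxp
    obtain ⟨r, hr, hball⟩ := Metric.nhds_basis_ball.mem_iff.1
      ((centeredChart n x).open_target.mem_nhds (zero_mem_centeredChart_target x))
    let S := Metric.sphere (0 : Eu n) 1
    let T := {t : ℝ // |t| < r}
    have hnorm : ∀ (t : T) (v : S), ‖t.1 • v.1‖ < r := fun t v => by
      rw [norm_smul, mem_sphere_zero_iff_norm.1 v.2, mul_one]; exact t.2
    -- Polar coordinates: radius t and direction v go to the vector tv on the line of v, with t = 0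
    -- giving the exceptional locus.
    let F : T × S → ModelPart n x := fun z =>
      ⟨⟨(z.1.1 • z.2.1, Projectivization.mk ℝ z.2.1 (ne_zero_of_mem_unit_sphere z.2)), by
        rw [Projectivization.submodule_mk]
        exact Submodule.smul_mem _ _ (Submodule.mem_span_singleton_self _)⟩,
        hball (by simpa using hnorm z.1 z.2)⟩
    have hF : Continuous F := by
      refine Continuous.subtype_mk (Continuous.subtype_mk (Continuous.prodMk ?_ ?_) _) _
      · exact (continuous_subtype_val.comp continuous_fst).smul
          (continuous_subtype_val.comp continuous_snd)
      · exact continuous_projMk (continuous_subtype_val.comp continuous_snd) _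
    have hW : IsOpen (F ⁻¹' (modelMap x ⁻¹' (blowdown x ⁻¹' U))) :=
      (h.preimage continuous_modelMap).preimage hF
    have hsub : ({⟨0, by simpa using hr⟩} : Set T) ×ˢ (univ : Set S) ⊆
        F ⁻¹' (modelMap x ⁻¹' (blowdown x ⁻¹' U)) := by
      rintro ⟨t, v⟩ ⟨ht, -⟩
      rw [mem_singleton_iff] at ht
      subst ht
      rw [mem_preimage, mem_preimage, mem_preimage, blowdown_modelMap]
      have : (F (⟨0, by simpa using hr⟩, v)).1.1.1 = 0 := zero_smul ℝ v.1
      rw [this, centeredChart_symm_zero]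
      exact hx
    obtain ⟨u, u', hu, -, hu0, hu', huv⟩ := generalized_tube_lemma isCompact_singleton
      (isCompact_univ (X := S)) hW hsub
    obtain ⟨δ, hδ, hδu⟩ := Metric.isOpen_iff.1 hu _ (hu0 rfl)
    have key : ∀ y : Eu n, ‖y‖ < min δ r → (centeredChart n x).symm y ∈ U := by
      intro y hy
      by_cases hy0 : y = 0
      · rwa [hy0, centeredChart_symm_zero]
      have hy1 : ‖y‖ ≠ 0 := norm_ne_zero_iff.2 hy0
      let t : T := ⟨‖y‖, by rw [abs_norm]; exact hy.trans_le (min_le_right _ _)⟩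
      let v : S := ⟨‖y‖⁻¹ • y, mem_sphere_zero_iff_norm.2 (by
        rw [norm_smul, norm_inv, norm_norm, inv_mul_cancel₀ hy1])⟩
      have ht : t ∈ u := hδu (by
        rw [Metric.mem_ball, Subtype.dist_eq, Real.dist_eq, sub_zero, abs_norm]
        exact hy.trans_le (min_le_left _ _))
      have h1 : blowdown x (modelMap x (F (t, v))) ∈ U := huv ⟨ht, hu' (mem_univ v)⟩
      rw [blowdown_modelMap] at h1
      have h2 : (F (t, v)).1.1.1 = y := by
        change ‖y‖ • (‖y‖⁻¹ • y) = y
        rw [smul_smul, mul_inv_cancel₀ hy1, one_smul]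
      rwa [h2] at h1
    have hb : ∀ᶠ y : Eu n in 𝓝 0, ‖y‖ < min δ r := by
      filter_upwards [Metric.ball_mem_nhds (0 : Eu n) (lt_min hδ hr)] with y hy
      simpa using hy
    filter_upwards [(tendsto_centeredChart x).eventually hb,
      (centeredChart n x).open_source.mem_nhds (mem_centeredChart_source x)] with z hz hzs
    have := key _ hz
    rwa [(centeredChart n x).left_inv hzs] at this
  · have h1 : Subtype.val '' ((Blowup.off : {x : M // x ≠ p} → Blowup n p) ⁻¹'
        (blowdown p ⁻¹' U)) ∈ 𝓝 x :=
      ((isOpen_compl_singleton (x := p)).isOpenMap_subtype_val _ hoff).mem_nhds ⟨⟨x, hxp⟩, hx, rfl⟩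
    filter_upwards [h1] with z hz
    obtain ⟨w, hw, rfl⟩ := hz
    exact hw

end BlowupTopology

/-! ### Lifting homeomorphisms to the blowup -/

section Lift

variable {n : ℕ} {M : Type*} [TopologicalSpace M] [ChartedSpace (Eu n) M] {p : M}

/-- The action of a linear automorphism on projective space. -/
def projMap (B : Eu n ≃L[ℝ] Eu n) : ℙ ℝ (Eu n) → ℙ ℝ (Eu n) :=
  Projectivization.map B.toLinearEquiv.toLinearMap B.injective

lemma continuous_projMap' (B : Eu n ≃L[ℝ] Eu n) : Continuous (projMap B) :=
  continuous_projMap _ B.continuous _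

lemma projMap_mk (B : Eu n ≃L[ℝ] Eu n) (v : Eu n) (hv : v ≠ 0) :
    projMap B (Projectivization.mk ℝ v hv) =
      Projectivization.mk ℝ (B v) ((map_ne_zero_iff B B.injective).2 hv) := rfl

lemma projMap_leftInverse {B C : Eu n ≃L[ℝ] Eu n} (h : ∀ v, B (C v) = v) (l : ℙ ℝ (Eu n)) :
    projMap B (projMap C l) = l := by
  induction l with | h v hv =>
  rw [projMap_mk, projMap_mk]
  congr 1
  exact h v

/-- The lift to the blowup of a homeomorphism fixing `p`, acting on the exceptional locus by a given
linear automorphism. -/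
def liftMap (k : M ≃ₜ M) (hk : k p = p) (B : Eu n ≃L[ℝ] Eu n) : Blowup n p → Blowup n p
  | .off x => .off ⟨k x.1, fun h => x.2 (k.injective (h.trans hk.symm))⟩
  | .exc l => excMap p (projMap B l)

lemma blowdown_liftMap (k : M ≃ₜ M) (hk : k p = p) (B : Eu n ≃L[ℝ] Eu n) (v : Blowup n p) :
    blowdown p (liftMap k hk B v) = k (blowdown p v) := by
  cases v with
  | off x => rfl
  | exc l => exact hk.symm

open Classical in
/-- The parametrization of the blowup by the model, extended by junk values. -/
def modelMapTotal (p : M) (z : Model n) : Blowup n p :=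
  if h : z.1.1 ∈ (centeredChart n p).target then modelMap p ⟨z, h⟩ else excMap p z.1.2

lemma modelMapTotal_of_mem {z : Model n} (h : z.1.1 ∈ (centeredChart n p).target) :
    modelMapTotal p z = modelMap p ⟨z, h⟩ := dif_pos h

lemma continuousAt_modelMapTotal {z : Model n} (h : z.1.1 ∈ (centeredChart n p).target) :
    ContinuousAt (modelMapTotal p) z := by
  have hO : IsOpen {z : Model n | z.1.1 ∈ (centeredChart n p).target} :=
    (centeredChart n p).open_target.preimage (continuous_fst.comp continuous_subtype_val)
  have h1 : (modelMapTotal p) ∘ (Subtype.val :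
      {z : Model n | z.1.1 ∈ (centeredChart n p).target} → Model n) = modelMap p := by
    funext w
    exact modelMapTotal_of_mem w.2
  have h2 := (hO.isOpenEmbedding_subtypeVal.continuousAt_iff (g := modelMapTotal p)
    (x := ⟨z, h⟩)).1
  rw [h1] at h2
  exact h2 continuous_modelMap.continuousAt

/-- The lift of a linear automorphism to the model blowup. -/
def modelLift (B : Eu n ≃L[ℝ] Eu n) (z : Model n) : Model n :=
  ⟨(B z.1.1, projMap B z.1.2), by
    obtain ⟨⟨y, l⟩, hy⟩ := z
    induction l with | h v hv =>
    rw [Projectivization.submodule_mk, Submodule.mem_span_singleton] at hy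
    obtain ⟨c, hc⟩ := hy
    change B y ∈ (projMap B (Projectivization.mk ℝ v hv)).submodule
    rw [projMap_mk, Projectivization.submodule_mk, Submodule.mem_span_singleton]
    exact ⟨c, by rw [← map_smul]; exact congrArg B hc⟩⟩

lemma continuous_modelLift (B : Eu n ≃L[ℝ] Eu n) : Continuous (modelLift B) :=
  Continuous.subtype_mk ((B.continuous.comp (continuous_fst.comp continuous_subtype_val)).prodMk
    ((continuous_projMap' B).comp (continuous_snd.comp continuous_subtype_val))) _

/-- Continuity across the exceptional locus uses linearity in the chart: in model coordinates the
lift is `modelLift B` there. -/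
lemma continuous_liftMap [T1Space M] (k : M ≃ₜ M) (hk : k p = p) (B : Eu n ≃L[ℝ] Eu n)
    (hB : ∀ᶠ x in 𝓝 p, k x = (centeredChart n p).symm (B (centeredChart n p x))) :
    Continuous (liftMap k hk B) := by
  rw [continuous_iff_continuousAt]
  intro v
  cases v with
  | off x =>
    refine isOpenEmbedding_off.continuousAt_iff.1 (Continuous.continuousAt ?_)
    exact continuous_off.comp (Continuous.subtype_mk
      (k.continuous.comp continuous_subtype_val) _)
  | exc l =>
    have h0 := modelMap_modelExc (p := p) l
    rw [show Blowup.exc l = modelMap p (modelExc p l) from h0.symm]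
    refine isOpenEmbedding_modelMap.continuousAt_iff.1 ?_
    have h1 : ContinuousAt (fun z : ModelPart n p => modelMapTotal p (modelLift B z.1))
        (modelExc p l) := by
      refine ContinuousAt.comp (g := modelMapTotal p) (f := fun z : ModelPart n p =>
        modelLift B z.1) (continuousAt_modelMapTotal ?_)
        ((continuous_modelLift B).comp continuous_subtype_val).continuousAt
      change B 0 ∈ _
      rw [map_zero]
      exact zero_mem_centeredChart_target p
    refine h1.congr ?_
    have t1 : Tendsto (fun z : ModelPart n p => z.1.1.1) (𝓝 (modelExc p l)) (𝓝 0) :=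
      continuous_modelPart_fst.tendsto (modelExc p l)
    have t2 : Tendsto B (𝓝 0) (𝓝 0) := by simpa using B.continuous.tendsto 0
    have h2 : ∀ᶠ y in 𝓝 (0 : Eu n), y ∈ (centeredChart n p).target :=
      (centeredChart n p).open_target.mem_nhds (zero_mem_centeredChart_target p)
    filter_upwards [(t2.comp t1).eventually h2,
      ((tendsto_centeredChart_symm p).comp t1).eventually hB] with z hz hkz
    have hz' : (modelLift B z.1).1.1 ∈ (centeredChart n p).target := hz
    rw [modelMapTotal_of_mem hz']
    simp only [Function.comp_apply] at hkz ⊢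
    rw [(centeredChart n p).right_inv (modelPart_mem_target z)] at hkz
    by_cases hz0 : z.1.1.1 = 0
    · have hz1 : B z.1.1.1 = 0 := by rw [hz0, map_zero]
      rw [modelMap_of_eq_zero hz0]
      exact modelMap_of_eq_zero (z := (⟨modelLift B z.1, hz'⟩ : ModelPart n p)) hz1
    · have hz1 : B z.1.1.1 ≠ 0 := (map_ne_zero_iff B B.injective).2 hz0
      rw [modelMap_of_ne_zero hz0]
      exact (modelMap_of_ne_zero (z := (⟨modelLift B z.1, hz'⟩ : ModelPart n p)) hz1).trans
        (congrArg Blowup.off (Subtype.ext hkz.symm))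

lemma liftMap_leftInverse {k k' : M ≃ₜ M} (hk : k p = p) (hk' : k' p = p)
    {B C : Eu n ≃L[ℝ] Eu n} (hkk' : ∀ x, k (k' x) = x) (hBC : ∀ v, B (C v) = v) (v : Blowup n p) :
    liftMap k hk B (liftMap k' hk' C v) = v := by
  cases v with
  | off x => exact congrArg Blowup.off (Subtype.ext (hkk' x.1))
  | exc l => exact congrArg (excMap p) (projMap_leftInverse hBC l)

/-- The lift to the blowup of a homeomorphism that is linear in the chart at `p`. -/
def liftHomeo [T1Space M] (k : M ≃ₜ M) (hk : k p = p) (B : Eu n ≃L[ℝ] Eu n)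
    (hB : ∀ᶠ x in 𝓝 p, k x = (centeredChart n p).symm (B (centeredChart n p x))) :
    Blowup n p ≃ₜ Blowup n p where
  toFun := liftMap k hk B
  invFun := liftMap k.symm (by rw [k.symm_apply_eq, hk]) B.symm
  left_inv := liftMap_leftInverse _ _ k.symm_apply_apply B.symm_apply_apply
  right_inv := liftMap_leftInverse _ _ k.apply_symm_apply B.apply_symm_apply
  continuous_toFun := continuous_liftMap k hk B hB
  continuous_invFun := by
    have hk' : k.symm p = p := by rw [k.symm_apply_eq, hk]
    refine continuous_liftMap k.symm hk' B.symm ?_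
    have t1 : Tendsto k.symm (𝓝 p) (𝓝 p) := by simpa [hk'] using k.symm.continuous.tendsto p
    have t2 : Tendsto B (𝓝 0) (𝓝 0) := by simpa using B.continuous.tendsto 0
    have h2 : ∀ᶠ y in 𝓝 (0 : Eu n), y ∈ (centeredChart n p).target :=
      (centeredChart n p).open_target.mem_nhds (zero_mem_centeredChart_target p)
    have h3 : ∀ᶠ x in 𝓝 p, x ∈ (centeredChart n p).source :=
      (centeredChart n p).open_source.mem_nhds (mem_centeredChart_source p)
    filter_upwards [t1.eventually hB, t1.eventually h3,
      (t2.comp ((tendsto_centeredChart p).comp t1)).eventually h2] with x h4 h5 h6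
    simp only [Function.comp_apply] at h6
    rw [k.apply_symm_apply] at h4
    conv_rhs => rw [h4]
    rw [(centeredChart n p).right_inv h6, B.symm_apply_apply, (centeredChart n p).left_inv h5]

end Lift

/-! ### The blowup induced by a conjugacy -/

section Induced

variable {n : ℕ} {M : Type*} [TopologicalSpace M] [ChartedSpace (Eu n) M] {p : M}

lemma isTopologicalBlowup [T2Space M] [SecondCountableTopology M] (hn : 2 ≤ n) (φ : M ≃ₜ M)
    (hφ : φ p = p) : IsTopologicalBlowup n (φ ∘ blowdown p : Blowup n p → M) p := by
  have hpre : (φ ∘ blowdown p) ⁻¹' {p} = range (excMap p : ℙ ℝ (Eu n) → _) := by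
    rw [← preimage_blowdown_singleton]
    ext v
    simp only [mem_preimage, Function.comp_apply, mem_singleton_iff]
    exact ⟨fun h => φ.injective (h.trans hφ.symm), fun h => by rw [h, hφ]⟩
  have : ConnectedSpace (ℙ ℝ (Eu n)) := connectedSpace_proj <| by
    rw [← Module.finrank_eq_rank, finrank_euclideanSpace_fin]
    exact_mod_cast hn
  have hc : Continuous (excMap p : ℙ ℝ (Eu n) → _) := isEmbedding_excMap.continuous
  refine ⟨isTopManifold_blowup p, φ.isQuotientMap.comp (isQuotientMap_blowdown (by omega) p),
    ?_, ?_, ?_⟩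
  · rw [hpre]
    exact isConnected_range hc
  · rw [hpre]
    exact isCompact_range hc
  · have hmem : ∀ v : Blowup n p, v ∉ (φ ∘ blowdown p) ⁻¹' {p} → φ (blowdown p v) ≠ p :=
      fun v hv h => hv h
    have hne : ∀ x : {x : M // x ≠ p}, φ.symm x.1 ≠ p := fun x h => x.2 (by
      rw [φ.symm_apply_eq, hφ] at h; exact h)
    refine ⟨⟨⟨fun v => ⟨φ (blowdown p v.1), hmem v.1 v.2⟩,
      fun x => ⟨.off ⟨φ.symm x.1, hne x⟩, ?_⟩, ?_, ?_⟩, ?_, ?_⟩, fun v => rfl⟩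
    · change ¬ φ (φ.symm x.1) = p
      rw [φ.apply_symm_apply]
      exact x.2
    · rintro ⟨v, hv⟩
      refine Subtype.ext ?_
      cases v with
      | off x => exact congrArg Blowup.off (Subtype.ext (φ.symm_apply_apply x.1))
      | exc l => exact absurd hφ hv
    · rintro ⟨x, hx⟩
      exact Subtype.ext (φ.apply_symm_apply x)
    · exact Continuous.subtype_mk (φ.continuous.comp
        (continuous_blowdown.comp continuous_subtype_val)) _
    · exact Continuous.subtype_mk (continuous_off.comp (Continuous.subtype_mk
        (φ.symm.continuous.comp continuous_subtype_val) _)) _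

/-- A local conjugacy with a smooth diffeomorphism that is linear in the chart induces a blowup. -/
theorem exists_isConjugacyInduced [T2Space M] [SecondCountableTopology M] (hn : 2 ≤ n)
    (h : M ≃ₘ^1⟮𝓡 n, 𝓡 n⟯ M) (hp : h p = p) (g : M ≃ₘ^∞⟮𝓡 n, 𝓡 n⟯ M) (hg : g p = p)
    (φ : M ≃ₜ M) {B : Eu n ≃L[ℝ] Eu n} (hB : B = derivAt (by simp) g p hg) (hyp : IsHyperbolic B)
    (hφ : φ p = p) (hconj : ∀ᶠ x in 𝓝 p, φ (g x) = h (φ x))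
    (hgB : ∀ᶠ x in 𝓝 p, g x = (centeredChart n p).symm (B (centeredChart n p x))) :
    ∃ (q : Blowup n p → M) (h' : Blowup n p ≃ₜ Blowup n p),
      IsConjugacyInduced h p q h' ∧
      excFix q h' p = excMap p '' Function.fixedPoints (projMap B) := by
  -- The map lifted is φ⁻¹hφ rather than `g`: it satisfies the commutation with `h` on all of `M`,
  -- and agrees with `g` near `p`.
  let k : M ≃ₜ M := (φ.trans h.toHomeomorph).trans φ.symm
  have hk : ∀ x, k x = φ.symm (h (φ x)) := fun _ => rfl
  have hkp : k p = p := by rw [hk, hφ, hp, φ.symm_apply_eq, hφ]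
  have hkg : ∀ᶠ x in 𝓝 p, k x = g x := by
    filter_upwards [hconj] with x hx
    rw [hk, ← hx, φ.symm_apply_apply]
  have hkB : ∀ᶠ x in 𝓝 p, k x = (centeredChart n p).symm (B (centeredChart n p x)) := by
    filter_upwards [hkg, hgB] with x h1 h2
    rw [h1, h2]
  have hq : ∀ v : Blowup n p, (φ ∘ blowdown p) v = p ↔ blowdown p v = p := fun v =>
    ⟨fun h => φ.injective (h.trans hφ.symm), fun h => by rw [Function.comp_apply, h, hφ]⟩
  have hlift : ∀ v, liftHomeo k hkp B hkB v = liftMap k hkp B v := fun _ => rfl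
  refine ⟨φ ∘ blowdown p, liftHomeo k hkp B hkB, ⟨⟨hp, isTopologicalBlowup hn φ hφ,
    (liftHomeo k hkp B hkB).continuous, ?_⟩, g, hg, φ, ?_, hφ, hconj, rfl, ?_⟩, ?_⟩
  · funext v
    simp only [Function.comp_apply, hlift, blowdown_liftMap, hk, φ.apply_symm_apply]
  · rw [← hB]
    exact hyp
  · obtain ⟨N, hN, hNo, hpN⟩ := eventually_nhds_iff.1 hkg
    have hsub : (φ ∘ blowdown p) ⁻¹' {p} ⊆ blowdown (n := n) p ⁻¹' N := by
      intro v hv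
      have : blowdown p v = p := (hq v).1 hv
      rw [mem_preimage, this]
      exact hpN
    filter_upwards [(hNo.preimage continuous_blowdown).mem_nhdsSet.2 hsub] with v hv
    cases v with
    | off x => exact congrArg Blowup.off (Subtype.ext (hN x.1 hv))
    | exc l =>
      subst hB
      rfl
  · ext v
    simp only [excFix, mem_inter_iff, mem_preimage, mem_singleton_iff, hq]
    constructor
    · rintro ⟨h1, h2⟩
      cases v with
      | off x => exact absurd h1 x.2
      | exc l => exact ⟨l, Blowup.exc.inj h2, rfl⟩
    · rintro ⟨l, hl, rfl⟩
      exact ⟨rfl, congrArg (excMap p) hl⟩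

end Induced

/-! ### The lines fixed by a linear automorphism -/

section FixedLines

open scoped RealInnerProductSpace

variable {n : ℕ} (B : Eu n ≃L[ℝ] Eu n)

/-- The dimension of the space of eigenvectors. -/
def eigenDim {E : Type*} [AddCommGroup E] [Module ℝ E] (T : E →ₗ[ℝ] E) (c : ℝ) : ℕ :=
  Module.finrank ℝ (Module.End.eigenspace T c)

variable {B}

lemma mk_mem_fixedPoints_iff {v : Eu n} (hv : v ≠ 0) :
    Projectivization.mk ℝ v hv ∈ Function.fixedPoints (projMap B) ↔ ∃ c : ℝ, B v = c • v := by
  rw [Function.mem_fixedPoints, Function.IsFixedPt, projMap_mk, Projectivization.mk_eq_mk_iff']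
  exact ⟨fun ⟨c, h⟩ => ⟨c, h.symm⟩, fun ⟨c, h⟩ => ⟨c, h.symm⟩⟩

lemma exists_unit_eigenvector {l : ℙ ℝ (Eu n)} (hl : l ∈ Function.fixedPoints (projMap B)) :
    ∃ (v : Eu n) (hv : v ≠ 0) (c : ℝ), ‖v‖ = 1 ∧ B v = c • v ∧ l = Projectivization.mk ℝ v hv := by
  induction l with | h m hm =>
  obtain ⟨c, hc⟩ := (mk_mem_fixedPoints_iff hm).1 hl
  have hm' : ‖m‖ ≠ 0 := norm_ne_zero_iff.2 hm
  refine ⟨‖m‖⁻¹ • m, smul_ne_zero (inv_ne_zero hm') hm, c, by simp [norm_smul, hm'], ?_, ?_⟩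
  · rw [map_smul, hc, smul_comm]
  · exact ((Projectivization.mk_eq_mk_iff' ℝ _ _ _ _).2 ⟨‖m‖⁻¹, rfl⟩).symm

lemma slope_of_mem_fixedPoints {v : Eu n} {l : ℙ ℝ (Eu n)}
    (hl : l ∈ Function.fixedPoints (projMap B)) (h : slope v l ≠ 0) :
    B (slope v l) = ⟪B (slope v l), v⟫ • slope v l := by
  rw [← mk_slope h] at hl
  obtain ⟨c, hc⟩ := (mk_mem_fixedPoints_iff h).1 hl
  have : ⟪B (slope v l), v⟫ = c := by
    rw [hc, real_inner_smul_left, inner_slope h, mul_one]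
  rw [this, hc]

/-- On fixed lines in the affine chart the eigenvalue is a continuous function with values in a
finite set, hence locally constant. -/
lemma isOpen_eigenlines (v : Eu n) (c : ℝ) :
    IsOpen {l : Function.fixedPoints (projMap B) | slope v l.1 ≠ 0 ∧
      B (slope v l.1) = c • slope v l.1} := by
  let s : Set ℝ := {a | Module.End.HasEigenvalue (B : Eu n →ₗ[ℝ] Eu n) a} \ {c}
  have hs : IsClosed s := by
    refine Set.Finite.isClosed (Set.Finite.subset ?_ sdiff_subset)
    exact Module.End.finite_hasEigenvalue _
  have h1 : {l : Function.fixedPoints (projMap B) | slope v l.1 ≠ 0 ∧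
      B (slope v l.1) = c • slope v l.1} =
      {l : Function.fixedPoints (projMap B) | slope v l.1 ≠ 0 ∧ ⟪B (slope v l.1), v⟫ ∈ sᶜ} := by
    ext l
    refine and_congr_right fun h => ?_
    have h2 := slope_of_mem_fixedPoints l.2 h
    constructor
    · intro h3 h4
      refine h4.2 ?_
      rw [mem_singleton_iff, h3, real_inner_smul_left, inner_slope h, mul_one]
    · intro h3
      by_cases h4 : ⟪B (slope v l.1), v⟫ = c
      · rw [h4] at h2
        exact h2
      · exact absurd ⟨Module.End.hasEigenvalue_of_hasEigenvector
          ⟨Module.End.mem_eigenspace_iff.2 h2, h⟩, h4⟩ h3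
  rw [h1, isOpen_iff_mem_nhds]
  rintro l ⟨h2, h3⟩
  have h4 : ContinuousAt (fun l : Function.fixedPoints (projMap B) => slope v l.1) l :=
    (continuousAt_slope h2).comp continuousAt_subtype_val
  have h5 : ContinuousAt (fun l : Function.fixedPoints (projMap B) => ⟪B (slope v l.1), v⟫) l :=
    (B.continuous.continuousAt.comp h4).inner continuousAt_const
  exact inter_mem (((isOpen_slope_ne_zero v).preimage continuous_subtype_val).mem_nhds h2)
    (h5.preimage_mem_nhds (hs.isOpen_compl.mem_nhds h3))

/-- The lines of eigenvectors near a given one form a Euclidean space. -/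
def eigenlinesHomeo {v : Eu n} {c : ℝ} (hv : ‖v‖ = 1) (hc : B v = c • v) :
    {l : Function.fixedPoints (projMap B) | slope v l.1 ≠ 0 ∧ B (slope v l.1) = c • slope v l.1} ≃ₜ
      ((Submodule.span ℝ {v})ᗮ ⊓ Module.End.eigenspace (B : Eu n →ₗ[ℝ] Eu n) c :
        Submodule ℝ (Eu n)) := by
  have hw : ∀ w : ((Submodule.span ℝ {v})ᗮ ⊓ Module.End.eigenspace (B : Eu n →ₗ[ℝ] Eu n) c :
      Submodule ℝ (Eu n)), ⟪v + w.1, v⟫ = 1 ∧ B (v + w.1) = c • (v + w.1) := by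
    intro w
    have h1 : ⟪w.1, v⟫ = 0 := by
      rw [real_inner_comm]
      exact Submodule.mem_orthogonal_singleton_iff_inner_right.1 w.2.1
    have h2 : B w.1 = c • w.1 := Module.End.mem_eigenspace_iff.1 w.2.2
    refine ⟨by rw [inner_add_left, h1, real_inner_self_eq_norm_sq, hv]; norm_num, ?_⟩
    rw [map_add, hc, h2, smul_add]
  have hw0 : ∀ w : ((Submodule.span ℝ {v})ᗮ ⊓ Module.End.eigenspace (B : Eu n →ₗ[ℝ] Eu n) c :
      Submodule ℝ (Eu n)), v + w.1 ≠ 0 := by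
    intro w h
    have h1 := (hw w).1
    rw [h, inner_zero_left] at h1
    exact zero_ne_one h1
  refine ⟨⟨fun l => ⟨slope v l.1.1 - v, ?_, ?_⟩,
    fun w => ⟨⟨Projectivization.mk ℝ (v + w.1) (hw0 w),
      (mk_mem_fixedPoints_iff (hw0 w)).2 ⟨c, (hw w).2⟩⟩, ?_⟩, ?_, ?_⟩, ?_, ?_⟩
  · rw [SetLike.mem_coe, Submodule.mem_orthogonal_singleton_iff_inner_right, inner_sub_right,
      real_inner_comm, inner_slope l.2.1, real_inner_self_eq_norm_sq, hv]
    norm_num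
  · refine Module.End.mem_eigenspace_iff.2 ?_
    change B (slope v l.1.1 - v) = _
    rw [map_sub, hc, l.2.2, smul_sub]
  · change slope v (Projectivization.mk ℝ (v + w.1) (hw0 w)) ≠ 0 ∧
      B (slope v (Projectivization.mk ℝ (v + w.1) (hw0 w))) =
        c • slope v (Projectivization.mk ℝ (v + w.1) (hw0 w))
    rw [slope_mk_of_inner_eq_one _ (hw w).1]
    exact ⟨hw0 w, (hw w).2⟩
  · intro l
    refine Subtype.ext (Subtype.ext ?_)
    simp only [add_sub_cancel]
    exact mk_slope l.2.1
  · intro w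
    refine Subtype.ext ?_
    change slope v (Projectivization.mk ℝ (v + w.1) (hw0 w)) - v = w.1
    rw [slope_mk_of_inner_eq_one _ (hw w).1, add_sub_cancel_left]
  · refine Continuous.subtype_mk (Continuous.sub ?_ continuous_const) _
    refine continuous_iff_continuousAt.2 fun l => ?_
    exact ContinuousAt.comp (f := fun l : {l : Function.fixedPoints (projMap B) | slope v l.1 ≠ 0 ∧
      B (slope v l.1) = c • slope v l.1} => l.1.1) (continuousAt_slope l.2.1)
      (continuous_subtype_val.comp continuous_subtype_val).continuousAt
  · exact Continuous.subtype_mk (Continuous.subtype_mk (continuous_projMk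
      (continuous_const.add continuous_subtype_val) _) _) _

/-- Nearby fixed lines are spanned by v + w with w an eigenvector orthogonal to v or zero, so one
dimension of the eigenspace is lost. -/
lemma exists_nhds_homeo_fixedPoints {v : Eu n} {c : ℝ} (hv : ‖v‖ = 1) (hc : B v = c • v)
    (x : Function.fixedPoints (projMap B)) (hx : slope v x.1 = v) {m : ℕ}
    (hm : eigenDim (B : Eu n →ₗ[ℝ] Eu n) c = m + 1) :
    ∃ U : Set (Function.fixedPoints (projMap B)), IsOpen U ∧ x ∈ U ∧ Nonempty (U ≃ₜ Eu m) := by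
  have hv0 : v ≠ 0 := by rintro rfl; simp at hv
  refine ⟨_, isOpen_eigenlines v c, ?_, ⟨(eigenlinesHomeo hv hc).trans
    (ContinuousLinearEquiv.ofFinrankEq (𝕜 := ℝ) ?_).toHomeomorph⟩⟩
  · change slope v x.1 ≠ 0 ∧ B (slope v x.1) = c • slope v x.1
    rw [hx]
    exact ⟨hv0, hc⟩
  · have h1 : Submodule.span ℝ {v} ≤ Module.End.eigenspace (B : Eu n →ₗ[ℝ] Eu n) c := by
      rw [Submodule.span_singleton_le_iff_mem]
      exact Module.End.mem_eigenspace_iff.2 hc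
    have h2 := Submodule.finrank_add_inf_finrank_orthogonal h1
    rw [finrank_span_singleton hv0] at h2
    rw [finrank_euclideanSpace_fin]
    unfold eigenDim at hm
    omega

lemma eigenDim_pos_of_eigenvector {E : Type*} [AddCommGroup E] [Module ℝ E] [Module.Finite ℝ E]
    {T : E →ₗ[ℝ] E} {v : E} (hv : v ≠ 0) {c : ℝ} (hc : T v = c • v) : 0 < eigenDim T c :=
  have : Nontrivial (Module.End.eigenspace T c) :=
    ⟨⟨v, Module.End.mem_eigenspace_iff.2 hc⟩, 0, fun h => hv (congrArg Subtype.val h)⟩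
  Module.finrank_pos

lemma exists_unit_eigenvector_of_eigenDim_pos {c : ℝ}
    (h : 0 < eigenDim (B : Eu n →ₗ[ℝ] Eu n) c) : ∃ v : Eu n, ‖v‖ = 1 ∧ B v = c • v := by
  have : Nontrivial (Module.End.eigenspace (B : Eu n →ₗ[ℝ] Eu n) c) :=
    Module.nontrivial_of_finrank_pos (R := ℝ) h
  obtain ⟨m, hm⟩ := exists_ne (0 : Module.End.eigenspace (B : Eu n →ₗ[ℝ] Eu n) c)
  have hm0 : ‖m.1‖ ≠ 0 := norm_ne_zero_iff.2 fun h => hm (Subtype.ext h)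
  have hc : B m.1 = c • m.1 := Module.End.mem_eigenspace_iff.1 m.2
  exact ⟨‖m.1‖⁻¹ • m.1, by simp [norm_smul, hm0], by rw [map_smul, hc, smul_comm]⟩

lemma slope_mk_self {v : Eu n} (hv : ‖v‖ = 1) (hv0 : v ≠ 0) :
    slope v (Projectivization.mk ℝ v hv0) = v :=
  slope_mk_of_inner_eq_one hv0 (by rw [real_inner_self_eq_norm_sq, hv]; norm_num)

lemma fixedPoints_eq_empty (h : ∀ c, eigenDim (B : Eu n →ₗ[ℝ] Eu n) c = 0) :
    Function.fixedPoints (projMap B) = ∅ := by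
  refine eq_empty_of_forall_notMem fun l hl => ?_
  obtain ⟨v, hv, c, -, hc, -⟩ := exists_unit_eigenvector hl
  exact (eigenDim_pos_of_eigenvector (T := (B : Eu n →ₗ[ℝ] Eu n)) hv hc).ne' (h c)

/-- If the spaces of eigenvectors have dimension at most `d + 1`, with equality for one of them,
then the fixed lines form a manifold of dimension `d`. -/
theorem hasManifoldDim_fixedPoints {d : ℕ}
    (h : ∀ c, eigenDim (B : Eu n →ₗ[ℝ] Eu n) c ≤ d + 1) {a : ℝ}
    (ha : eigenDim (B : Eu n →ₗ[ℝ] Eu n) a = d + 1) :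
    HasManifoldDim d (Function.fixedPoints (projMap B)) := by
  constructor
  · rintro ⟨l, hl⟩
    obtain ⟨v, hv, c, hv1, hc, rfl⟩ := exists_unit_eigenvector hl
    have h1 := eigenDim_pos_of_eigenvector (T := (B : Eu n →ₗ[ℝ] Eu n)) hv hc
    have h2 := h c
    obtain ⟨m, hm⟩ := Nat.exists_eq_succ_of_ne_zero h1.ne'
    exact ⟨m, by omega, exists_nhds_homeo_fixedPoints hv1 hc _ (slope_mk_self hv1 hv) hm⟩
  · obtain ⟨v, hv1, hc⟩ := exists_unit_eigenvector_of_eigenDim_pos (B := B) (c := a) (by omega)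
    have hv : v ≠ 0 := by rintro rfl; simp at hv1
    exact ⟨⟨Projectivization.mk ℝ v hv, (mk_mem_fixedPoints_iff hv).2 ⟨a, hc⟩⟩,
      exists_nhds_homeo_fixedPoints hv1 hc _ (slope_mk_self hv1 hv) ha⟩

/-- If the spaces of eigenvectors are lines, there are as many fixed lines as eigenvalues. -/
theorem ncard_fixedPoints {ι : Type*} [Finite ι] {a : ι → ℝ} (hinj : Function.Injective a)
    (h : ∀ c, eigenDim (B : Eu n →ₗ[ℝ] Eu n) c ≤ 1)
    (ha : ∀ c, 0 < eigenDim (B : Eu n →ₗ[ℝ] Eu n) c ↔ c ∈ range a) :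
    (Function.fixedPoints (projMap B)).ncard = Nat.card ι := by
  choose v hv1 hv using fun i => exists_unit_eigenvector_of_eigenDim_pos ((ha (a i)).2 ⟨i, rfl⟩)
  have hv0 : ∀ i, v i ≠ 0 := fun i h0 => by have := hv1 i; simp [h0] at this
  have h1 : Function.fixedPoints (projMap B) = range fun i => Projectivization.mk ℝ (v i) (hv0 i) := by
    refine Subset.antisymm ?_ ?_
    · intro l hl
      obtain ⟨w, hw, c, -, hc, rfl⟩ := exists_unit_eigenvector hl
      have h2 := eigenDim_pos_of_eigenvector (T := (B : Eu n →ₗ[ℝ] Eu n)) hw hc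
      obtain ⟨i, rfl⟩ := (ha c).1 h2
      refine ⟨i, ?_⟩
      have h3 := finrank_le_one_iff.1 (h (a i))
      obtain ⟨u, hu⟩ := h3
      obtain ⟨r, hr⟩ := hu ⟨w, Module.End.mem_eigenspace_iff.2 hc⟩
      obtain ⟨t, ht⟩ := hu ⟨v i, Module.End.mem_eigenspace_iff.2 (hv i)⟩
      have hr' : r • u.1 = w := congrArg Subtype.val hr
      have ht' : t • u.1 = v i := congrArg Subtype.val ht
      have hr0 : r ≠ 0 := by rintro rfl; rw [zero_smul] at hr'; exact hw hr'.symm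
      refine (Projectivization.mk_eq_mk_iff' ℝ _ _ _ _).2 ⟨t * r⁻¹, ?_⟩
      rw [← hr', ← ht', smul_smul, inv_mul_cancel_right₀ hr0]
    · rintro _ ⟨i, rfl⟩
      exact (mk_mem_fixedPoints_iff _).2 ⟨_, hv i⟩
  rw [h1, ← Set.image_univ, Set.ncard_image_of_injective, Set.ncard_univ]
  -- Lines of eigenvectors that coincide have the same eigenvalue, hence the same index.
  intro i i' hii
  obtain ⟨r, hr⟩ := (Projectivization.mk_eq_mk_iff' ℝ _ _ _ _).1 hii
  apply hinj
  have h2 : a i • v i = a i' • v i := by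
    rw [← hv i, ← hr, map_smul, hv i', smul_comm]
  exact smul_left_injective ℝ (hv0 i) h2

lemma HasManifoldDim.congr {d : ℕ} {X Y : Type*} [TopologicalSpace X] [TopologicalSpace Y]
    (h : HasManifoldDim d X) (e : X ≃ₜ Y) : HasManifoldDim d Y := by
  have key : ∀ (m : ℕ) (x : X), (∃ U : Set X, IsOpen U ∧ x ∈ U ∧ Nonempty (U ≃ₜ Eu m)) →
      ∃ U : Set Y, IsOpen U ∧ e x ∈ U ∧ Nonempty (U ≃ₜ Eu m) := by
    rintro m x ⟨U, hU, hx, ⟨f⟩⟩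
    exact ⟨e '' U, e.isOpenMap U hU, mem_image_of_mem e hx, ⟨(e.image U).symm.trans f⟩⟩
  refine ⟨fun y => ?_, ?_⟩
  · obtain ⟨m, hm, h1⟩ := h.1 (e.symm y)
    have h2 := key m _ h1
    rw [e.apply_symm_apply] at h2
    exact ⟨m, hm, h2⟩
  · obtain ⟨x, h1⟩ := h.2
    exact ⟨e x, key d x h1⟩

lemma HasManifoldDim.discreteTopology {X : Type*} [TopologicalSpace X] (h : HasManifoldDim 0 X) :
    DiscreteTopology X := by
  refine discreteTopology_iff_isOpen_singleton.2 fun x => ?_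
  obtain ⟨m, hm, U, hU, hx, ⟨e⟩⟩ := h.1 x
  obtain rfl : m = 0 := by omega
  convert hU
  refine Subset.antisymm (singleton_subset_iff.2 hx) fun y hy => ?_
  exact congrArg Subtype.val (e.injective (Subsingleton.elim (e ⟨y, hy⟩) (e ⟨x, hx⟩)))

end FixedLines

/-! ### Stable automorphisms with prescribed eigenvalues -/

section Models

/-- The segment from 1 to `T` stays invertible: a kernel vector at time t > 0 would be an
eigenvector for -(1-t)/t, which is nonpositive. -/
lemma mem_pathComponentIn_of_no_nonpos_eigenvalue {E : Type*} [NormedAddCommGroup E]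
    [NormedSpace ℝ E] [FiniteDimensional ℝ E] {T : E →L[ℝ] E}
    (h : ∀ c : ℝ, c ≤ 0 → ∀ v, T v = c • v → v = 0) : T ∈ pathComponentIn {S : E →L[ℝ] E | IsUnit S} 1 := by
  have hseg : ∀ t : unitInterval, IsUnit ((1 - (t : ℝ)) • (1 : E →L[ℝ] E) + (t : ℝ) • T) := by
    intro t
    have hinj : Function.Injective ((1 - (t : ℝ)) • (1 : E →L[ℝ] E) + (t : ℝ) • T) := by
      rw [injective_iff_map_eq_zero]
      intro v hv
      have hv' : (1 - (t : ℝ)) • v + (t : ℝ) • T v = 0 := hv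
      rcases t.2.1.eq_or_lt with h0 | h0
      · rw [← h0] at hv'
        simpa using hv'
      · refine h (-((1 - (t : ℝ)) / t)) ?_ v ?_
        · have := t.2.2
          have : 0 ≤ (1 - (t : ℝ)) / t := div_nonneg (by linarith) h0.le
          linarith
        · have h1 : (t : ℝ) • T v = -((1 - (t : ℝ)) • v) := by
            rw [eq_neg_iff_add_eq_zero, add_comm]
            exact hv'
          have h2 := congrArg ((t : ℝ)⁻¹ • ·) h1
          simp only [smul_smul, inv_mul_cancel₀ h0.ne', one_smul, smul_neg] at h2
          rw [h2, neg_smul, div_eq_inv_mul]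
    rw [ContinuousLinearMap.isUnit_iff_bijective]
    exact ⟨hinj, LinearMap.surjective_of_injective
      (f := (((1 - (t : ℝ)) • (1 : E →L[ℝ] E) + (t : ℝ) • T : E →L[ℝ] E) : E →ₗ[ℝ] E)) hinj⟩
  refine JoinedIn.ofLine (f := fun t => (1 - t) • (1 : E →L[ℝ] E) + t • T) ?_ ?_ ?_ ?_
  · fun_prop
  · simp
  · simp
  · rintro _ ⟨t, ht, rfl⟩
    exact hseg ⟨t, ht⟩

/-- Multiplication by the given numbers on some coordinates, and by `i / 2` on the others. -/
def diagModel {ι κ : Type} [Fintype ι] [Fintype κ] (b : ι → ℝ) :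
    ((ι → ℝ) × (κ → ℂ)) →ₗ[ℝ] (ι → ℝ) × (κ → ℂ) where
  toFun z := (fun i => b i * z.1 i, fun i => Complex.I / 2 * z.2 i)
  map_add' z w := by
    ext i <;> simp [mul_add]
  map_smul' c z := by
    ext i <;> simp <;> ring

/-- Multiplication by i/2 has no real eigenvector, so the complex coordinates contribute nothing. -/
lemma diagModel_eq_smul_iff {ι κ : Type} [Fintype ι] [Fintype κ] (b : ι → ℝ)
    (z : (ι → ℝ) × (κ → ℂ)) (c : ℝ) :
    diagModel b z = c • z ↔ (∀ i, b i = c ∨ z.1 i = 0) ∧ z.2 = 0 := by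
  rw [Prod.ext_iff, funext_iff, funext_iff, funext_iff]
  refine and_congr (forall_congr' fun i => ?_) (forall_congr' fun i => ?_)
  · change b i * z.1 i = c * z.1 i ↔ _
    exact mul_eq_mul_right_iff
  · change Complex.I / 2 * z.2 i = c • z.2 i ↔ z.2 i = 0
    rw [Complex.real_smul, mul_eq_mul_right_iff, or_iff_right]
    intro h
    have := congrArg Complex.im h
    simp at this

lemma tendsto_diagModel {ι κ : Type} [Fintype ι] [Fintype κ] {b : ι → ℝ}
    (hb : ∀ i, b i ∈ Ioo (0 : ℝ) 1) (z : (ι → ℝ) × (κ → ℂ)) :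
    Tendsto (fun k : ℕ => (diagModel b)^[k] z) atTop (𝓝 0) := by
  have h : ∀ k : ℕ, (diagModel b)^[k] z =
      (fun i => b i ^ k * z.1 i, fun i => (Complex.I / 2) ^ k * z.2 i) := by
    intro k
    induction k with
    | zero => simp
    | succ k ih =>
      rw [Function.iterate_succ_apply', ih]
      refine Prod.ext (funext fun i => ?_) (funext fun i => ?_)
      · change b i * (b i ^ k * z.1 i) = b i ^ (k + 1) * z.1 i
        ring
      · change Complex.I / 2 * ((Complex.I / 2) ^ k * z.2 i) = (Complex.I / 2) ^ (k + 1) * z.2 i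
        ring
  simp only [h]
  refine Tendsto.prodMk_nhds (tendsto_pi_nhds.2 fun i => ?_) (tendsto_pi_nhds.2 fun i => ?_)
  · simpa using (tendsto_pow_atTop_nhds_zero_of_lt_one (hb i).1.le (hb i).2).mul_const (z.1 i)
  · simpa using (tendsto_pow_atTop_nhds_zero_of_norm_lt_one (x := Complex.I / 2)
      (by simp; norm_num)).mul_const (z.2 i)

lemma eigenDim_diagModel {ι κ : Type} [Fintype ι] [Fintype κ] (b : ι → ℝ) (c : ℝ) :
    eigenDim (diagModel (κ := κ) b) c = Nat.card {i // b i = c} := by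
  classical
  let f : Module.End.eigenspace (diagModel (κ := κ) b) c →ₗ[ℝ] ({i // b i = c} → ℝ) :=
    { toFun := fun z i => z.1.1 i
      map_add' := fun _ _ => rfl
      map_smul' := fun _ _ => rfl }
  have hf : Function.Bijective f := by
    constructor
    · rw [injective_iff_map_eq_zero]
      rintro ⟨z, hz⟩ h
      obtain ⟨h1, h2⟩ := (diagModel_eq_smul_iff b z c).1 (Module.End.mem_eigenspace_iff.1 hz)
      refine Subtype.ext (Prod.ext (funext fun i => ?_) h2)
      by_cases hi : b i = c
      · exact congrFun h ⟨i, hi⟩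
      · exact (h1 i).resolve_left hi
    · intro x
      refine ⟨⟨(fun i => if hi : b i = c then x ⟨i, hi⟩ else 0, 0),
        Module.End.mem_eigenspace_iff.2 ((diagModel_eq_smul_iff b _ c).2 ⟨fun i => ?_, rfl⟩)⟩, ?_⟩
      · by_cases hi : b i = c
        · exact Or.inl hi
        · exact Or.inr (dif_neg hi)
      · funext i
        exact dif_pos i.2
  have := (LinearEquiv.ofBijective f hf).finrank_eq
  rw [Module.finrank_fintype_fun_eq_card] at this
  rw [eigenDim, this, Nat.card_eq_fintype_card]

lemma eigenDim_conj {E F : Type*} [AddCommGroup E] [Module ℝ E] [AddCommGroup F] [Module ℝ F]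
    (e : E ≃ₗ[ℝ] F) {S : E →ₗ[ℝ] E} {T : F →ₗ[ℝ] F} (h : ∀ v, e (S v) = T (e v)) (c : ℝ) :
    eigenDim S c = eigenDim T c := by
  have h1 : (Module.End.eigenspace S c).map (e : E →ₗ[ℝ] F) = Module.End.eigenspace T c := by
    ext w
    obtain ⟨v, rfl⟩ := e.surjective w
    rw [Module.End.mem_eigenspace_iff, ← h, ← map_smul, e.injective.eq_iff]
    simp
  rw [eigenDim, eigenDim, ← h1]
  exact (e.submoduleMap (Module.End.eigenspace S c)).finrank_eq

/-- There is a stable automorphism with prescribed real eigenvalues in the unit interval, as long as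
the number of the remaining dimensions is even. -/
theorem exists_mem_stableAut_eigenDim {E : Type} [NormedAddCommGroup E] [NormedSpace ℝ E]
    [FiniteDimensional ℝ E] {j : ℕ} (hj : j ≤ Module.finrank ℝ E)
    (he : Even (Module.finrank ℝ E - j)) {b : Fin j → ℝ} (hb : ∀ i, b i ∈ Ioo (0 : ℝ) 1) :
    ∃ S ∈ stableAut E, ∀ c, eigenDim (S : E →ₗ[ℝ] E) c = Nat.card {i // b i = c} := by
  obtain ⟨l, hl⟩ := he
  let e : E ≃L[ℝ] (Fin j → ℝ) × (Fin l → ℂ) := ContinuousLinearEquiv.ofFinrankEq (by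
    rw [Module.finrank_prod, Module.finrank_fin_fun, Module.finrank_pi_fintype]
    simp [Complex.finrank_real_complex]
    omega)
  let S : E →L[ℝ] E := (e.symm : _ →L[ℝ] E) ∘L (LinearMap.toContinuousLinearMap (diagModel (κ := Fin l) b)) ∘L
    (e : E →L[ℝ] _)
  have hS : ∀ v, e (S v) = diagModel b (e v) := fun v => e.apply_symm_apply _
  have hSk : ∀ v (k : ℕ), (S ^ k) v = e.symm ((diagModel b)^[k] (e v)) := by
    intro v k
    induction k with
    | zero => simp
    | succ k ih =>
      rw [pow_succ', Function.iterate_succ_apply']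
      change S ((S ^ k) v) = _
      rw [e.eq_symm_apply, hS, ih, e.apply_symm_apply]
  refine ⟨S, ⟨fun v => ?_, mem_pathComponentIn_of_no_nonpos_eigenvalue fun c hc v hv => ?_⟩,
    fun c => ?_⟩
  · simp only [hSk]
    have := (e.symm.continuous.tendsto 0).comp (tendsto_diagModel hb (e v))
    rwa [map_zero] at this
  · have h1 : diagModel b (e v) = c • e v := by rw [← hS, hv, map_smul]
    obtain ⟨h2, h3⟩ := (diagModel_eq_smul_iff b _ c).1 h1
    have h4 : e v = 0 := Prod.ext (funext fun i =>
      (h2 i).resolve_left fun h => by linarith [(hb i).1]) h3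
    exact (map_eq_zero_iff e e.injective).1 h4
  · rw [← eigenDim_diagModel (κ := Fin l)]
    exact eigenDim_conj e.toLinearEquiv hS c

/-- The eigenvectors of a split automorphism. -/
lemma eigenDim_splitMap {X E E' : Type} [NormedAddCommGroup X] [NormedSpace ℝ X]
    [NormedAddCommGroup E] [NormedSpace ℝ E] [NormedAddCommGroup E']
    [NormedSpace ℝ E'] [FiniteDimensional ℝ E] [FiniteDimensional ℝ E'] (e : X ≃L[ℝ] E × E')
    {S : E →L[ℝ] E} {W : E' →L[ℝ] E'} (hW : IsUnit W) {c : ℝ} (hc : c ≠ 0) :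
    eigenDim (splitMap e S W : X →ₗ[ℝ] X) c =
      eigenDim (S : E →ₗ[ℝ] E) c + eigenDim (W : E' →ₗ[ℝ] E') c⁻¹ := by
  obtain ⟨w, rfl⟩ := hW
  have hw : ∀ y, (↑w⁻¹ : E' →L[ℝ] E') y = c • y ↔ (w : E' →L[ℝ] E') y = c⁻¹ • y := by
    intro y
    have h1 : (w : E' →L[ℝ] E') ((↑w⁻¹ : E' →L[ℝ] E') y) = y := by
      rw [← mul_apply_eq_comp, Units.mul_inv]; rfl
    have h2 : (↑w⁻¹ : E' →L[ℝ] E') ((w : E' →L[ℝ] E') y) = y := by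
      rw [← mul_apply_eq_comp, Units.inv_mul]; rfl
    constructor
    · intro h
      rw [h, map_smul] at h1
      rw [eq_inv_smul_iff₀ hc, h1]
    · intro h
      rw [h, map_smul] at h2
      rw [← inv_smul_eq_iff₀ hc, h2]
  have hmem : ∀ x, x ∈ Module.End.eigenspace (splitMap e S w : X →ₗ[ℝ] X) c ↔
      (e x).1 ∈ Module.End.eigenspace (S : E →ₗ[ℝ] E) c ∧
      (e x).2 ∈ Module.End.eigenspace (w : E' →ₗ[ℝ] E') c⁻¹ := by
    intro x
    rw [Module.End.mem_eigenspace_iff, Module.End.mem_eigenspace_iff, Module.End.mem_eigenspace_iff]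
    change e.symm (S (e x).1, Ring.inverse (w : E' →L[ℝ] E') (e x).2) = c • x ↔
      S (e x).1 = c • (e x).1 ∧ (w : E' →L[ℝ] E') (e x).2 = c⁻¹ • (e x).2
    rw [Ring.inverse_unit, ← hw, e.symm_apply_eq, map_smul, Prod.ext_iff]
    rfl
  let f : Module.End.eigenspace (splitMap e S w : X →ₗ[ℝ] X) c ≃ₗ[ℝ]
      Module.End.eigenspace (S : E →ₗ[ℝ] E) c × Module.End.eigenspace (w : E' →ₗ[ℝ] E') c⁻¹ :=
    { toFun := fun x => (⟨(e x.1).1, ((hmem x).1 x.2).1⟩, ⟨(e x.1).2, ((hmem x).1 x.2).2⟩)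
      invFun := fun z => ⟨e.symm (z.1.1, z.2.1), (hmem _).2 (by
        rw [e.apply_symm_apply]
        exact ⟨z.1.2, z.2.2⟩)⟩
      left_inv := fun x => Subtype.ext (e.symm_apply_apply x.1)
      right_inv := fun z => by
        refine Prod.ext (Subtype.ext ?_) (Subtype.ext ?_)
        · exact congrArg Prod.fst (e.apply_symm_apply (z.1.1, z.2.1))
        · exact congrArg Prod.snd (e.apply_symm_apply (z.1.1, z.2.1))
      map_add' := fun x y => by
        refine Prod.ext (Subtype.ext ?_) (Subtype.ext ?_)
        · exact congrArg Prod.fst (map_add e x.1 y.1)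
        · exact congrArg Prod.snd (map_add e x.1 y.1)
      map_smul' := fun r x => by
        refine Prod.ext (Subtype.ext ?_) (Subtype.ext ?_)
        · exact congrArg Prod.fst (map_smul e r x.1)
        · exact congrArg Prod.snd (map_smul e r x.1) }
  rw [eigenDim, f.finrank_eq, Module.finrank_prod]
  rfl

end Models

/-! ### Prescribing the multiplicities of the real eigenvalues. -/

section Main

/-- Numbers in the unit interval: `1 / 2`, repeated `d + 1` times, followed by distinct smaller
ones. -/
def multipliers (d i : ℕ) : ℝ := if i ≤ d then 1 / 2 else 1 / (i + 2)

lemma multipliers_mem_Ioo (d i : ℕ) : multipliers d i ∈ Ioo (0 : ℝ) 1 := by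
  unfold multipliers
  split_ifs
  · constructor <;> norm_num
  · refine ⟨by positivity, ?_⟩
    rw [div_lt_one (by positivity)]
    have : (0 : ℝ) ≤ i := i.cast_nonneg
    linarith

lemma eq_of_multipliers_eq {d i i' : ℕ} (h : multipliers d i = multipliers d i') :
    i = i' ∨ (i ≤ d ∧ i' ≤ d) := by
  have key : ∀ {m : ℕ}, ¬ m ≤ d → (1 : ℝ) / (m + 2) ≠ 1 / 2 := by
    intro m hm h
    have hm' : (0 : ℝ) < m := by exact_mod_cast (by omega : 0 < m)
    have := inv_injective (by simpa only [one_div] using h)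
    linarith
  unfold multipliers at h
  split_ifs at h with h1 h2 h2
  · exact Or.inr ⟨h1, h2⟩
  · exact absurd h.symm (key h2)
  · exact absurd h (key h1)
  · left
    have := inv_injective (by simpa only [one_div] using h)
    exact_mod_cast add_right_cancel this

lemma injective_multipliers_zero : Function.Injective (multipliers 0) := by
  intro i i' h
  rcases eq_of_multipliers_eq h with h | ⟨h1, h2⟩
  · exact h
  · omega

/-- The number of times that a number occurs among the first `j` multipliers. -/
def multiplierCount (d j : ℕ) (c : ℝ) : ℕ := Nat.card {i : Fin j // multipliers d i = c}

lemma multiplierCount_le (d j : ℕ) (c : ℝ) : multiplierCount d j c ≤ d + 1 := by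
  let f : {i : Fin j // multipliers d i = c} → Fin (d + 1) := fun i =>
    if h : i.1.1 ≤ d then ⟨i.1.1, by omega⟩ else 0
  have hf : Function.Injective f := by
    intro i i' h
    refine Subtype.ext (Fin.ext ?_)
    rcases eq_of_multipliers_eq (i.2.trans i'.2.symm) with h1 | ⟨h1, h2⟩
    · exact h1
    · simp only [f, dif_pos h1, dif_pos h2] at h
      exact Fin.mk.inj h
  simpa [multiplierCount] using Nat.card_le_card_of_injective f hf

lemma multiplierCount_half {d j : ℕ} (h : d < j) : multiplierCount d j (1 / 2) = d + 1 := by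
  refine le_antisymm (multiplierCount_le d j _) ?_
  let f : Fin (d + 1) → {i : Fin j // multipliers d i = 1 / 2} := fun i =>
    ⟨⟨i.1, by omega⟩, if_pos (by change i.1 ≤ d; omega)⟩
  have hf : Function.Injective f := fun i i' h =>
    Fin.ext (congrArg (fun x : {i : Fin j // multipliers d i = 1 / 2} => x.1.1) h)
  simpa [multiplierCount] using Nat.card_le_card_of_injective f hf

lemma multiplierCount_pos_iff {d j : ℕ} {c : ℝ} :
    0 < multiplierCount d j c ↔ ∃ i : Fin j, multipliers d i = c := by
  rw [multiplierCount, Nat.card_pos_iff]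
  exact ⟨fun h => h.1.elim fun i => ⟨i.1, i.2⟩, fun ⟨i, hi⟩ => ⟨⟨i, hi⟩, inferInstance⟩⟩

lemma multiplierCount_eq_zero {d j : ℕ} {c : ℝ} (hc : c ∉ Ioo (0 : ℝ) 1) : multiplierCount d j c = 0 := by
  by_contra h
  obtain ⟨i, rfl⟩ := multiplierCount_pos_iff.1 (Nat.pos_of_ne_zero h)
  exact hc (multipliers_mem_Ioo d i)

/-- A number and its inverse are never both in (0,1): stable and unstable eigenvalues do not
collide, so multiplicities do not add. -/
lemma multiplierCount_eq_zero_or (d j d' j' : ℕ) (c : ℝ) :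
    multiplierCount d j c = 0 ∨ multiplierCount d' j' c⁻¹ = 0 := by
  by_cases hc : c ∈ Ioo (0 : ℝ) 1
  · right
    exact multiplierCount_eq_zero fun h => (one_lt_inv₀ hc.1).2 hc.2 |>.not_gt h.2
  · exact Or.inl (multiplierCount_eq_zero hc)

lemma multiplierCount_add_le (d j d' j' : ℕ) (c : ℝ) :
    multiplierCount d j c + multiplierCount d' j' c⁻¹ ≤ max d d' + 1 := by
  have h1 := multiplierCount_le d j c
  have h2 := multiplierCount_le d' j' c⁻¹
  rcases multiplierCount_eq_zero_or d j d' j' c with h | h <;> omega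

variable {n : ℕ} {M : Type*} [TopologicalSpace M] [ChartedSpace (Eu n) M] {p : M}

/-- A fixed point that preserves the orientations of its stable and unstable subspaces has a blowup
whose derivative has prescribed real eigenvalues. -/
theorem exists_isConjugacyInduced_eigenDim [T2Space M] [SecondCountableTopology M]
    [IsManifold (𝓡 n) ∞ M] (hn : 2 ≤ n)
    (h : M ≃ₘ^1⟮𝓡 n, 𝓡 n⟯ M) (hp : h p = p) {A : Eu n ≃L[ℝ] Eu n}
    (hA : A = derivAt one_ne_zero h p hp) (hyp : IsHyperbolic A)
    (hos : PreservesStableOrientation A) (hou : PreservesUnstableOrientation A)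
    (d d' : ℕ) {j j' : ℕ} (hj : j ≤ Module.finrank ℝ (stableSubspace A))
    (hj' : j' ≤ Module.finrank ℝ (unstableSubspace A))
    (he : Even (Module.finrank ℝ (stableSubspace A) - j))
    (he' : Even (Module.finrank ℝ (unstableSubspace A) - j')) :
    ∃ (q : Blowup n p → M) (h' : Blowup n p ≃ₜ Blowup n p) (B : Eu n ≃L[ℝ] Eu n),
      IsConjugacyInduced h p q h' ∧
      excFix q h' p = excMap p '' Function.fixedPoints (projMap B) ∧
      ∀ c, eigenDim (B : Eu n →ₗ[ℝ] Eu n) c = multiplierCount d j c + multiplierCount d' j' c⁻¹ := by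
  obtain ⟨e, S, hS, W, hW, hASW⟩ := hyp.exists_eq_splitMap hos hou
  obtain ⟨S', hS', hSe⟩ := exists_mem_stableAut_eigenDim hj he
    (b := fun i => multipliers d i) fun i => multipliers_mem_Ioo d i
  obtain ⟨W', hW', hWe⟩ := exists_mem_stableAut_eigenDim hj' he'
    (b := fun i => multipliers d' i) fun i => multipliers_mem_Ioo d' i
  have hSu := isUnit_of_mem_pathComponentIn hS'.2
  have hWu := isUnit_of_mem_pathComponentIn hW'.2
  obtain ⟨u, hu⟩ := isUnit_splitMap e hSu hWu
  let B : Eu n ≃L[ℝ] Eu n := ContinuousLinearEquiv.ofUnit u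
  have hB : (B : Eu n →L[ℝ] Eu n) = splitMap e S' W' := hu
  have hBs : SplitHyperbolic (B : Eu n →L[ℝ] Eu n) := by
    rw [hB]
    exact splitHyperbolic_splitMap e hS'.1 hSu hW'.1 hWu
  have hAs : SplitHyperbolic (A : Eu n →L[ℝ] Eu n) := by
    rw [hASW]
    exact splitHyperbolic_splitMap e hS.1 (isUnit_of_mem_pathComponentIn hS.2) hW.1
      (isUnit_of_mem_pathComponentIn hW.2)
  have hAB : ∀ R, 0 < R → GermConj R (A : Eu n → Eu n) (B : Eu n → Eu n) := by
    intro R hR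
    have := germConj_splitMap e hS hW hS' hW' hR
    rw [← hASW, ← hB] at this
    exact this
  obtain ⟨g, hg, φ, hBg, hφ, hconj, hgB⟩ := exists_conjugate_diffeo h hp hA hAs hAB (by
    rw [hB]
    exact splitMap_mem_pathComponentIn e hS' hW')
  obtain ⟨q, h', h1, h2⟩ := exists_isConjugacyInduced hn h hp g hg φ hBg hBs.isHyperbolic hφ hconj
    hgB
  refine ⟨q, h', B, h1, h2, fun c => ?_⟩
  -- The value 0 is separate: both counts vanish since 0⁻¹ = 0 is not in (0,1), and `B` has no
  -- kernel.
  rcases eq_or_ne c 0 with rfl | hc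
  · rw [inv_zero, multiplierCount_eq_zero (by simp), multiplierCount_eq_zero (by simp)]
    by_contra h0
    obtain ⟨v, hv, hv0⟩ := exists_unit_eigenvector_of_eigenDim_pos (Nat.pos_of_ne_zero h0)
    rw [zero_smul, map_eq_zero_iff B B.injective] at hv0
    simp [hv0] at hv
  · have h3 := eigenDim_splitMap e (S := S') hWu hc
    rw [← hB] at h3
    exact h3.trans (congrArg₂ (· + ·) (hSe c) (hWe c⁻¹))

lemma hasManifoldDim_excFix [T1Space M] {q : Blowup n p → M} {h' : Blowup n p ≃ₜ Blowup n p}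
    {B : Eu n ≃L[ℝ] Eu n} (hq : excFix q h' p = excMap p '' Function.fixedPoints (projMap B))
    {d : ℕ} (h : HasManifoldDim d (Function.fixedPoints (projMap B))) :
    HasManifoldDim d (excFix q h' p) := by
  rw [hq]
  exact h.congr (isEmbedding_excMap.homeomorphImage _)

end Main

end PointBlowup

end

/-! ### The three choices of eigenvalues. -/

theorem mainTheorem4 {n : ℕ} (hn : 0 < n)
    {M : Type*} [TopologicalSpace M] [T2Space M] [SecondCountableTopology M]
    [ChartedSpace (PointBlowup.Eu n) M] [IsManifold (𝓡 n) ∞ M]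
    (h : M ≃ₘ^1⟮𝓡 n, 𝓡 n⟯ M) (p : M) (hp : h p = p)
    (A : TangentSpace (𝓡 n) p ≃L[ℝ] TangentSpace (𝓡 n) p)
    (hA : A = PointBlowup.derivAt one_ne_zero h p hp)
    (hyp : PointBlowup.IsHyperbolic A)
    (hs : Even (Module.finrank ℝ (PointBlowup.stableSubspace A)))
    (hu : Even (Module.finrank ℝ (PointBlowup.unstableSubspace A)))
    (hos : PointBlowup.PreservesStableOrientation A)
    (hou : PointBlowup.PreservesUnstableOrientation A) :
    (∃ (q : PointBlowup.Blowup n p → M) (h' : PointBlowup.Blowup n p ≃ₜ PointBlowup.Blowup n p),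
      PointBlowup.IsConjugacyInduced h p q h' ∧
      PointBlowup.excFix q h' p = ∅) ∧
    (∀ k : ℕ, Even k → 2 ≤ k → k ≤ n →
      ∃ (q : PointBlowup.Blowup n p → M) (h' : PointBlowup.Blowup n p ≃ₜ PointBlowup.Blowup n p),
        PointBlowup.IsConjugacyInduced h p q h' ∧
        DiscreteTopology (PointBlowup.excFix q h' p) ∧
        (PointBlowup.excFix q h' p).ncard = k) ∧
    (∀ d : ℕ, 1 ≤ d →
      d + 1 ≤ max (Module.finrank ℝ (PointBlowup.unstableSubspace A))
        (Module.finrank ℝ (PointBlowup.stableSubspace A)) →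
      ∃ (q : PointBlowup.Blowup n p → M) (h' : PointBlowup.Blowup n p ≃ₜ PointBlowup.Blowup n p),
        PointBlowup.IsConjugacyInduced h p q h' ∧
        PointBlowup.HasManifoldDim d (PointBlowup.excFix q h' p)) := by
  open PointBlowup in
  have hdim : Module.finrank ℝ (stableSubspace A) + Module.finrank ℝ (unstableSubspace A) = n := by
    have h1 := Submodule.finrank_add_eq_of_isCompl (IsHyperbolic.isCompl (V := Eu n) hyp)
    rw [finrank_euclideanSpace_fin] at h1
    exact h1
  -- A positive sum of two even dimensions.
  have hn2 : 2 ≤ n := by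
    obtain ⟨a, ha⟩ := hs
    obtain ⟨b, hb⟩ := hu
    omega
  have key := exists_isConjugacyInduced_eigenDim hn2 h hp hA hyp hos hou
  refine ⟨?_, fun k hk hk2 hkn => ?_, fun d hd hdm => ?_⟩
  · obtain ⟨q, h', B, h1, h2, h3⟩ := key 0 0 (Nat.zero_le _) (Nat.zero_le _) hs hu
    refine ⟨q, h', h1, ?_⟩
    rw [h2, fixedPoints_eq_empty, image_empty]
    intro c
    rw [h3]
    simp [multiplierCount]
  · obtain ⟨j, j', hj, hj', he, he', hjk⟩ : ∃ j j', j ≤ Module.finrank ℝ (stableSubspace A) ∧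
        j' ≤ Module.finrank ℝ (unstableSubspace A) ∧
        Even (Module.finrank ℝ (stableSubspace A) - j) ∧
        Even (Module.finrank ℝ (unstableSubspace A) - j') ∧ j + j' = k := by
      -- The stable subspace takes as many of the k eigenvalues as it can hold; both shares are
      -- even, so the complementary dimensions are too.
      refine ⟨min k (Module.finrank ℝ (stableSubspace A)),
        k - min k (Module.finrank ℝ (stableSubspace A)), by omega, by omega, ?_, ?_, by omega⟩
      · rcases min_choice k (Module.finrank ℝ (stableSubspace A)) with h0 | h0 <;> rw [h0]
        · exact hs.tsub hk
        · exact hs.tsub hs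
      · refine hu.tsub (hk.tsub ?_)
        rcases min_choice k (Module.finrank ℝ (stableSubspace A)) with h0 | h0 <;> rw [h0]
        · exact hk
        · exact hs
    obtain ⟨q, h', B, h1, h2, h3⟩ := key 0 0 hj hj' he he'
    have hle : ∀ c, eigenDim (B : Eu n →ₗ[ℝ] Eu n) c ≤ 0 + 1 := fun c => by
      rw [h3]
      exact multiplierCount_add_le 0 j 0 j' c
    let a : Fin j ⊕ Fin j' → ℝ :=
      Sum.elim (fun i => multipliers 0 i) fun i => (multipliers 0 i)⁻¹
    have ha : Function.Injective a := by
      refine Function.Injective.sumElim (injective_multipliers_zero.comp Fin.val_injective)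
        (inv_injective.comp (injective_multipliers_zero.comp Fin.val_injective)) fun i i' hi => ?_
      have h4 := multipliers_mem_Ioo 0 i
      have h5 := multipliers_mem_Ioo 0 i'
      have h6 := (one_lt_inv₀ h5.1).2 h5.2
      rw [← hi] at h6
      exact h6.not_gt h4.2
    have hrange : ∀ c, 0 < eigenDim (B : Eu n →ₗ[ℝ] Eu n) c ↔ c ∈ range a := by
      intro c
      rw [h3, Nat.add_pos_iff_pos_or_pos, multiplierCount_pos_iff, multiplierCount_pos_iff]
      simp only [mem_range, Sum.exists, a, Sum.elim_inl, Sum.elim_inr, inv_eq_iff_eq_inv]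
    have hcard : (Function.fixedPoints (projMap B)).ncard = k := by
      rw [ncard_fixedPoints ha hle hrange]
      simp [hjk]
    have hpos : (Function.fixedPoints (projMap B)).Nonempty :=
      Set.nonempty_of_ncard_ne_zero (by omega)
    obtain ⟨l, hl⟩ := hpos
    obtain ⟨v, hv, c, -, hc, -⟩ := exists_unit_eigenvector hl
    have hc1 := eigenDim_pos_of_eigenvector (T := (B : Eu n →ₗ[ℝ] Eu n)) hv hc
    -- Discreteness is the case of dimension 0, all eigenspaces being lines.
    have hdisc := hasManifoldDim_excFix h2
      (hasManifoldDim_fixedPoints hle (a := c) (le_antisymm (hle c) hc1))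
    refine ⟨q, h', h1, hdisc.discreteTopology, ?_⟩
    rw [h2, ncard_image_of_injective _ isEmbedding_excMap.injective, hcard]
  · have hee : ∀ m : ℕ, Even (m - m) := fun m => by simp
    rcases le_max_iff.1 hdm with hdu | hds
    -- All eigenvalues are real. On the unstable side 2 is the inverse of the multiplier 1/2 and has
    -- multiplicity d + 1; all others are simple.
    · obtain ⟨q, h', B, h1, h2, h3⟩ := key 0 d le_rfl le_rfl (hee _) (hee _)
      refine ⟨q, h', h1, hasManifoldDim_excFix h2 (hasManifoldDim_fixedPoints (a := 2)
        (fun c => ?_) ?_)⟩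
      · rw [h3]
        exact (multiplierCount_add_le _ _ _ _ c).trans (by simp)
      · rw [h3, multiplierCount_eq_zero (by simp), ← one_div, zero_add]
        exact multiplierCount_half hdu
    · obtain ⟨q, h', B, h1, h2, h3⟩ := key d 0 le_rfl le_rfl (hee _) (hee _)
      refine ⟨q, h', h1, hasManifoldDim_excFix h2 (hasManifoldDim_fixedPoints (a := 1 / 2)
        (fun c => ?_) ?_)⟩
      · rw [h3]
        exact (multiplierCount_add_le _ _ _ _ c).trans (by simp)
      · rw [h3, multiplierCount_eq_zero (d := 0) (by norm_num), add_zero]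
        exact multiplierCount_half hds
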